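/- **Setting.** Let $\mathfrak g$ be a finite-dimensional complex Lie algebra, $\lambda\in\mathbb C$, and let $U\subseteq\mathbb C^4$ be an open region of complexified space-time with coordinates $x^{\alpha\dot\alpha}$ (e.g. $U=\mathbb C^4$). Let $\theta^{a\alpha}$ ($a=1,\dots,4$, $\alpha=0,1$) be the odd coordinates of chiral superspace $\mathbb M^{4|8}$. Super-fields are $\mathfrak g$-valued polynomials in the $\theta^{a\alpha}$ and in finitely many auxiliary odd constants, with coefficients holomorphic on $U$; $[\cdot,\cdot\}$ denotes the graded Lie bracket (written $\{\cdot,\cdot\}$ between odd fields), $\partial_{a\alpha}=\partial/\partial\theta^{a\alpha}$ acts from the left, and $\mathcal D=\theta^{a\alpha}\partial_{a\alpha}$. Spinor indices are moved by $V^\alpha=\varepsilon^{\alpha\beta}V_\beta$, $V_\beta=V^\alpha\varepsilon_{\alpha\beta}$, $\varepsilon^{01}=\varepsilon_{01}=1$, likewise for dotted indices; (anti)symmetrisation has weight one and never exchanges dotted with undotted indices; repeated indices are summed. A super-connection is $\nabla_{\alpha\dot\alpha}=\partial_{\alpha\dot\alpha}+A_{\alpha\dot\alpha}$, $\nabla_{a\alpha}=\partial_{a\alpha}+A_{a\alpha}$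 with $A_{\alpha\dot\alpha}$ even and $A_{a\alpha}$ odd; covariant derivatives act on super-fields through the bracket. Write $[\nabla_{\alpha\dot\alpha},\nabla_{\beta\dot\beta}]=\varepsilon_{\alpha\beta}\tilde F_{\dot\alpha\dot\beta}+\varepsilon_{\dot\alpha\dot\beta}F_{\alpha\beta}$ with $\tilde F,F$ symmetric, and $\square=\nabla^{\alpha\dot\alpha}\nabla_{\alpha\dot\alpha}$. A multiplet consists of super-fields $\tilde\psi_{a\dot\alpha},\psi^a_\alpha$ (odd) and $\phi_{ab}=-\phi_{ba}$, $B_{\alpha\beta}=B_{\beta\alpha}$ (even); put $\phi^{ab}=\frac12\epsilon^{abcd}\phi_{cd}$. The $\mathcal N=4$ field equations are $$\nabla^\beta_{\dot\alpha}B_{\alpha\beta}=-\{\tilde\psi_{a\dot\alpha},\psi^a_\alpha\}-\tfrac12[\phi_{ab},\nabla_{\alpha\dot\alpha}\phi^{ab}],\qquad \nabla_\alpha^{\dot\alpha}\tilde\psi_{a\dot\alpha}=2\lambda[\psi^b_\alpha,\phi_{ab}],\qquad \nabla^\alpha_{\dot\alpha}\psi^a_\alpha=[\tilde\psi_{b\dot\alpha},\phi^{ab}],$$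 $$\square\phi_{ab}=\{\tilde\psi_{\dot\alpha[a},\tilde\psi^{\dot\alpha}_{b]}\}+\lambda\epsilon_{abcd}\{\psi^c_\alpha,\psi^{d\alpha}\}-2\lambda[\phi_{c[a},[\phi^{cd},\phi_{b]d}]],\qquad F_{\alpha\beta}=\lambda B_{\alpha\beta}.$$ **Theorem.** (i) For every super-connection $A$ and every multiplet $\Phi=(\tilde\psi,\phi,\psi,B)$ the following are equivalent. 1. $[\nabla_{a(\alpha},\nabla_{\beta)\dot\beta}]=0$, $\{\nabla_{a(\alpha},\nabla_{\beta)b}\}=0$ and $F_{\alpha\beta}=\lambda B_{\alpha\beta}$, where $\Phi$ is the multiplet determined by $A$ through $[\nabla_{a\alpha},\nabla_{\beta\dot\alpha}]=\varepsilon_{\alpha\beta}\tilde\psi_{a\dot\alpha}$, $\{\nabla_{a\alpha},\nabla_{b\beta}\}=2\varepsilon_{\alpha\beta}\phi_{ab}$, $\psi^a_\alpha=-\frac1{3!}\epsilon^{abcd}\nabla_{b\alpha}\phi_{cd}$, $B_{\alpha\beta}=\frac14\nabla_{a(\alpha}\psi^a_{\beta)}$. 2. $A$ and $\Phi$ are related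 by $\theta^{a\alpha}[\nabla_{a\alpha},\nabla_{\beta\dot\beta}]=\theta^a_\beta\tilde\psi_{a\dot\beta}$, $\theta^{a\alpha}\{\nabla_{a\alpha},\nabla_{b\beta}\}=2\theta^a_\beta\phi_{ab}$, and $$\nabla_{a\alpha}\tilde F_{\dot\alpha\dot\beta}=\nabla_{\alpha(\dot\alpha}\tilde\psi_{\dot\beta)a},\quad \nabla_{a\alpha}\tilde\psi_{b\dot\alpha}=2\nabla_{\alpha\dot\alpha}\phi_{ab},\quad \nabla_{a\alpha}\phi_{bc}=\epsilon_{abcd}\psi^d_\alpha,$$ $$\nabla_{a\alpha}\psi^b_\beta=-\varepsilon_{\alpha\beta}[\phi_{ac},\phi^{bc}]+\delta^b_aB_{\alpha\beta},\quad \nabla_{a\alpha}B_{\beta\gamma}=-2\varepsilon_{\alpha(\beta}[\psi^b_{\gamma)},\phi_{ab}],\quad F_{\alpha\beta}=\lambda B_{\alpha\beta}.$$ 3. There is a gauge transformation $e^\omega$ with $\omega$ even and $\omega|_{\theta=0}=0$ such that the transformed fields (again denoted $A,\Phi$) are in radial gauge $\theta^{a\alpha}A_{a\alpha}=0$, satisfy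 the recursion relations $$\mathcal D\tilde F_{\dot\alpha\dot\beta}=\theta^{a\alpha}\nabla_{\alpha(\dot\alpha}\tilde\psi_{\dot\beta)a},\quad \mathcal D\tilde\psi_{a\dot\alpha}=-2\theta^{b\alpha}\nabla_{\alpha\dot\alpha}\phi_{ab},\quad \mathcal D\phi_{ab}=\epsilon_{abcd}\theta^{c\alpha}\psi^d_\alpha,$$ $$\mathcal D\psi^a_\alpha=\theta^{a\beta}B_{\alpha\beta}-\theta^b_\alpha[\phi_{bc},\phi^{ac}],\quad \mathcal DB_{\alpha\beta}=-2\theta^a_{(\alpha}[\psi^b_{\beta)},\phi_{ab}],\quad \mathcal DF_{\alpha\beta}=\lambda\mathcal DB_{\alpha\beta},$$ $$\mathcal DA_{\alpha\dot\alpha}=\theta^a_\alpha\tilde\psi_{a\dot\alpha},\quad (1+\mathcal D)A_{a\alpha}=2\theta^b_\alpha\phi_{ba},$$ and their components at $\theta=0$ satisfy the $\mathcal N=4$ field equations. (ii) If (2) holds, then the super-fields $A_{\alpha\dot\alpha},\Phi$ satisfy the $\mathcal N=4$ field equations. (iii) Every set of ($\theta$-independent) component fields $(A_{\alpha\dot\alpha},\tilde\psi_{a\dot\alpha},\phi_{ab},\psi^a_\alpha,B_{\alpha\beta})$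 on $U$ satisfying the $\mathcal N=4$ field equations is the $\theta=0$ part of exactly one pair $(A,\Phi)$ in radial gauge that satisfies the recursion relations. -/

import Mathlib

open scoped TensorProduct
open TopologicalSpace

noncomputable section

namespace ChiralSuperspace

/-! ### Holomorphic functions on space-time -/

/-- Complexified Minkowski space, with the bispinor coordinates `x (α, α')` = `x^{α α'}`.
Undotted and dotted spinor indices both run over `Fin 2`. -/
abbrev Spacetime : Type := Fin 2 × Fin 2 → ℂ

/-- The algebra of holomorphic functions on an open region `U` of space-time. -/
def holSubalgebra (U : Opens Spacetime) : Subalgebra ℂ (U → ℂ) where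
  carrier := {f | ∃ F : Spacetime → ℂ, AnalyticOnNhd ℂ F (U : Set Spacetime) ∧ ∀ x : U, F x = f x}
  mul_mem' := by
    rintro f g ⟨F, hF, hf⟩ ⟨G, hG, hg⟩
    exact ⟨F * G, hF.mul hG, fun x => by simp [hf, hg]⟩
  add_mem' := by
    rintro f g ⟨F, hF, hf⟩ ⟨G, hG, hg⟩
    exact ⟨F + G, hF.add hG, fun x => by simp [hf, hg]⟩
  algebraMap_mem' := fun c => ⟨fun _ => c, analyticOnNhd_const, fun _ => rfl⟩

/-- Holomorphic functions on `U`, as a type. -/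
abbrev Hol (U : Opens Spacetime) : Type := holSubalgebra U

/-- Extension by zero of a holomorphic function on `U`; only its values on `U` matter. -/
def holExt {U : Opens Spacetime} (f : Hol U) : Spacetime → ℂ :=
  Function.extend Subtype.val f.1 0

theorem holExt_apply {U : Opens Spacetime} (f : Hol U) (x : U) : holExt f x = f.1 x :=
  Subtype.val_injective.extend_apply _ _ x

theorem holExt_eventuallyEq {U : Opens Spacetime} (f : Hol U) (G : Spacetime → ℂ)
    (h : ∀ x : U, G x = f.1 x) (x : U) : holExt f =ᶠ[nhds (x : Spacetime)] G := by
  filter_upwards [U.2.mem_nhds x.2] with y hy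
  rw [h ⟨y, hy⟩]
  exact holExt_apply f ⟨y, hy⟩

theorem analyticAt_holExt {U : Opens Spacetime} (f : Hol U) (x : U) :
    AnalyticAt ℂ (holExt f) x := by
  obtain ⟨F, hF, hf⟩ := f.2
  exact (hF x x.2).congr (holExt_eventuallyEq f F hf x).symm

/-- The partial derivative `∂_{α α'} = ∂/∂x^{α α'}` of holomorphic functions, `i = (α, α')`. -/
def holPd {U : Opens Spacetime} (i : Fin 2 × Fin 2) : Hol U →ₗ[ℂ] Hol U where
  toFun f := ⟨fun x => fderiv ℂ (holExt f) x (Pi.single i 1),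
    ⟨fun x => fderiv ℂ (holExt f) x (Pi.single i 1),
      fun x hx => AnalyticAt.comp
        (g := ContinuousLinearMap.apply ℂ ℂ (Pi.single i 1 : Spacetime))
        (ContinuousLinearMap.analyticAt _ _) (analyticAt_holExt f ⟨x, hx⟩).fderiv, fun _ => rfl⟩⟩
  map_add' f g := by
    ext x
    have h : holExt (f + g) =ᶠ[nhds (x : Spacetime)] holExt f + holExt g :=
      holExt_eventuallyEq _ _ (fun y => by simp [holExt_apply]) x
    change fderiv ℂ (holExt (f + g)) x (Pi.single i 1) =
      fderiv ℂ (holExt f) x (Pi.single i 1) + fderiv ℂ (holExt g) x (Pi.single i 1)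
    rw [h.fderiv_eq, fderiv_add (analyticAt_holExt f x).differentiableAt
      (analyticAt_holExt g x).differentiableAt]
    rfl
  map_smul' c f := by
    ext x
    have h : holExt (c • f) =ᶠ[nhds (x : Spacetime)] c • holExt f :=
      holExt_eventuallyEq _ _ (fun y => by simp [holExt_apply]) x
    change fderiv ℂ (holExt (c • f)) x (Pi.single i 1) =
      c • fderiv ℂ (holExt f) x (Pi.single i 1)
    rw [h.fderiv_eq, fderiv_const_smul (analyticAt_holExt f x).differentiableAt]
    rfl

/-! ### Grassmann algebra and super-fields -/

/-- The Grassmann algebra generated by `N` auxiliary odd constants `η_1, …, η_N` (in which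
the odd component fields take their values) and the eight odd coordinates `θ^{a α}`. -/
abbrev Gr (N : ℕ) : Type := ExteriorAlgebra ℂ (Fin N ⊕ (Fin 4 × Fin 2) → ℂ)

/-- Superfunctions on the part of chiral superspace over `U`: polynomials in the odd generators
with coefficients holomorphic on `U`. -/
abbrev SuperFun (N : ℕ) (U : Opens Spacetime) : Type := (Hol U) ⊗[ℂ] (Gr N)

instance (U : Opens Spacetime) : CommRing (Hol U) := inferInstance

instance (U : Opens Spacetime) : Algebra ℂ (Hol U) := inferInstance

instance (N : ℕ) : Ring (Gr N) := inferInstance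

instance (N : ℕ) : Algebra ℂ (Gr N) := inferInstance

instance (N : ℕ) (U : Opens Spacetime) : Ring (SuperFun N U) := Algebra.TensorProduct.instRing

instance (N : ℕ) (U : Opens Spacetime) : AddCommGroup (SuperFun N U) := Ring.toAddCommGroup

instance (N : ℕ) (U : Opens Spacetime) : Algebra ℂ (SuperFun N U) :=
  Algebra.TensorProduct.leftAlgebra

/-- Super-fields with values in the complex Lie algebra `𝔤`. -/
abbrev SuperField (N : ℕ) (U : Opens Spacetime) (𝔤 : Type*) [LieRing 𝔤] [LieAlgebra ℂ 𝔤] : Type _ :=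
  (SuperFun N U) ⊗[ℂ] 𝔤

variable {N : ℕ} {U : Opens Spacetime} {𝔤 : Type*} [LieRing 𝔤] [LieAlgebra ℂ 𝔤]

/-- A linear operator on the Grassmann algebra, applied to super-fields. -/
def onGr (T : Gr N →ₗ[ℂ] Gr N) : SuperField N U 𝔤 →ₗ[ℂ] SuperField N U 𝔤 :=
  (T.lTensor (Hol U)).rTensor 𝔤

/-- The derivative `∂_{α α'}` of super-fields. -/
def dx (α α' : Fin 2) : SuperField N U 𝔤 →ₗ[ℂ] SuperField N U 𝔤 :=
  ((holPd (α, α')).rTensor (Gr N)).rTensor 𝔤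

/-- The left odd derivative `∂_{a α} = ∂/∂θ^{a α}`. -/
def dth (a : Fin 4) (α : Fin 2) : SuperField N U 𝔤 →ₗ[ℂ] SuperField N U 𝔤 :=
  onGr (CliffordAlgebra.contractLeft (LinearMap.proj (Sum.inr (a, α))))

/-- Multiplication by `θ^{a α}` from the left. -/
def th (a : Fin 4) (α : Fin 2) : SuperField N U 𝔤 →ₗ[ℂ] SuperField N U 𝔤 :=
  onGr (LinearMap.mulLeft ℂ (ExteriorAlgebra.ι ℂ (Pi.single (Sum.inr (a, α)) 1)))

/-- The parity automorphism: `+1` on even and `-1` on odd super-fields. -/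
def parity : SuperField N U 𝔤 →ₗ[ℂ] SuperField N U 𝔤 :=
  onGr CliffordAlgebra.involute.toLinearMap

/-- The truncation of a super-field to `θ = 0`. -/
def body : SuperField N U 𝔤 →ₗ[ℂ] SuperField N U 𝔤 :=
  onGr (ExteriorAlgebra.map (LinearMap.pi
    (Sum.elim (fun i => LinearMap.proj (Sum.inl i)) fun _ => 0))).toLinearMap

/-- The bracket of `𝔤` as a bilinear map. -/
def lieBilin : 𝔤 →ₗ[ℂ] 𝔤 →ₗ[ℂ] 𝔤 :=
  LinearMap.mk₂ ℂ (fun X Y => ⁅X, Y⁆) (fun X Y Z => add_lie X Y Z) (fun c X Y => smul_lie c X Y)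
    (fun X Y Z => lie_add X Y Z) (fun c X Y => lie_smul c X Y)

/-- The graded Lie bracket `[f ⊗ X, g ⊗ Y} = f g ⊗ [X, Y]` of super-fields. For a matrix Lie algebra
and homogeneous arguments it is the supercommutator `P Q - (-1)^{|P||Q|} Q P`, i.e. the
anticommutator if both arguments are odd and the commutator otherwise. -/
def br : SuperField N U 𝔤 →ₗ[ℂ] SuperField N U 𝔤 →ₗ[ℂ] SuperField N U 𝔤 :=
  TensorProduct.map₂ (LinearMap.mul ℂ (SuperFun N U)) lieBilin

/-- A super-field is even. -/
def IsEven (f : SuperField N U 𝔤) : Prop := parity f = f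

/-- A super-field is odd. -/
def IsOdd (f : SuperField N U 𝔤) : Prop := parity f = -f

/-- The Euler operator `𝒟 = θ^{a α} ∂_{a α}`. -/
def euler (f : SuperField N U 𝔤) : SuperField N U 𝔤 := ∑ a, ∑ α, th a α (dth a α f)

/-! ### Levi-Civita symbols

Spinor indices are raised by `V^α = ε^{αβ} V_β` and lowered by `V_β = V^α ε_{αβ}`, likewise for
dotted indices, where `ε^{01} = ε_{01} = 1`. -/

/-- The two-index Levi-Civita symbol, used for both `ε_{αβ}` and `ε^{αβ}`. -/
def eps (α β : Fin 2) : ℂ := !![0, 1; -1, 0] α β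

/-- The four-index Levi-Civita symbol `ε_{abcd} = ε^{abcd}`, equal to `1` at `(0, 1, 2, 3)`. -/
def eps4 (a b c d : Fin 4) : ℂ :=
  Matrix.det (Matrix.of fun i j : Fin 4 => if ![a, b, c, d] i = j then (1 : ℂ) else 0)

/-- Multiplication from the left by `θ^a_α = θ^{a β} ε_{βα}`. -/
def thLow (a : Fin 4) (α : Fin 2) (f : SuperField N U 𝔤) : SuperField N U 𝔤 :=
  ∑ β, eps β α • th a β f

/-! ### Super-connections and their curvature -/

/-- The components `A_{α α'}` (`bos α α'`) and `A_{a α}` (`fer a α`) of a super-connection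
`∇_{α α'} = ∂_{α α'} + A_{α α'}`, `∇_{a α} = ∂_{a α} + A_{a α}` on chiral superspace. -/
@[ext]
structure SuperConnection (N : ℕ) (U : Opens Spacetime) (𝔤 : Type*)
    [LieRing 𝔤] [LieAlgebra ℂ 𝔤] where
  bos : Fin 2 → Fin 2 → SuperField N U 𝔤
  fer : Fin 4 → Fin 2 → SuperField N U 𝔤

/-- The components of a super-connection have the right Grassmann parity. -/
structure SuperConnection.IsGraded (A : SuperConnection N U 𝔤) : Prop where
  bos_even : ∀ α α', IsEven (A.bos α α')
  fer_odd : ∀ a α, IsOdd (A.fer a α)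

/-- `∇_{α α'} f` for a connection with bosonic components `A_{α α'}`. -/
def covB (A : Fin 2 → Fin 2 → SuperField N U 𝔤) (α α' : Fin 2) (f : SuperField N U 𝔤) :
    SuperField N U 𝔤 :=
  dx α α' f + br (A α α') f

/-- `∇_{a α} f`. -/
def covF (A : SuperConnection N U 𝔤) (a : Fin 4) (α : Fin 2) (f : SuperField N U 𝔤) :
    SuperField N U 𝔤 :=
  dth a α f + br (A.fer a α) f

/-- The curvature component `[∇_{α α'}, ∇_{β β'}]`. -/
def curvBB (A : Fin 2 → Fin 2 → SuperField N U 𝔤) (α α' β β' : Fin 2) : SuperField N U 𝔤 :=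
  dx α α' (A β β') - dx β β' (A α α') + br (A α α') (A β β')

/-- The curvature component `[∇_{a α}, ∇_{β β'}]`. -/
def curvFB (A : SuperConnection N U 𝔤) (a : Fin 4) (α β β' : Fin 2) : SuperField N U 𝔤 :=
  dth a α (A.bos β β') - dx β β' (A.fer a α) + br (A.fer a α) (A.bos β β')

/-- The curvature component `{∇_{a α}, ∇_{b β}}`. -/
def curvFF (A : SuperConnection N U 𝔤) (a : Fin 4) (α : Fin 2) (b : Fin 4) (β : Fin 2) :
    SuperField N U 𝔤 :=
  dth a α (A.fer b β) + dth b β (A.fer a α) + br (A.fer a α) (A.fer b β)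

/-- The self-dual part `F̃_{α'β'}` in
`[∇_{α α'}, ∇_{β β'}] = ε_{αβ} F̃_{α'β'} + ε_{α'β'} F_{αβ}`. -/
def Ftilde (A : Fin 2 → Fin 2 → SuperField N U 𝔤) (α' β' : Fin 2) : SuperField N U 𝔤 :=
  (1 / 2 : ℂ) • ∑ α, ∑ β, eps α β • curvBB A α α' β β'

/-- The anti-self-dual part `F_{αβ}` in
`[∇_{α α'}, ∇_{β β'}] = ε_{αβ} F̃_{α'β'} + ε_{α'β'} F_{αβ}`. -/
def Fasd (A : Fin 2 → Fin 2 → SuperField N U 𝔤) (α β : Fin 2) : SuperField N U 𝔤 :=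
  (1 / 2 : ℂ) • ∑ α', ∑ β', eps α' β' • curvBB A α α' β β'

/-! ### The N = 4 multiplet -/

/-- The fields `ψ̃_{a α'}`, `φ_{ab}`, `ψ^a_α`, `B_{αβ}` of the `N = 4` multiplet. -/
@[ext]
structure Multiplet (N : ℕ) (U : Opens Spacetime) (𝔤 : Type*)
    [LieRing 𝔤] [LieAlgebra ℂ 𝔤] where
  psiT : Fin 4 → Fin 2 → SuperField N U 𝔤
  phi : Fin 4 → Fin 4 → SuperField N U 𝔤
  psi : Fin 4 → Fin 2 → SuperField N U 𝔤
  B : Fin 2 → Fin 2 → SuperField N U 𝔤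

/-- Grassmann parities and index symmetries of the multiplet. -/
structure Multiplet.IsGraded (Φ : Multiplet N U 𝔤) : Prop where
  psiT_odd : ∀ a α', IsOdd (Φ.psiT a α')
  phi_even : ∀ a b, IsEven (Φ.phi a b)
  psi_odd : ∀ a α, IsOdd (Φ.psi a α)
  B_even : ∀ α β, IsEven (Φ.B α β)
  phi_skew : ∀ a b, Φ.phi a b = -Φ.phi b a
  B_symm : ∀ α β, Φ.B α β = Φ.B β α

/-- `φ^{ab} = ½ ε^{abcd} φ_{cd}`. -/
def upper (φ : Fin 4 → Fin 4 → SuperField N U 𝔤) (a b : Fin 4) : SuperField N U 𝔤 :=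
  (1 / 2 : ℂ) • ∑ c, ∑ d, eps4 a b c d • φ c d

/-- Apply a map to all components of a multiplet. -/
def Multiplet.map (T : SuperField N U 𝔤 → SuperField N U 𝔤) (Φ : Multiplet N U 𝔤) :
    Multiplet N U 𝔤 where
  psiT a α' := T (Φ.psiT a α')
  phi a b := T (Φ.phi a b)
  psi a α := T (Φ.psi a α)
  B α β := T (Φ.B α β)

/-! ### First formulation: constraint equations -/

/-- The scalar super-field of a super-connection: the part skew in `αβ` of the curvature, normalised
by `{∇_{a α}, ∇_{b β}} = 2 ε_{αβ} φ_{ab}`. -/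
def SuperConnection.phi (A : SuperConnection N U 𝔤) (a b : Fin 4) : SuperField N U 𝔤 :=
  (1 / 4 : ℂ) • ∑ α, ∑ β, eps α β • curvFF A a α b β

/-- The part skew in `αβ` of the curvature, normalised by
`[∇_{a α}, ∇_{β α'}] = ε_{αβ} ψ̃_{a α'}`. -/
def SuperConnection.psiT (A : SuperConnection N U 𝔤) (a : Fin 4) (α' : Fin 2) :
    SuperField N U 𝔤 :=
  (1 / 2 : ℂ) • ∑ α, ∑ β, eps α β • curvFB A a α β α'

/-- `ψ^a_α = -(1/3!) ε^{abcd} ∇_{b α} φ_{cd}`. -/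
def SuperConnection.psi (A : SuperConnection N U 𝔤) (a : Fin 4) (α : Fin 2) :
    SuperField N U 𝔤 :=
  -((1 / 6 : ℂ) • ∑ b, ∑ c, ∑ d, eps4 a b c d • covF A b α (A.phi c d))

/-- `B_{αβ} = ¼ ∇_{a(α} ψ^a_{β)}`, with symmetrisation of weight one. -/
def SuperConnection.B (A : SuperConnection N U 𝔤) (α β : Fin 2) : SuperField N U 𝔤 :=
  (1 / 4 : ℂ) • ∑ a, (1 / 2 : ℂ) • (covF A a α (A.psi a β) + covF A a β (A.psi a α))

/-- The multiplet determined by a super-connection. -/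
def SuperConnection.multiplet (A : SuperConnection N U 𝔤) : Multiplet N U 𝔤 where
  psiT := A.psiT
  phi := A.phi
  psi := A.psi
  B := A.B

/-- The constraint equations `[∇_{a(α}, ∇_{β)B}} = 0` for `B = β'` and for `B = b`, together
with `F_{αβ} = lam B_{αβ}`. -/
structure ConstraintEquations (lam : ℂ) (A : SuperConnection N U 𝔤) : Prop where
  fermi_bose : ∀ a α β β', curvFB A a α β β' + curvFB A a β α β' = 0
  fermi_fermi : ∀ a α b β, curvFF A a α b β + curvFF A a β b α = 0
  asd : ∀ α β, Fasd A.bos α β = lam • A.B α β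

/-! ### Second formulation: super-field relations -/

/-- The relations for the fermionic derivatives of the super-fields. The first two fields say in
a gauge-covariant way which super-connection the super-fields `φ_{ab}`, `ψ̃_{a α'}` belong to: only
the contractions with `θ^{a α}` of
`{∇_{a α}, ∇_{b β}} = 2 ε_{αβ} φ_{ab}` and `[∇_{a α}, ∇_{β α'}] = ε_{αβ} ψ̃_{a α'}` are required. -/
structure SuperfieldRelations (lam : ℂ) (A : SuperConnection N U 𝔤) (Φ : Multiplet N U 𝔤) :
    Prop where
  radial_curvFB : ∀ β β', ∑ a, ∑ α, th a α (curvFB A a α β β') = ∑ a, thLow a β (Φ.psiT a β')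
  radial_curvFF : ∀ b β,
    ∑ a, ∑ α, th a α (curvFF A a α b β) = (2 : ℂ) • ∑ a, thLow a β (Φ.phi a b)
  der_Ftilde : ∀ a α α' β', covF A a α (Ftilde A.bos α' β') =
    (1 / 2 : ℂ) • (covB A.bos α α' (Φ.psiT a β') + covB A.bos α β' (Φ.psiT a α'))
  der_psiT : ∀ a α b α', covF A a α (Φ.psiT b α') = (2 : ℂ) • covB A.bos α α' (Φ.phi a b)
  der_phi : ∀ a α b c, covF A a α (Φ.phi b c) = ∑ d, eps4 a b c d • Φ.psi d α
  der_psi : ∀ a α b β, covF A a α (Φ.psi b β) =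
    -(eps α β • ∑ c, br (Φ.phi a c) (upper Φ.phi b c)) + (if a = b then Φ.B α β else 0)
  der_B : ∀ a α β γ, covF A a α (Φ.B β γ) =
    -(2 : ℂ) • (1 / 2 : ℂ) • (eps α β • ∑ b, br (Φ.psi b γ) (Φ.phi a b) +
      eps α γ • ∑ b, br (Φ.psi b β) (Φ.phi a b))
  asd : ∀ α β, Fasd A.bos α β = lam • Φ.B α β

/-! ### The field equations -/

/-- `□ f = ∇^{α α'} ∇_{α α'} f`. -/
def box (A : Fin 2 → Fin 2 → SuperField N U 𝔤) (f : SuperField N U 𝔤) : SuperField N U 𝔤 :=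
  ∑ α, ∑ β, ∑ α', ∑ β', (eps α β * eps α' β') • covB A β β' (covB A α α' f)

/-- The `N = 4` field equations for `A_{α α'}`, `ψ̃_{a α'}`, `φ_{ab}`, `ψ^a_α`, `B_{αβ}`. They
contain no fermionic derivatives, so they make sense for super-fields as well as for
component fields. -/
structure FieldEquations (lam : ℂ) (A : Fin 2 → Fin 2 → SuperField N U 𝔤)
    (Φ : Multiplet N U 𝔤) : Prop where
  eq_B : ∀ α α', ∑ β, ∑ γ, eps β γ • covB A γ α' (Φ.B α β) =
    -(∑ a, br (Φ.psiT a α') (Φ.psi a α)) -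
      (1 / 2 : ℂ) • ∑ a, ∑ b, br (Φ.phi a b) (covB A α α' (upper Φ.phi a b))
  eq_psiT : ∀ a α, ∑ α', ∑ β', eps α' β' • covB A α β' (Φ.psiT a α') =
    (2 * lam) • ∑ b, br (Φ.psi b α) (Φ.phi a b)
  eq_phi : ∀ a b, box A (Φ.phi a b) =
    (1 / 2 : ℂ) • ∑ α', ∑ β', eps α' β' •
      (br (Φ.psiT a α') (Φ.psiT b β') - br (Φ.psiT b α') (Φ.psiT a β')) +
    lam • ∑ c, ∑ d, eps4 a b c d • ∑ α, ∑ β, eps α β • br (Φ.psi c α) (Φ.psi d β) -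
    (2 * lam) • (1 / 2 : ℂ) • ∑ c, ∑ d,
      (br (Φ.phi c a) (br (upper Φ.phi c d) (Φ.phi b d)) -
        br (Φ.phi c b) (br (upper Φ.phi c d) (Φ.phi a d)))
  eq_psi : ∀ a α', ∑ α, ∑ β, eps α β • covB A β α' (Φ.psi a α) =
    ∑ b, br (Φ.psiT b α') (upper Φ.phi a b)
  asd : ∀ α β, Fasd A α β = lam • Φ.B α β

/-! ### Third formulation: radial gauge, recursion relations, component fields -/

/-- The radial gauge condition `θ^{a α} A_{a α} = 0`. -/
def IsRadial (A : SuperConnection N U 𝔤) : Prop := ∑ a, ∑ α, th a α (A.fer a α) = 0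

/-- The recursion relations in the fermionic degree. -/
structure RecursionRelations (lam : ℂ) (A : SuperConnection N U 𝔤) (Φ : Multiplet N U 𝔤) :
    Prop where
  rec_Ftilde : ∀ α' β', euler (Ftilde A.bos α' β') = ∑ a, ∑ α, th a α
    ((1 / 2 : ℂ) • (covB A.bos α α' (Φ.psiT a β') + covB A.bos α β' (Φ.psiT a α')))
  rec_psiT : ∀ a α', euler (Φ.psiT a α') =
    -(2 : ℂ) • ∑ b, ∑ α, th b α (covB A.bos α α' (Φ.phi a b))
  rec_phi : ∀ a b, euler (Φ.phi a b) = ∑ c, ∑ d, eps4 a b c d • ∑ α, th c α (Φ.psi d α)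
  rec_psi : ∀ a α, euler (Φ.psi a α) =
    ∑ β, th a β (Φ.B α β) - ∑ b, ∑ c, thLow b α (br (Φ.phi b c) (upper Φ.phi a c))
  rec_B : ∀ α β, euler (Φ.B α β) = -(2 : ℂ) • (1 / 2 : ℂ) • ∑ a, ∑ b,
    (thLow a α (br (Φ.psi b β) (Φ.phi a b)) + thLow a β (br (Φ.psi b α) (Φ.phi a b)))
  rec_Fasd : ∀ α β, euler (Fasd A.bos α β) = lam • euler (Φ.B α β)
  rec_bos : ∀ α α', euler (A.bos α α') = ∑ a, thLow a α (Φ.psiT a α')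
  rec_fer : ∀ a α, A.fer a α + euler (A.fer a α) = (2 : ℂ) • ∑ b, thLow b α (Φ.phi b a)

/-- Parameters `ω` of the gauge transformations `exp ω` that are the identity at `θ = 0`. -/
def IsGaugeParameter (ω : SuperField N U 𝔤) : Prop := IsEven ω ∧ body ω = 0

/-- The adjoint action `exp(ad ω) f`. Every monomial of a gauge parameter contains
one of the eight `θ^{a α}`, so `(ad ω)^9 = 0` and the sum is the whole exponential series. -/
def gaugeAd (ω f : SuperField N U 𝔤) : SuperField N U 𝔤 :=
  ∑ k ∈ Finset.range 9, (1 / (k.factorial : ℂ)) • ((br ω) ^ k) f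

/-- The inhomogeneous term `-(∂ e^ω) e^{-ω} = -∑ (ad ω)^k (∂ω) / (k+1)!`, where `dω = ∂ω`. -/
def gaugeInhom (ω dω : SuperField N U 𝔤) : SuperField N U 𝔤 :=
  -∑ k ∈ Finset.range 9, (1 / ((k + 1).factorial : ℂ)) • ((br ω) ^ k) dω

/-- The gauge transform `∇ ↦ e^ω ∇ e^{-ω}` of a super-connection. -/
def SuperConnection.gauge (ω : SuperField N U 𝔤) (A : SuperConnection N U 𝔤) :
    SuperConnection N U 𝔤 where
  bos α α' := gaugeAd ω (A.bos α α') + gaugeInhom ω (dx α α' ω)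
  fer a α := gaugeAd ω (A.fer a α) + gaugeInhom ω (dth a α ω)

/-- In radial gauge, reached by a gauge transformation that is trivial at `θ = 0`, the super-fields
obey the recursion relations, and their components at `θ = 0` obey the `N = 4` field equations. -/
def RadialGaugeComponents (lam : ℂ) (A : SuperConnection N U 𝔤) (Φ : Multiplet N U 𝔤) : Prop :=
  ∃ ω : SuperField N U 𝔤, IsGaugeParameter ω ∧ IsRadial (A.gauge ω) ∧
    RecursionRelations lam (A.gauge ω) (Φ.map (gaugeAd ω)) ∧
    FieldEquations lam (fun α α' => body ((A.gauge ω).bos α α'))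
      ((Φ.map (gaugeAd ω)).map body)

/-- Component fields on space-time: fields independent of `θ`, with the right
Grassmann parities and index symmetries. -/
structure IsComponentFields (A₀ : Fin 2 → Fin 2 → SuperField N U 𝔤) (Φ₀ : Multiplet N U 𝔤) :
    Prop where
  even : ∀ α α', IsEven (A₀ α α')
  graded : Φ₀.IsGraded
  body_conn : ∀ α α', body (A₀ α α') = A₀ α α'
  body_fields : Φ₀.map body = Φ₀

end ChiralSuperspace

end

open ChiralSuperspace

noncomputable section

namespace ChiralSuperspace

/-! ### Levi-Civita symbols -/

/-! Super-fields are filtered by their degree in the eight `θ^{aα}`, and degree nine is zero. The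
operator `θ^{aα}∇_{aα}` is the Euler operator `𝒟` plus the bracket with an element of positive
degree, so modulo higher degree it acts on degree `n` as multiplication by `n`, and adding a
constant `c` makes it injective wherever `n + c > 0`. Hence an identity may be tested after
contraction with `θ^{aα}`, given its value at `θ = 0` when `c = 0` (`mem_fil_of_radial`,
`eq_zero_of_mem_fil`), and equations for `𝒟 + c` can be solved (`exists_euler_eq`).

The algebraic input is `N = 4` supersymmetry. The right-hand sides of the relations in (2) define
formal variations of the fields. First, these close: the anticommutator of two variations is `2
ε_{αβ}[φ_{ab}, ·]` (`closure_phi`, `closure_psi`, `closure_B`), on `ψ̃` only modulo the field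
equation of `ψ` (`closure_psiT`). Second, the defects of the five field equations vary into each
other (`IsSusyD.resF`, `IsSusyD.resPsiT`, `IsSusyD.resPhi`, `IsSusyD.resPsi`, `IsSusyD.resB`). Both
facts are proved for an abstract notion of variation, because they are applied to two of them:
equality after contraction with `θ^{aα}` (`VarRad`), and equality of all components of `∇_{aα}` up
to degree `n` (`VarMod`).

In radial gauge the recursion relations are the relations of (2) contracted with `θ^{aα}`. If the
defects vanish at `θ = 0`, each contraction raises their degree, so they vanish (`RadialRel.fe`).
Closure then removes the contraction degree by degree (`closure_step`, `RadialRel.varMod`). This is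
(3) ⇒ (2).

Under (2), the Bianchi identities contracted with `θ^{aα}` determine the full curvature, which gives
(1), and covariant differentiation of `F = λB`, together with closure on `ψ̃`, produces all field
equations. From (1), the Bianchi identities give the derivatives of `ψ̃` and `φ`, and closure on `φ`
and `ψ`, read backwards, gives those of `ψ` and `B`. The relations of (2) are gauge covariant, since
the exponential of a nilpotent derivation respects brackets. Radial gauge and the solution of the
recursion relations in (iii) are both fixed points of maps that gain one degree in `θ` at each
application. -/

theorem eps4_eq (a b c d : Fin 4) : eps4 a b c d =
    (((((b.val : ℤ) - a.val) * ((c.val : ℤ) - a.val) * ((d.val : ℤ) - a.val) *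
      ((c.val : ℤ) - b.val) * ((d.val : ℤ) - b.val) * ((d.val : ℤ) - c.val)) / 12 : ℤ) : ℂ) := by
  have hdiv : ∀ a b c d : Fin 4, ((b.val : ℤ) - a.val) * ((c.val : ℤ) - a.val) *
      ((d.val : ℤ) - a.val) * ((c.val : ℤ) - b.val) * ((d.val : ℤ) - b.val) *
      ((d.val : ℤ) - c.val) = 12 * ((((b.val : ℤ) - a.val) * ((c.val : ℤ) - a.val) *
      ((d.val : ℤ) - a.val) * ((c.val : ℤ) - b.val) * ((d.val : ℤ) - b.val) *
      ((d.val : ℤ) - c.val)) / 12) := by decide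
  -- Selecting rows of the Vandermonde matrix with nodes `0, 1, 2, 3` gives the one with nodes `a,
  -- b, c, d`. The former has determinant `12`, whence the divisor; the division is exact, and
  -- identities of symbols become decidable statements about integers.
  have hV : (Matrix.of fun i j : Fin 4 => if ![a, b, c, d] i = j then (1 : ℂ) else 0) *
      Matrix.vandermonde (fun j : Fin 4 => ((j.val : ℤ) : ℂ)) =
      Matrix.vandermonde (fun i => ((((![a, b, c, d] : Fin 4 → Fin 4) i).val : ℤ) : ℂ)) := by
    ext i j
    simp [Matrix.mul_apply, Matrix.vandermonde]
  have h := congrArg Matrix.det hV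
  rw [Matrix.det_mul] at h
  have h4 : ∀ v : Fin 4 → ℂ, (Matrix.vandermonde v).det =
      (v 1 - v 0) * (v 2 - v 0) * (v 3 - v 0) * (v 2 - v 1) * (v 3 - v 1) * (v 3 - v 2) := by
    intro v
    simp [Matrix.det_succ_row_zero, Fin.sum_univ_succ, Matrix.vandermonde, Fin.succAbove]
    ring
  rw [h4, h4] at h
  have h12 : eps4 a b c d * 12 = ((12 * ((((b.val : ℤ) - a.val) * ((c.val : ℤ) - a.val) *
      ((d.val : ℤ) - a.val) * ((c.val : ℤ) - b.val) * ((d.val : ℤ) - b.val) *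
      ((d.val : ℤ) - c.val)) / 12) : ℤ) : ℂ) := by
    rw [← hdiv]
    have e : (Matrix.of fun i j : Fin 4 => if ![a, b, c, d] i = j then (1 : ℂ) else 0).det =
      eps4 a b c d := rfl
    rw [e] at h
    push_cast
    simp at h
    rw [← h]
    norm_num
  push_cast at h12 ⊢
  linear_combination h12 / 12

theorem eps4_same (a c d : Fin 4) : eps4 a a c d = 0 ∧ eps4 a c a d = 0 ∧ eps4 a c d a = 0 ∧
    eps4 c a a d = 0 ∧ eps4 c a d a = 0 ∧ eps4 c d a a = 0 := by
  simp [eps4_eq]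

theorem eps4_perm :
    eps4 0 1 2 3 = 1 ∧ eps4 0 1 3 2 = -1 ∧ eps4 0 2 1 3 = -1 ∧ eps4 0 2 3 1 = 1 ∧
    eps4 0 3 1 2 = 1 ∧ eps4 0 3 2 1 = -1 ∧ eps4 1 0 2 3 = -1 ∧ eps4 1 0 3 2 = 1 ∧
    eps4 1 2 0 3 = 1 ∧ eps4 1 2 3 0 = -1 ∧ eps4 1 3 0 2 = -1 ∧ eps4 1 3 2 0 = 1 ∧
    eps4 2 0 1 3 = 1 ∧ eps4 2 0 3 1 = -1 ∧ eps4 2 1 0 3 = -1 ∧ eps4 2 1 3 0 = 1 ∧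
    eps4 2 3 0 1 = 1 ∧ eps4 2 3 1 0 = -1 ∧ eps4 3 0 1 2 = -1 ∧ eps4 3 0 2 1 = 1 ∧
    eps4 3 1 0 2 = 1 ∧ eps4 3 1 2 0 = -1 ∧ eps4 3 2 0 1 = -1 ∧ eps4 3 2 1 0 = 1 := by
  simp [eps4_eq]

theorem forall_fin4 {p : Fin 4 → Prop} (h0 : p 0) (h1 : p 1) (h2 : p 2) (h3 : p 3) (a : Fin 4) :
    p a := by
  fin_cases a <;> assumption

theorem forall_fin2 {p : Fin 2 → Prop} (h0 : p 0) (h1 : p 1) (a : Fin 2) : p a := by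
  fin_cases a <;> assumption

@[simp] theorem eps_zero_zero : eps 0 0 = 0 := by simp [eps]
@[simp] theorem eps_zero_one : eps 0 1 = 1 := by simp [eps]
@[simp] theorem eps_one_zero : eps 1 0 = -1 := by simp [eps]
@[simp] theorem eps_one_one : eps 1 1 = 0 := by simp [eps]

/-! ### Lie superalgebras -/

/-- A `ℤ/2`-graded Lie bracket on a complex vector space with parity automorphism `par`. -/
structure SuperLie (L : Type*) [AddCommGroup L] [Module ℂ L] where
  br : L →ₗ[ℂ] L →ₗ[ℂ] L
  par : L →ₗ[ℂ] L
  par_par : ∀ x, par (par x) = x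
  par_br : ∀ x y, par (br x y) = br (par x) (par y)
  skew : ∀ x y, par x = x → br x y = -br y x
  symm : ∀ x y, par x = -x → par y = -y → br x y = br y x
  jacobi_even : ∀ x y z, par x = x → br x (br y z) = br (br x y) z + br y (br x z)
  jacobi_odd : ∀ x y z, par x = -x → par y = -y → br x (br y z) = br (br x y) z - br y (br x z)

variable {L : Type*} [AddCommGroup L] [Module ℂ L]

/-- `φ^{ab} = ½ ε^{abcd} φ_{cd}`. -/
def raise (φ : Fin 4 → Fin 4 → L) (a b : Fin 4) : L :=
  (1 / 2 : ℂ) • ∑ c, ∑ d, eps4 a b c d • φ c d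

theorem phi_table {φ : Fin 4 → Fin 4 → L} (h : ∀ a b, φ a b = -φ b a) :
    φ 0 0 = 0 ∧ φ 1 1 = 0 ∧ φ 2 2 = 0 ∧ φ 3 3 = 0 ∧
    φ 1 0 = -φ 0 1 ∧ φ 2 0 = -φ 0 2 ∧ φ 3 0 = -φ 0 3 ∧
    φ 2 1 = -φ 1 2 ∧ φ 3 1 = -φ 1 3 ∧ φ 3 2 = -φ 2 3 := by
  have hh : ∀ a, φ a a = 0 := fun a => by
    have := h a a
    rw [eq_neg_iff_add_eq_zero, ← two_smul ℂ] at this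
    simpa using this
  exact ⟨hh _, hh _, hh _, hh _, h _ _, h _ _, h _ _, h _ _, h _ _, h _ _⟩

/-- Duality exchanges complementary pairs of indices up to sign. Everything is thereby expressed in
the six independent components of `φ`, in which the later tensor identities are linear. -/
theorem raise_table {φ : Fin 4 → Fin 4 → L} (h : ∀ a b, φ a b = -φ b a) :
    raise φ 0 0 = 0 ∧ raise φ 1 1 = 0 ∧ raise φ 2 2 = 0 ∧ raise φ 3 3 = 0 ∧
    raise φ 0 1 = φ 2 3 ∧ raise φ 0 2 = -φ 1 3 ∧ raise φ 0 3 = φ 1 2 ∧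
    raise φ 1 2 = φ 0 3 ∧ raise φ 1 3 = -φ 0 2 ∧ raise φ 2 3 = φ 0 1 ∧
    raise φ 1 0 = -φ 2 3 ∧ raise φ 2 0 = φ 1 3 ∧ raise φ 3 0 = -φ 1 2 ∧
    raise φ 2 1 = -φ 0 3 ∧ raise φ 3 1 = φ 0 2 ∧ raise φ 3 2 = -φ 0 1 := by
  have s := phi_table h
  simp only [raise, Fin.sum_univ_four]
  refine ⟨?_, ?_, ?_, ?_, ?_, ?_, ?_, ?_, ?_, ?_, ?_, ?_, ?_, ?_, ?_, ?_⟩ <;>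
    simp [eps4_same, eps4_perm, s] <;> module

/-- The component fields of the `N = 4` multiplet, with values in `L`. -/
structure Fields (L : Type*) where
  psiT : Fin 4 → Fin 2 → L
  phi : Fin 4 → Fin 4 → L
  psi : Fin 4 → Fin 2 → L
  B : Fin 2 → Fin 2 → L

namespace SuperLie

variable (S : SuperLie L)

/-- Grassmann parities and index symmetries of the multiplet. -/
structure Graded (Φ : Fields L) : Prop where
  psiT_odd : ∀ a α', S.par (Φ.psiT a α') = -Φ.psiT a α'
  phi_even : ∀ a b, S.par (Φ.phi a b) = Φ.phi a b
  psi_odd : ∀ a α, S.par (Φ.psi a α) = -Φ.psi a α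
  B_even : ∀ α β, S.par (Φ.B α β) = Φ.B α β
  phi_skew : ∀ a b, Φ.phi a b = -Φ.phi b a
  B_symm : ∀ α β, Φ.B α β = Φ.B β α

/-- Half the bracket, as a normal form for brackets of two fields. -/
def hb (x y : L) : L := (1 / 2 : ℂ) • S.br x y

/-- A third of the iterated bracket, as a normal form for brackets of three fields. -/
def trip (x y z : L) : L := (1 / 3 : ℂ) • S.br x (S.br y z)

/-- In this form skewness of the bracket is an identity between linear combinations, and no ordering
of the arguments has to be chosen. -/
theorem br_eq_hb_even {x y : L} (hx : S.par x = x) : S.br x y = S.hb x y - S.hb y x := by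
  rw [hb, hb, S.skew x y hx]; module

theorem skew' {x y : L} (hy : S.par y = y) : S.br x y = -S.br y x := by
  rw [S.skew y x hy, neg_neg]

end SuperLie

end ChiralSuperspace

namespace ChiralSuperspace

variable {L : Type*} [AddCommGroup L] [Module ℂ L]

/-! ### Tensor identities for `SU(4)` and spinor indices -/

/-- The left side is totally antisymmetric in three indices that take only two values. -/
theorem schouten (x : Fin 2 → L) (α β γ : Fin 2) :
    eps α β • x γ + eps β γ • x α + eps γ α • x β = 0 := by
  revert α β γ
  refine forall_fin2 ?_ ?_ <;> refine forall_fin2 ?_ ?_ <;> refine forall_fin2 ?_ ?_ <;>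
    simp

theorem eps_symm (α β : Fin 2) : eps α β = -eps β α := by
  revert α β
  refine forall_fin2 ?_ ?_ <;> refine forall_fin2 ?_ ?_ <;> simp

theorem eps4_rotate (a b c d : Fin 4) : eps4 a b c d = -eps4 b a c d ∧
    eps4 a b c d = -eps4 a c b d ∧ eps4 a b c d = -eps4 a b d c := by
  have key : ∀ a b c d : Fin 4,
      let f := fun a b c d : Fin 4 => (((b.val : ℤ) - a.val) * ((c.val : ℤ) - a.val) *
        ((d.val : ℤ) - a.val) * ((c.val : ℤ) - b.val) * ((d.val : ℤ) - b.val) *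
        ((d.val : ℤ) - c.val)) / 12
      f a b c d = -f b a c d ∧ f a b c d = -f a c b d ∧ f a b c d = -f a b d c := by decide
  obtain ⟨h1, h2, h3⟩ := key a b c d
  simp only [eps4_eq]
  exact ⟨mod_cast h1, mod_cast h2, mod_cast h3⟩

/-- A product of two Levi-Civita symbols with one index contracted is an antisymmetrised product of
Kronecker deltas. One term remains for each of `a`, `b`, `e` that `c` can match. -/
theorem sum_eps4_raise {φ : Fin 4 → Fin 4 → L} (h : ∀ a b, φ a b = -φ b a) (a b c e : Fin 4) :
    ∑ d, eps4 a b d e • raise φ c d = (if c = a then φ e b else 0) +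
      (if c = b then φ a e else 0) + (if c = e then φ b a else 0) := by
  have r := raise_table h
  have s := phi_table h
  revert a b c e
  refine forall_fin4 ?_ ?_ ?_ ?_ <;> refine forall_fin4 ?_ ?_ ?_ ?_ <;>
    refine forall_fin4 ?_ ?_ ?_ ?_ <;> refine forall_fin4 ?_ ?_ ?_ ?_ <;>
    simp [Fin.sum_univ_four, eps4_same, eps4_perm, r, s]

/-- The same contraction with two summed indices. With `x = ψ` it computes the variation of
`φ^{bc}`. -/
theorem raise_eps4 (x : Fin 4 → L) (a b c : Fin 4) :
    raise (fun b c => ∑ d, eps4 a b c d • x d) b c =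
      (if a = b then x c else 0) - (if a = c then x b else 0) := by
  have hs : ∀ a, ∀ b c, (fun b c => ∑ d, eps4 a b c d • x d) b c =
      -(fun b c => ∑ d, eps4 a b c d • x d) c b := by
    intro a b c
    simp only [← Finset.sum_neg_distrib, ← neg_smul]
    refine Finset.sum_congr rfl fun d _ => ?_
    rw [(eps4_rotate a b c d).2.1]
  revert a b c
  refine forall_fin4 ?_ ?_ ?_ ?_
  · have r := raise_table (hs 0)
    refine forall_fin4 ?_ ?_ ?_ ?_ <;> refine forall_fin4 ?_ ?_ ?_ ?_ <;>
      (simp only [r]; simp [Fin.sum_univ_four, eps4_same, eps4_perm])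
  · have r := raise_table (hs 1)
    refine forall_fin4 ?_ ?_ ?_ ?_ <;> refine forall_fin4 ?_ ?_ ?_ ?_ <;>
      (simp only [r]; simp [Fin.sum_univ_four, eps4_same, eps4_perm])
  · have r := raise_table (hs 2)
    refine forall_fin4 ?_ ?_ ?_ ?_ <;> refine forall_fin4 ?_ ?_ ?_ ?_ <;>
      (simp only [r]; simp [Fin.sum_univ_four, eps4_same, eps4_perm])
  · have r := raise_table (hs 3)
    refine forall_fin4 ?_ ?_ ?_ ?_ <;> refine forall_fin4 ?_ ?_ ?_ ?_ <;>
      (simp only [r]; simp [Fin.sum_univ_four, eps4_same, eps4_perm])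

/-- The arrays `φ_{ab}` and `φ^{ab}` are the two chiral blocks of gamma matrices in six dimensions.
This is their polarised Clifford relation, for an arbitrary bilinear product. -/
theorem sum_raise_clifford {L' : Type*} [AddCommGroup L'] [Module ℂ L'] (m : L →ₗ[ℂ] L →ₗ[ℂ] L')
    {φ χ : Fin 4 → Fin 4 → L} (hφ : ∀ a b, φ a b = -φ b a) (hχ : ∀ a b, χ a b = -χ b a)
    (a b : Fin 4) :
    ∑ c, m (φ a c) (raise χ b c) + ∑ c, m (raise φ b c) (χ a c) =
      if a = b then (1 / 2 : ℂ) • ∑ c, ∑ d, m (φ c d) (raise χ c d) else 0 := by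
  have r := raise_table hφ
  have s := phi_table hφ
  have r' := raise_table hχ
  have s' := phi_table hχ
  revert a b
  refine forall_fin4 ?_ ?_ ?_ ?_ <;> refine forall_fin4 ?_ ?_ ?_ ?_ <;>
    simp [Fin.sum_univ_four, r, s, r', s'] <;> module

theorem raise_skew {φ : Fin 4 → Fin 4 → L} (a b : Fin 4) : raise φ a b = -raise φ b a := by
  simp only [raise, (eps4_rotate b a _ _).1, neg_smul, Finset.sum_neg_distrib, smul_neg, neg_neg]

theorem map_raise {L' : Type*} [AddCommGroup L'] [Module ℂ L'] (m : L →ₗ[ℂ] L')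
    (φ : Fin 4 → Fin 4 → L) (a b : Fin 4) : m (raise φ a b) = raise (fun c d => m (φ c d)) a b := by
  simp [raise, map_sum]

end ChiralSuperspace

namespace ChiralSuperspace

variable {L : Type*} [AddCommGroup L] [Module ℂ L]

/-! ### Formal supersymmetry variations -/

theorem map_ite_zero {L' : Type*} [AddCommGroup L'] [Module ℂ L'] (f : L →ₗ[ℂ] L') (P : Prop)
    [Decidable P] (x : L) : f (if P then x else 0) = if P then f x else 0 := by
  split_ifs <;> simp

namespace SuperLie

/-- `V x q` says that `q a α` is the variation of `x` in the direction `(a, α)`; the variations obey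
the Leibniz rule of odd derivations. -/
structure IsVariation (S : SuperLie L) (V : L → (Fin 4 → Fin 2 → L) → Prop) : Prop where
  zero : V 0 fun _ _ => 0
  add : ∀ {x y p q}, V x p → V y q → V (x + y) fun a α => p a α + q a α
  smul : ∀ (c : ℂ) {x p}, V x p → V (c • x) fun a α => c • p a α
  br_even : ∀ {x y p q}, S.par x = x → V x p → V y q →
    V (S.br x y) fun a α => S.br (p a α) y + S.br x (q a α)
  br_odd : ∀ {x y p q}, S.par x = -x → V x p → V y q →
    V (S.br x y) fun a α => S.br (p a α) y - S.br x (q a α)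

namespace IsVariation

variable {S : SuperLie L} {V : L → (Fin 4 → Fin 2 → L) → Prop}

theorem congr (_ : S.IsVariation V) {x p q} (h : V x p) (hpq : ∀ a α, p a α = q a α) : V x q := by
  rwa [← (funext fun a => funext fun α => hpq a α : p = q)]

theorem neg (hV : S.IsVariation V) {x p} (h : V x p) : V (-x) fun a α => -p a α := by
  simpa using hV.smul (-1) h

theorem sub (hV : S.IsVariation V) {x y p q} (h : V x p) (h' : V y q) :
    V (x - y) fun a α => p a α - q a α := by
  simpa [sub_eq_add_neg] using hV.add h (hV.neg h')

theorem sum (hV : S.IsVariation V) {ι : Type*} (s : Finset ι) {x : ι → L}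
    {p : ι → Fin 4 → Fin 2 → L} (h : ∀ i, V (x i) (p i)) :
    V (∑ i ∈ s, x i) fun a α => ∑ i ∈ s, p i a α := by
  classical
  induction s using Finset.induction_on with
  | empty => simpa using hV.zero
  | insert i s hi ih => simpa [Finset.sum_insert hi] using hV.add (h i) ih

theorem ite (hV : S.IsVariation V) (P : Prop) [Decidable P] {x p} (h : V x p) :
    V (if P then x else 0) fun a α => if P then p a α else 0 := by
  by_cases hP : P
  · simpa [hP] using h
  · simpa [hP] using hV.zero

theorem raise (hV : S.IsVariation V) {φ : Fin 4 → Fin 4 → L}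
    {p : Fin 4 → Fin 4 → Fin 4 → Fin 2 → L} (h : ∀ b c, V (φ b c) (p b c))
    (b c : Fin 4) : V (raise φ b c)
      fun a α => ChiralSuperspace.raise (fun d e => p d e a α) b c :=
  hV.smul _ (hV.sum _ fun _ => hV.sum _ fun _ => hV.smul _ (h _ _))

end IsVariation

/-- The variation of `φ_{bc}`. -/
def qphi (Φ : Fields L) (a : Fin 4) (α : Fin 2) (b c : Fin 4) : L := ∑ d, eps4 a b c d • Φ.psi d α

variable (S : SuperLie L)

/-- The variation of `ψ^b_β`. -/
def qpsi (Φ : Fields L) (a : Fin 4) (α : Fin 2) (b : Fin 4) (β : Fin 2) : L :=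
  -(eps α β • ∑ c, S.br (Φ.phi a c) (raise Φ.phi b c)) + (if a = b then Φ.B α β else 0)

/-- The variation of `B_{βγ}`. -/
def qB (Φ : Fields L) (a : Fin 4) (α β γ : Fin 2) : L :=
  -(2 : ℂ) • (1 / 2 : ℂ) • (eps α β • ∑ b, S.br (Φ.psi b γ) (Φ.phi a b) +
      eps α γ • ∑ b, S.br (Φ.psi b β) (Φ.phi a b))

/-- The second variation of `φ_{cd}`. -/
def rphi (Φ : Fields L) (a : Fin 4) (α : Fin 2) (b : Fin 4) (β : Fin 2) (c d : Fin 4) : L :=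
  ∑ e, eps4 b c d e • S.qpsi Φ a α e β

/-- The second variation of `ψ^c_γ`. -/
def rpsi (Φ : Fields L) (a : Fin 4) (α : Fin 2) (b : Fin 4) (β : Fin 2) (c : Fin 4) (γ : Fin 2) :
    L :=
  -(eps β γ • ∑ d, (S.br (qphi Φ a α b d) (raise Φ.phi c d) +
    S.br (Φ.phi b d) (raise (qphi Φ a α) c d))) + if b = c then S.qB Φ a α β γ else 0

/-- The second variation of `B_{γδ}`. -/
def rB (Φ : Fields L) (a : Fin 4) (α : Fin 2) (b : Fin 4) (β γ δ : Fin 2) : L :=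
  -(2 : ℂ) • (1 / 2 : ℂ) •
    (eps β γ • ∑ c, (S.br (S.qpsi Φ a α c δ) (Φ.phi b c) - S.br (Φ.psi c δ) (qphi Φ a α b c)) +
      eps β δ • ∑ c, (S.br (S.qpsi Φ a α c γ) (Φ.phi b c) - S.br (Φ.psi c γ) (qphi Φ a α b c)))

variable {S} {V : L → (Fin 4 → Fin 2 → L) → Prop} {Φ : Fields L}

theorem IsVariation.qphi (hV : S.IsVariation V)
    (hpsi : ∀ b β, V (Φ.psi b β) fun a α => S.qpsi Φ a α b β) (b β c d) :
    V (qphi Φ b β c d) fun a α => S.rphi Φ a α b β c d :=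
  hV.sum _ fun _ => hV.smul _ (hpsi _ _)

theorem IsVariation.qpsi (hV : S.IsVariation V) (hΦ : S.Graded Φ)
    (hphi : ∀ b c, V (Φ.phi b c) fun a α => SuperLie.qphi Φ a α b c)
    (hB : ∀ β γ, V (Φ.B β γ) fun a α => S.qB Φ a α β γ) (b β c γ) :
    V (S.qpsi Φ b β c γ) fun a α => S.rpsi Φ a α b β c γ :=
  hV.add (hV.neg (hV.smul _ (hV.sum _ fun _ =>
    hV.br_even (hΦ.phi_even _ _) (hphi _ _) (hV.raise hphi _ _)))) (hV.ite _ (hB _ _))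

theorem IsVariation.qB (hV : S.IsVariation V) (hΦ : S.Graded Φ)
    (hphi : ∀ b c, V (Φ.phi b c) fun a α => SuperLie.qphi Φ a α b c)
    (hpsi : ∀ b β, V (Φ.psi b β) fun a α => S.qpsi Φ a α b β) (b β γ δ) :
    V (S.qB Φ b β γ δ) fun a α => S.rB Φ a α b β γ δ :=
  hV.smul _ (hV.smul _ (hV.add
    (hV.smul _ (hV.sum _ fun _ => hV.br_odd (hΦ.psi_odd _ _) (hpsi _ _) (hphi _ _)))
    (hV.smul _ (hV.sum _ fun _ => hV.br_odd (hΦ.psi_odd _ _) (hpsi _ _) (hphi _ _)))))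

/-! ### Closure of the supersymmetry algebra on `φ` and `ψ`. -/

theorem Graded.phi_self (h : S.Graded Φ) (a : Fin 4) : Φ.phi a a = 0 := by
  obtain ⟨h0, h1, h2, h3, -⟩ := phi_table h.phi_skew
  exact forall_fin4 (p := fun a => Φ.phi a a = 0) h0 h1 h2 h3 a

theorem eq_zero_of_skew {f : Fin 4 → Fin 4 → L} (hf : ∀ a b, f a b = -f b a) (h01 : f 0 1 = 0)
    (h02 : f 0 2 = 0) (h03 : f 0 3 = 0) (h12 : f 1 2 = 0) (h13 : f 1 3 = 0) (h23 : f 2 3 = 0)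
    (a b : Fin 4) : f a b = 0 := by
  have s := phi_table hf
  revert a b
  refine forall_fin4 ?_ ?_ ?_ ?_ <;> refine forall_fin4 ?_ ?_ ?_ ?_ <;>
    simp [s, h01, h02, h03, h12, h13, h23]

-- These are the quadratic terms of the closure relation on `φ`, with the factor `ε_{αβ}` removed.
-- Skewness in `ab` and in `cd` leaves six values of each pair, and after `hb` no property of the
-- bracket is needed any more.
set_option maxHeartbeats 1000000 in
theorem closure_phi_aux (h : S.Graded Φ) (a b c d : Fin 4) :
    ∑ e, eps4 b c d e • ∑ f, S.br (Φ.phi a f) (raise Φ.phi e f) -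
    ∑ e, eps4 a c d e • ∑ f, S.br (Φ.phi b f) (raise Φ.phi e f) +
      (2:ℂ) • S.br (Φ.phi a b) (Φ.phi c d) = 0 := by
  have hs : ∀ a b c d, S.br (Φ.phi a b) (Φ.phi c d) =
    S.hb (Φ.phi a b) (Φ.phi c d) - S.hb (Φ.phi c d) (Φ.phi a b) :=
    fun a b c d => S.br_eq_hb_even (h.phi_even _ _)
  have r := raise_table h.phi_skew
  have s := phi_table h.phi_skew
  have key : ∀ a b : Fin 4, ∀ c d : Fin 4, a < b → ∑ e, eps4 b c d e • ∑ f, S.br (Φ.phi a f) (raise Φ.phi e f) -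
    ∑ e, eps4 a c d e • ∑ f, S.br (Φ.phi b f) (raise Φ.phi e f) +
      (2:ℂ) • S.br (Φ.phi a b) (Φ.phi c d) = 0 := by
    intro a b c d hab
    refine eq_zero_of_skew (f := fun c d => ∑ e, eps4 b c d e • ∑ f, S.br (Φ.phi a f) (raise Φ.phi e f) -
      ∑ e, eps4 a c d e • ∑ f, S.br (Φ.phi b f) (raise Φ.phi e f) +
        (2:ℂ) • S.br (Φ.phi a b) (Φ.phi c d)) (fun c d => ?_) ?_ ?_ ?_ ?_ ?_ ?_ c d
    · simp only [(eps4_rotate _ c d _).2.1, h.phi_skew c d, neg_smul, Finset.sum_neg_distrib,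
        map_neg, smul_neg]
      abel
    all_goals
      revert a b
      refine forall_fin4 ?_ ?_ ?_ ?_ <;> refine forall_fin4 ?_ ?_ ?_ ?_ <;> intro hab <;>
      first
      | exact absurd hab (by decide)
      | (simp [Fin.sum_univ_four, eps4_same, eps4_perm, r, s, hs]; done)
      | (simp [Fin.sum_univ_four, eps4_same, eps4_perm, r, s, hs]; module)
  rcases lt_trichotomy a b with hab | rfl | hab
  · exact key a b c d hab
  · rw [h.phi_self a]; simp
  · have := key b a c d hab
    rw [h.phi_skew a b]
    simp only [map_neg, LinearMap.neg_apply, smul_neg]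
    rw [← neg_eq_zero, ← this]; abel

/-- The `B` terms cancel: `B_{αβ}` is symmetric, while the symbol in front of it is skew under
exchange of `a` and `b`. -/
theorem closure_phi (h : S.Graded Φ) (a α b β c d) :
    S.rphi Φ a α b β c d + S.rphi Φ b β a α c d =
      (2 * eps α β) • S.br (Φ.phi a b) (Φ.phi c d) := by
  have h1 := closure_phi_aux h a b c d
  simp only [rphi, qpsi, smul_add, smul_neg, Finset.sum_add_distrib, Finset.sum_neg_distrib,
    smul_comm (eps4 _ _ _ _) (eps _ _), ← Finset.smul_sum, smul_ite, smul_zero, Finset.sum_ite_eq,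
    Finset.mem_univ, if_true]
  rw [eps_symm β α, h.B_symm β α, (eps4_rotate a c d b).2.2, (eps4_rotate a c b d).2.1,
    (eps4_rotate a b c d).1, (eps4_rotate b a c d).2.1, (eps4_rotate b c a d).2.2]
  linear_combination (norm := module) (-eps α β) • h1

/-- Everything reduces to `[φ_{ab}, ψ^c]` and the contraction `Y_a = [φ_{ad}, ψ^d]`, with one `ε` on
the spinor indices. The Schouten identity in `α, β, γ` does the rest, without any Jacobi identity.
-/
theorem closure_psi (h : S.Graded Φ) (a α b β c γ) :
    S.rpsi Φ a α b β c γ + S.rpsi Φ b β a α c γ =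
      (2 * eps α β) • S.br (Φ.phi a b) (Φ.psi c γ) := by
  set Y : Fin 4 → Fin 2 → L := fun a α => ∑ d, S.br (Φ.phi a d) (Φ.psi d α) with hY
  have hs : ∀ c γ a b, S.br (Φ.psi c γ) (Φ.phi a b) = -S.br (Φ.phi a b) (Φ.psi c γ) :=
    fun c γ a b => S.skew' (h.phi_even _ _)
  have e1 : ∀ a α b c, ∑ d, S.br (qphi Φ a α b d) (raise Φ.phi c d) =
      (if c = a then Y b α else 0) - (if c = b then Y a α else 0) +
        S.br (Φ.phi a b) (Φ.psi c α) := by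
    intro a α b c
    simp only [qphi, map_sum, LinearMap.sum_apply, map_smul, LinearMap.smul_apply]
    rw [Finset.sum_comm]
    simp only [← map_smul, ← map_sum, sum_eps4_raise h.phi_skew, map_add, map_ite_zero]
    simp only [Finset.sum_add_distrib, hs, Finset.sum_ite_eq, Finset.mem_univ, if_true]
    rw [h.phi_skew b a]
    have : ∀ x, S.br (Φ.phi x b) (Φ.psi x α) = - S.br (Φ.phi b x) (Φ.psi x α) := fun x => by
      rw [h.phi_skew x b]; simp
    split_ifs <;> simp [hY, this, sub_eq_add_neg]
  have e2 : ∀ a α b c, ∑ d, S.br (Φ.phi b d) (raise (qphi Φ a α) c d) =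
      (if c = a then Y b α else 0) + S.br (Φ.phi a b) (Φ.psi c α) := by
    intro a α b c
    have := fun c d => raise_eps4 (fun d => Φ.psi d α) a c d
    simp only [show qphi Φ a α = fun b c => ∑ d, eps4 a b c d • Φ.psi d α from rfl, this, map_sub,
      Finset.sum_sub_distrib, map_ite_zero, Finset.sum_ite_eq, Finset.mem_univ, if_true]
    rw [h.phi_skew a b]
    by_cases hc : a = c
    · simp [hc, hY, sub_eq_add_neg]
    · simp [hc, Ne.symm hc]
  have e3 : ∀ a α β γ, S.qB Φ a α β γ = eps α β • Y a γ + eps α γ • Y a β := by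
    intro a α β γ
    simp only [qB, hs, hY, Finset.sum_neg_distrib]
    module
  simp only [rpsi, Finset.sum_add_distrib, e1, e2, e3]
  rw [h.phi_skew b a]
  have s1 := schouten (S.br (Φ.phi a b) ∘ Φ.psi c) α β γ
  have s2 := schouten (Y a) α β γ
  have s3 := schouten (Y b) α β γ
  have t1 := eps_symm β α
  have t2 := eps_symm γ α
  simp only [Function.comp_apply, t1, t2] at s1 s2 s3 ⊢
  -- The Kronecker deltas decide which Schouten identities occur: `c = a` brings in the one for `Y
  -- b`, and `c = b` the one for `Y a`.
  by_cases hca : c = a <;> by_cases hcb : c = b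
  · subst hca; subst hcb
    simp only [if_true, h.phi_self, neg_zero, map_zero, LinearMap.zero_apply]
    linear_combination (norm := module) s2 - s3
  · subst hca
    simp only [hcb, Ne.symm hcb, if_true, if_false, map_neg, LinearMap.neg_apply]
    linear_combination (norm := module) (-2 : ℂ) • s1 - s3
  · subst hcb
    simp only [hca, Ne.symm hca, if_true, if_false, map_neg, LinearMap.neg_apply]
    linear_combination (norm := module) (-2 : ℂ) • s1 + s2
  · simp only [hca, hcb, Ne.symm hca, Ne.symm hcb, if_false, map_neg, LinearMap.neg_apply]
    linear_combination (norm := module) (-2 : ℂ) • s1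

end SuperLie
end ChiralSuperspace

/-! ### Closure of the supersymmetry algebra on `B`. -/

namespace ChiralSuperspace

variable {L : Type*} [AddCommGroup L] [Module ℂ L]
namespace SuperLie
variable {S : SuperLie L} {V : L → (Fin 4 → Fin 2 → L) → Prop} {Φ : Fields L}

/-- Jacobi identity for three even fields, in the normal form of the Dynkin projection. -/
theorem br_br_eq_trip_even (S : SuperLie L) {x y z : L} (hx : S.par x = x) (hy : S.par y = y) :
    S.br x (S.br y z) = S.trip x y z - S.trip x z y - S.trip y z x + S.trip z y x := by
  have h1 := S.jacobi_even x y z hx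
  have h2 := S.skew y x hy
  have h3 := S.skew x z hx
  have h4 := S.skew y z hy
  have h5 := S.skew' (x := S.br y z) hx
  have h6 := S.skew' (x := S.br x z) hy
  have h7 : S.br z (S.br x y) = - S.br (S.br x y) z :=
    S.skew' (by rw [S.par_br, hx, hy])
  simp only [trip]
  rw [← neg_eq_iff_eq_neg.mpr h3, ← neg_eq_iff_eq_neg.mpr h4, h2]
  simp only [map_neg]
  rw [h7]
  linear_combination (norm := module) (1/3 : ℂ) • h1

/-- The cubic term `[φ_{bc}, [φ_{ad}, φ^{cd}]]` of the field equation for `φ`. -/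
def cubic (S : SuperLie L) (Φ : Fields L) (a b : Fin 4) : L :=
  ∑ c, ∑ d, S.br (Φ.phi b c) (S.br (Φ.phi a d) (raise Φ.phi c d))

/-- The Yukawa term `ε_{abcd} {ψ^c_β, ψ^d_α}`. -/
def yukawa (S : SuperLie L) (Φ : Fields L) (a : Fin 4) (α : Fin 2) (b : Fin 4) (β : Fin 2) : L :=
  ∑ c, ∑ d, eps4 a b c d • S.br (Φ.psi c β) (Φ.psi d α)

/-- The part symmetric in `ab` vanishes by the Jacobi identity. In the `trip` form that identity is
built in, and the claim is linear algebra on components. -/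
theorem cubic_skew (h : S.Graded Φ) (a b : Fin 4) : S.cubic Φ a b + S.cubic Φ b a = 0 := by
  have hs : ∀ a b c d e f, S.br (Φ.phi a b) (S.br (Φ.phi c d) (Φ.phi e f)) =
    S.trip (Φ.phi a b) (Φ.phi c d) (Φ.phi e f) - S.trip (Φ.phi a b) (Φ.phi e f) (Φ.phi c d) -
    S.trip (Φ.phi c d) (Φ.phi e f) (Φ.phi a b) + S.trip (Φ.phi e f) (Φ.phi c d) (Φ.phi a b) :=
    fun a b c d e f => S.br_br_eq_trip_even (h.phi_even _ _) (h.phi_even _ _)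
  have r := raise_table h.phi_skew
  have s := phi_table h.phi_skew
  simp only [cubic]
  revert a b
  refine forall_fin4 ?_ ?_ ?_ ?_ <;> refine forall_fin4 ?_ ?_ ?_ ?_ <;>
    simp [Fin.sum_univ_four, r, s, hs] <;> module

/-- The bracket of two odd fields is symmetric, so relabelling the summation indices costs only the
sign of the Levi-Civita symbol. -/
theorem yukawa_skew (h : S.Graded Φ) (a α b β) : S.yukawa Φ a α b β = -S.yukawa Φ a β b α := by
  simp only [yukawa]
  rw [Finset.sum_comm, ← Finset.sum_neg_distrib]
  refine Finset.sum_congr rfl fun c _ => ?_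
  rw [← Finset.sum_neg_distrib]
  refine Finset.sum_congr rfl fun e _ => ?_
  rw [S.symm _ _ (h.psi_odd e β) (h.psi_odd c α), (eps4_rotate a b e c).2.2, neg_smul]

theorem yukawa_symm (h : S.Graded Φ) (a α b β) : S.yukawa Φ b β a α = S.yukawa Φ a α b β := by
  rw [yukawa_skew h a α b β]
  simp only [yukawa]
  rw [← Finset.sum_neg_distrib]
  refine Finset.sum_congr rfl fun c _ => ?_
  rw [← Finset.sum_neg_distrib]
  refine Finset.sum_congr rfl fun e _ => ?_
  rw [(eps4_rotate a b c e).1, neg_smul, neg_neg]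

theorem yukawa_eq_eps (h : S.Graded Φ) (a b α β) :
    S.yukawa Φ a α b β = eps α β • S.yukawa Φ a 0 b 1 := by
  have h0 : ∀ α, S.yukawa Φ a α b α = 0 := fun α => by
    have := yukawa_skew h a α b α
    rw [eq_neg_iff_add_eq_zero, ← two_smul ℂ] at this
    simpa using this
  revert α β
  refine forall_fin2 (forall_fin2 ?_ ?_) (forall_fin2 ?_ ?_) <;> simp [h0, yukawa_skew h a 1 b 0]

/-- The variation of `[ψ^c_δ, φ_{bc}]`. -/
theorem sum_qpsi_phi (h : S.Graded Φ) (a α b δ) :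
    ∑ c, (S.br (S.qpsi Φ a α c δ) (Φ.phi b c) - S.br (Φ.psi c δ) (qphi Φ a α b c)) =
      eps α δ • S.cubic Φ a b - S.br (Φ.phi b a) (Φ.B α δ) - S.yukawa Φ a α b δ := by
  have e0 : ∀ c, S.br (S.qpsi Φ a α c δ) (Φ.phi b c) =
      eps α δ • ∑ d, S.br (Φ.phi b c) (S.br (Φ.phi a d) (raise Φ.phi c d)) -
        if a = c then S.br (Φ.phi b c) (Φ.B α δ) else 0 := by
    intro c
    rw [S.skew' (h.phi_even b c), qpsi]
    simp only [map_add, map_neg, map_smul, map_sum, map_ite_zero]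
    abel
  simp only [e0, Finset.sum_sub_distrib, Finset.sum_ite_eq, Finset.mem_univ, if_true, qphi,
    cubic, yukawa, map_sum, map_smul, Finset.smul_sum]

/-- The terms `[φ_{ab}, B]` combine by the Schouten identity, the cubic terms occur only symmetrised
in `ab`, and the Yukawa terms cancel once each is written as a multiple of an `ε`. -/
theorem closure_B (h : S.Graded Φ) (a α b β γ δ) :
    S.rB Φ a α b β γ δ + S.rB Φ b β a α γ δ =
      (2 * eps α β) • S.br (Φ.phi a b) (Φ.B γ δ) := by
  simp only [rB, sum_qpsi_phi h]
  rw [h.phi_skew b a]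
  rw [yukawa_symm h a δ b β, yukawa_symm h a γ b β, yukawa_eq_eps h a b α δ,
    yukawa_eq_eps h a b α γ, yukawa_eq_eps h a b δ β, yukawa_eq_eps h a b γ β]
  have s1 := schouten (fun γ => S.br (Φ.phi a b) (Φ.B γ δ)) α β γ
  have s2 := schouten (fun δ => S.br (Φ.phi a b) (Φ.B γ δ)) α β δ
  have t2 := eps_symm γ α
  have t3 := eps_symm δ α
  have t4 := eps_symm γ β
  have t5 := eps_symm δ β
  have u := cubic_skew h a b
  have hB1 := h.B_symm γ α
  have hB2 := h.B_symm γ β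
  simp only [t2, t3, t4, t5, hB1, hB2, map_neg, LinearMap.neg_apply] at s1 s2 ⊢
  linear_combination (norm := module) -s1 - s2 - (eps β γ * eps α δ + eps β δ * eps α γ) • u
end SuperLie
end ChiralSuperspace

namespace ChiralSuperspace

variable {L : Type*} [AddCommGroup L] [Module ℂ L]

/-! ### Variations of the field equations -/

theorem fin2_cases (α : Fin 2) : α = 0 ∨ α = 1 := by omega

namespace SuperLie

/-- Even covariant derivatives `D α α'` with curvature
`[D_{αα'}, D_{ββ'}] = ε_{αβ} F̃_{α'β'} + ε_{α'β'} F_{αβ}`. -/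
structure IsCovDeriv (S : SuperLie L) (D : Fin 2 → Fin 2 → L →ₗ[ℂ] L)
    (Ft F : Fin 2 → Fin 2 → L) : Prop where
  leibniz : ∀ α α' x y, D α α' (S.br x y) = S.br (D α α' x) y + S.br x (D α α' y)
  par : ∀ α α' x, S.par (D α α' x) = D α α' (S.par x)
  comm : ∀ α α' β β' x, D α α' (D β β' x) - D β β' (D α α' x) =
    eps α β • S.br (Ft α' β') x + eps α' β' • S.br (F α β) x
  symm : ∀ α β, F α β = F β α
  symmT : ∀ α' β', Ft α' β' = Ft β' α'

/-- The operator `D^{αα'} D_{αα'}`. -/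
def boxD (D : Fin 2 → Fin 2 → L →ₗ[ℂ] L) : L →ₗ[ℂ] L :=
  ∑ α, ∑ β, ∑ α', ∑ β', (eps α β * eps α' β') • (D β β' ∘ₗ D α α')

variable (S : SuperLie L) (D : Fin 2 → Fin 2 → L →ₗ[ℂ] L) (Φ : Fields L) (lam : ℂ)

/-- The defect of the field equation for `B`. -/
def resB (α α' : Fin 2) : L :=
  ∑ β, ∑ γ, eps β γ • D γ α' (Φ.B α β) + ∑ a, S.br (Φ.psiT a α') (Φ.psi a α) +
    (1 / 2 : ℂ) • ∑ a, ∑ b, S.br (Φ.phi a b) (D α α' (raise Φ.phi a b))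

/-- The defect of the field equation for `ψ̃`. -/
def resPsiT (a : Fin 4) (α : Fin 2) : L :=
  ∑ α', ∑ β', eps α' β' • D α β' (Φ.psiT a α') -
    (2 * lam) • ∑ b, S.br (Φ.psi b α) (Φ.phi a b)

/-- The defect of the field equation for `ψ`. -/
def resPsi (a : Fin 4) (α' : Fin 2) : L :=
  ∑ α, ∑ β, eps α β • D β α' (Φ.psi a α) - ∑ b, S.br (Φ.psiT b α') (raise Φ.phi a b)

/-- The defect of the field equation for `φ`. -/
def resPhi (a b : Fin 4) : L :=
  boxD D (Φ.phi a b) -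
    ((1 / 2 : ℂ) • ∑ α', ∑ β', eps α' β' •
      (S.br (Φ.psiT a α') (Φ.psiT b β') - S.br (Φ.psiT b α') (Φ.psiT a β')) +
    lam • ∑ c, ∑ d, eps4 a b c d • ∑ α, ∑ β, eps α β • S.br (Φ.psi c α) (Φ.psi d β) -
    (2 * lam) • (1 / 2 : ℂ) • ∑ c, ∑ d,
      (S.br (Φ.phi c a) (S.br (raise Φ.phi c d) (Φ.phi b d)) -
        S.br (Φ.phi c b) (S.br (raise Φ.phi c d) (Φ.phi a d))))

/-- The variation of `ψ̃_{bα'}`. -/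
def qpsiT (a : Fin 4) (α : Fin 2) (b : Fin 4) (α' : Fin 2) : L := (2 : ℂ) • D α α' (Φ.phi a b)

/-- The variation of `F_{βγ}`. -/
def qF (a : Fin 4) (α β γ : Fin 2) : L :=
  -(1 / 2 : ℂ) • (eps α β • ∑ α', ∑ β', eps α' β' • D γ β' (Φ.psiT a α') +
    eps α γ • ∑ α', ∑ β', eps α' β' • D β β' (Φ.psiT a α'))

/-- The multiplet of fields varies by the supersymmetry transformations. -/
structure IsSusy (S : SuperLie L) (V : L → (Fin 4 → Fin 2 → L) → Prop) (Φ : Fields L) : Prop where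
  phi : ∀ b c, V (Φ.phi b c) fun a α => qphi Φ a α b c
  psi : ∀ b β, V (Φ.psi b β) fun a α => S.qpsi Φ a α b β
  B : ∀ β γ, V (Φ.B β γ) fun a α => S.qB Φ a α β γ

/-- Variations of covariant derivatives and of the fields `ψ̃`, `F`. -/
structure IsSusyD (S : SuperLie L) (V : L → (Fin 4 → Fin 2 → L) → Prop)
    (D : Fin 2 → Fin 2 → L →ₗ[ℂ] L) (F : Fin 2 → Fin 2 → L) (Φ : Fields L) : Prop
    extends IsSusy S V Φ where
  psiT : ∀ b α', V (Φ.psiT b α') fun a α => qpsiT D Φ a α b α'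
  F : ∀ β γ, V (F β γ) fun a α => qF D Φ a α β γ
  deriv : ∀ β β' {x p}, V x p →
    V (D β β' x) fun a α => D β β' (p a α) + eps α β • S.br (Φ.psiT a β') x

variable {S D Φ lam} {V : L → (Fin 4 → Fin 2 → L) → Prop} {Ft F : Fin 2 → Fin 2 → L}

/-- The variations of `F` and of `λB` have the same spinor structure, and the difference of their
coefficients is the Dirac equation of `ψ̃`. -/
theorem IsSusyD.resF (hV : S.IsVariation V) (hS : S.IsSusyD V D F Φ) (β γ) :
    V (F β γ - lam • Φ.B β γ) fun a α => -(1 / 2 : ℂ) •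
      (eps α β • S.resPsiT D Φ lam a γ + eps α γ • S.resPsiT D Φ lam a β) := by
  refine hV.congr (hV.sub (hS.F _ _) (hV.smul _ (hS.B _ _))) fun a α => ?_
  simp only [qF, qB, SuperLie.resPsiT]
  module

/-- Varying `ψ̃` inside its Dirac operator gives two derivatives of `φ`. Their part proportional to
`ε` is `□φ`; the rest is the curvature `F`, which pairs with the `B` from the variation of `ψ` to
form `F - λB`. The symmetric `F̃` drops out of the dotted contraction. -/
theorem IsSusyD.resPsiT (hV : S.IsVariation V) (hS : S.IsSusyD V D F Φ) (hD : S.IsCovDeriv D Ft F)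
    (hΦ : S.Graded Φ) (b α) :
    V (S.resPsiT D Φ lam b α) fun a β => eps β α • S.resPhi D Φ lam a b -
      (2 : ℂ) • S.br (F α β - lam • Φ.B α β) (Φ.phi a b) := by
  refine hV.congr (hV.sub (hV.sum _ fun α => hV.sum _ fun β => hV.smul _ (hS.deriv _ _ (hS.psiT _ _)))
    (hV.smul _ (hV.sum _ fun c => hV.br_odd (hΦ.psi_odd _ _) (hS.psi _ _) (hS.phi _ _))))
    fun a β => ?_
  have hT : ∑ c, ∑ d, (S.br (Φ.phi c a) (S.br (raise Φ.phi c d) (Φ.phi b d)) -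
      S.br (Φ.phi c b) (S.br (raise Φ.phi c d) (Φ.phi a d))) = -(2 : ℂ) • S.cubic Φ a b := by
    have h2 := cubic_skew hΦ a b
    have hs : ∀ a c d, S.br (raise Φ.phi c d) (Φ.phi a d) =
        -S.br (Φ.phi a d) (raise Φ.phi c d) := fun a c d => S.skew' (hΦ.phi_even _ _)
    simp only [hs, hΦ.phi_skew _ b, hΦ.phi_skew _ a, map_neg, LinearMap.neg_apply, neg_neg,
      Finset.sum_sub_distrib]
    rw [← cubic, ← cubic]
    linear_combination (norm := module) h2
  have hY : ∑ c, ∑ d, eps4 a b c d • ∑ α, ∑ β, eps α β • S.br (Φ.psi c α) (Φ.psi d β) =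
      -(2 : ℂ) • S.yukawa Φ a 0 b 1 := by
    have h2 := yukawa_skew hΦ a 1 b 0
    simp only [yukawa] at h2 ⊢
    simp only [Fin.sum_univ_two, eps_zero_zero, eps_zero_one, eps_one_zero, eps_one_one,
      zero_smul, zero_add, add_zero, smul_add, Finset.sum_add_distrib, one_smul, neg_smul,
      smul_neg, Finset.sum_neg_distrib, h2]
    module
  have hc := fun α α' β β' => hD.comm α α' β β' (Φ.phi a b)
  have hp : ∀ α' β', S.br (Φ.psiT b α') (Φ.psiT a β') = S.br (Φ.psiT a β') (Φ.psiT b α') :=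
    fun α' β' => S.symm _ _ (hΦ.psiT_odd _ _) (hΦ.psiT_odd _ _)
  have hF := hD.symm 1 0
  have hFt := hD.symmT 1 0
  rw [sum_qpsi_phi hΦ, SuperLie.resPhi, hT, hY, yukawa_eq_eps hΦ, hΦ.phi_skew b a, boxD,
    hΦ.B_symm α β, map_neg, LinearMap.neg_apply, S.skew (Φ.phi a b) _ (hΦ.phi_even a b)]
  -- For `αβ = 00` and `11` the defect is a single commutator, `c1` or `c2`; for mixed indices `c3`
  -- and `c4` symmetrise the two orderings in `□`.
  have c1 := hc 0 0 0 1
  have c2 := hc 1 0 1 1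
  have c3 := hc 0 0 1 1
  have c4 := hc 0 1 1 0
  rcases fin2_cases α with rfl | rfl <;> rcases fin2_cases β with rfl | rfl <;>
    simp only [Fin.sum_univ_two, eps_zero_zero, eps_zero_one, eps_one_zero, eps_one_one, qpsiT,
        zero_smul, zero_add, add_zero, map_smul, LinearMap.add_apply, LinearMap.smul_apply,
        LinearMap.comp_apply, mul_zero, mul_one, one_smul, mul_neg, neg_neg, neg_smul,
        hp, map_sub, LinearMap.sub_apply, LinearMap.neg_apply, LinearMap.zero_apply, hF,
          hFt] at c1 c2 c3 c4 ⊢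
  · linear_combination (norm := module) (-2 : ℂ) • c1
  · linear_combination (norm := module) c4 - c3
  · linear_combination (norm := module) c4 - c3
  · linear_combination (norm := module) (-2 : ℂ) • c2

/-- The two kinds of terms `φ Dφ`, one from varying `ψ` and one from varying `ψ̃`, combine by the
Clifford relation into a pure trace. The variation is therefore diagonal in the `SU(4)` indices,
with the `B` equation as coefficient. -/
theorem IsSusyD.resPsi (hV : S.IsVariation V) (hS : S.IsSusyD V D F Φ) (hD : S.IsCovDeriv D Ft F)
    (hΦ : S.Graded Φ) (b α') :
    V (S.resPsi D Φ b α') fun a δ => if a = b then S.resB D Φ δ α' else 0 := by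
  refine hV.congr (hV.sub (hV.sum _ fun α => hV.sum _ fun β => hV.smul _ (hS.deriv _ _ (hS.psi _ _)))
    (hV.sum _ fun c => hV.br_odd (hΦ.psiT_odd _ _) (hS.psiT _ _) (hV.raise hS.phi _ _)))
    fun a δ => ?_
  have hr := fun b c => raise_eps4 (fun d => Φ.psi d δ) a b c
  have hc := sum_raise_clifford S.br hΦ.phi_skew (χ := fun a c => D δ α' (Φ.phi a c))
    (fun a c => by simp only [hΦ.phi_skew a c, map_neg]) a b
  have hs : ∀ c, S.br (D δ α' (Φ.phi a c)) (raise Φ.phi b c) =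
      -S.br (raise Φ.phi b c) (D δ α' (Φ.phi a c)) := fun c =>
    S.skew _ _ (by rw [hD.par, hΦ.phi_even])
  simp only [← map_raise] at hc
  have hK : D δ α' (∑ c, S.br (Φ.phi a c) (raise Φ.phi b c)) =
      ∑ c, S.br (Φ.phi a c) (D δ α' (raise Φ.phi b c)) -
        ∑ c, S.br (raise Φ.phi b c) (D δ α' (Φ.phi a c)) := by
    simp only [map_sum, hD.leibniz, hs, Finset.sum_add_distrib, Finset.sum_neg_distrib]
    abel
  simp only [qphi, hr, qpsiT, map_sub, map_smul, LinearMap.smul_apply, hs, map_ite_zero,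
    Finset.sum_sub_distrib, Finset.sum_neg_distrib, smul_neg, Finset.sum_ite_eq, Finset.mem_univ,
    if_true, ← Finset.smul_sum]
  simp only [qpsi, map_add, map_neg, map_smul, map_ite_zero]
  rcases eq_or_ne a b with rfl | hab
  · simp only [if_true, SuperLie.resB] at hc ⊢
    rcases fin2_cases δ with rfl | rfl <;>
      simp only [Fin.sum_univ_two, eps_zero_zero, eps_zero_one, eps_one_zero, eps_one_one,
        zero_smul, zero_add, add_zero] <;>
      linear_combination (norm := module) hc + hK
  · simp only [if_neg hab] at hc ⊢
    rcases fin2_cases δ with rfl | rfl <;>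
      simp only [Fin.sum_univ_two, eps_zero_zero, eps_zero_one, eps_one_zero, eps_one_one,
        zero_smul, zero_add, add_zero,
        Finset.sum_const_zero] <;>
      linear_combination (norm := module) hc + hK

end SuperLie
end ChiralSuperspace

/-! ### Variation of the field equation for `B`. -/

namespace ChiralSuperspace

variable {L : Type*} [AddCommGroup L] [Module ℂ L]
namespace SuperLie
variable {S : SuperLie L} {D : Fin 2 → Fin 2 → L →ₗ[ℂ] L} {Φ : Fields L} {lam : ℂ}
  {V : L → (Fin 4 → Fin 2 → L) → Prop} {Ft F : Fin 2 → Fin 2 → L}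

/-- By skewness and Jacobi every term becomes a combination of `[φ, [φ, ψ̃]]`, and these are
compared component by component. This cancels the terms without derivatives in the variation of the
`B` equation. -/
theorem jacobi_phi_phi_psiT (h : S.Graded Φ) (a : Fin 4) (α' : Fin 2) :
    ∑ b, S.br (Φ.psiT b α') (∑ c, S.br (Φ.phi a c) (raise Φ.phi b c)) +
      (1 / 2 : ℂ) • ∑ b, ∑ c, S.br (Φ.phi b c) (S.br (Φ.psiT a α') (raise Φ.phi b c)) =
    (2 : ℂ) • ∑ b, ∑ c, S.br (S.br (Φ.psiT c α') (raise Φ.phi b c)) (Φ.phi a b) := by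
  have h0 : ∀ a b d, S.br (Φ.psiT d α') (Φ.phi a b) = -S.br (Φ.phi a b) (Φ.psiT d α') :=
    fun a b d => S.skew' (h.phi_even _ _)
  have h1 : ∀ a b d x y, S.br (S.br (Φ.phi a b) (Φ.psiT d α')) (Φ.phi x y) = 
      -S.br (Φ.phi x y) (S.br (Φ.phi a b) (Φ.psiT d α')) := 
    fun a b d x y => S.skew' (h.phi_even _ _)
  have h2 : ∀ a b c e d, S.br (Φ.psiT d α') (S.br (Φ.phi a b) (Φ.phi c e)) =
      S.br (Φ.phi c e) (S.br (Φ.phi a b) (Φ.psiT d α')) -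
        S.br (Φ.phi a b) (S.br (Φ.phi c e) (Φ.psiT d α')) := by
    intro a b c e d
    have := S.jacobi_even (Φ.phi a b) (Φ.phi c e) (Φ.psiT d α') (h.phi_even _ _)
    rw [S.skew' (by rw [S.par_br, h.phi_even, h.phi_even]), this]
    abel
  have r := raise_table h.phi_skew
  have s := phi_table h.phi_skew
  revert a
  refine forall_fin4 ?_ ?_ ?_ ?_ <;>
    simp [Fin.sum_univ_four, r, s, h0, h1, h2] <;> module

theorem IsSusyD.resB (hV : S.IsVariation V) (hS : S.IsSusyD V D F Φ) (hD : S.IsCovDeriv D Ft F)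
    (hΦ : S.Graded Φ) (α α') :
    V (S.resB D Φ α α') fun a δ =>
      -(2 * eps δ α) • ∑ b, S.br (S.resPsi D Φ b α') (Φ.phi a b) := by
  refine hV.congr (hV.add (hV.add
    (hV.sum _ fun β => hV.sum _ fun γ => hV.smul _ (hS.deriv _ _ (hS.B _ _)))
    (hV.sum _ fun b => hV.br_odd (hΦ.psiT_odd _ _) (hS.psiT _ _) (hS.psi _ _)))
    (hV.smul _ (hV.sum _ fun b => hV.sum _ fun c => hV.br_even (hΦ.phi_even _ _) (hS.phi _ _)
      (hS.deriv _ _ (hV.raise hS.phi _ _))))) fun a δ => ?_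
  have hJ := jacobi_phi_phi_psiT hΦ a α'
  have hr := fun b c => raise_eps4 (fun d => Φ.psi d δ) a b c
  -- `e1` and `e2` are the two halves of the variation of `[φ_{bc}, Dφ^{bc}]`. Contracting the
  -- symbol with `φ^{bc}` gives twice `φ_{ad}`.
  have e1 : ∑ b, ∑ c, S.br (qphi Φ a δ b c) (D α α' (raise Φ.phi b c)) =
      (2 : ℂ) • ∑ b, S.br (Φ.psi b δ) (D α α' (Φ.phi a b)) := by
    have h4 : ∀ d, ∑ b, ∑ c, eps4 a b c d • raise Φ.phi b c = (2 : ℂ) • Φ.phi a d := by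
      intro d
      simp only [sum_eps4_raise hΦ.phi_skew, if_true, Finset.sum_add_distrib, Finset.sum_ite_eq',
        Finset.mem_univ, Finset.sum_const, Finset.card_univ, Fintype.card_fin]
      rw [hΦ.phi_skew d a]
      module
    simp only [qphi, map_sum, LinearMap.sum_apply, map_smul, LinearMap.smul_apply, Finset.smul_sum]
    rw [Finset.sum_congr rfl fun b _ => Finset.sum_comm, Finset.sum_comm]
    refine Finset.sum_congr rfl fun d _ => ?_
    simp only [← map_smul, ← map_sum, h4]
  have e2 : ∑ b, ∑ c, S.br (Φ.phi b c) (D α α' (raise (qphi Φ a δ) b c)) =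
      -(2 : ℂ) • ∑ b, S.br (D α α' (Φ.psi b δ)) (Φ.phi a b) := by
    simp only [show qphi Φ a δ = fun b c => ∑ d, eps4 a b c d • Φ.psi d δ from rfl, hr, map_sub,
      map_ite_zero, Finset.sum_sub_distrib, Finset.sum_ite_eq, Finset.mem_univ, if_true]
    have h4 : ∀ b c, S.br (Φ.phi b c) (D α α' (Φ.psi b δ)) =
      S.br (D α α' (Φ.psi b δ)) (Φ.phi c b) := fun b c => by
        rw [hΦ.phi_skew b c, map_neg, LinearMap.neg_apply, S.skew _ _ (hΦ.phi_even c b), neg_neg]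
    have h5 : ∀ b c, S.br (Φ.phi b c) (D α α' (Φ.psi c δ)) =
      -S.br (D α α' (Φ.psi c δ)) (Φ.phi b c) := fun b c => S.skew _ _ (hΦ.phi_even b c)
    rw [Finset.sum_comm]
    simp only [Finset.sum_ite_eq, Finset.mem_univ, if_true, h4, h5, Finset.sum_neg_distrib]
    module
  have e3 : ∑ b, S.br (Φ.psiT b α') (S.qpsi Φ a δ b α) =
      -(eps δ α) • ∑ b, S.br (Φ.psiT b α') (∑ c, S.br (Φ.phi a c) (raise Φ.phi b c)) +
        S.br (Φ.psiT a α') (Φ.B δ α) := by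
    simp only [qpsi, map_add, map_neg, map_smul, map_ite_zero, Finset.sum_add_distrib,
      Finset.sum_neg_distrib, Finset.sum_ite_eq, Finset.mem_univ, if_true, ← Finset.smul_sum,
      neg_smul]
  have e4 : ∀ b, S.br (D δ α' (Φ.phi a b)) (Φ.psi b α) =
      -S.br (Φ.psi b α) (D δ α' (Φ.phi a b)) := fun b =>
    S.skew _ _ (by rw [hD.par, hΦ.phi_even])
  have e5 : ∑ b, S.br (S.resPsi D Φ b α') (Φ.phi a b) =
      ∑ α, ∑ β, eps α β • ∑ b, S.br (D β α' (Φ.psi b α)) (Φ.phi a b) -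
        ∑ b, ∑ c, S.br (S.br (Φ.psiT c α') (raise Φ.phi b c)) (Φ.phi a b) := by
    simp only [SuperLie.resPsi, map_sub, LinearMap.sub_apply, map_sum, LinearMap.sum_apply,
      map_smul, LinearMap.smul_apply, Finset.sum_sub_distrib, Finset.smul_sum]
    congr 1
    rw [Finset.sum_comm]
    exact Finset.sum_congr rfl fun α _ => Finset.sum_comm
  have e6 : ∀ α β γ, D γ α' (S.qB Φ a δ α β) =
      -(eps δ α • (∑ b, S.br (D γ α' (Φ.psi b β)) (Φ.phi a b) +
          ∑ b, S.br (Φ.psi b β) (D γ α' (Φ.phi a b))) +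
        eps δ β • (∑ b, S.br (D γ α' (Φ.psi b α)) (Φ.phi a b) +
          ∑ b, S.br (Φ.psi b α) (D γ α' (Φ.phi a b)))) := by
    intro α β γ
    simp only [qB, map_smul, map_add, map_sum, hD.leibniz, Finset.sum_add_distrib]
    module
  simp only [e6, e3, e5, qpsiT, Finset.sum_sub_distrib, Finset.sum_add_distrib, e1, e2, e4,
    map_smul, LinearMap.smul_apply, map_add, smul_neg]
  rcases fin2_cases α with rfl | rfl <;> rcases fin2_cases δ with rfl | rfl <;>
    simp only [Fin.sum_univ_two, eps_zero_zero, eps_zero_one, eps_one_zero, eps_one_one,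
        zero_smul, zero_add, add_zero, hΦ.B_symm 1 0, Finset.sum_neg_distrib,
          Finset.sum_const_zero, ← Finset.smul_sum] 
  · module
  · linear_combination (norm := module) -hJ
  · linear_combination (norm := module) hJ
  · module

end SuperLie
end ChiralSuperspace

/-! ### The operator `D^{αα'} D_{αα'}`: variation and Weitzenböck formula. -/

namespace ChiralSuperspace

variable {L : Type*} [AddCommGroup L] [Module ℂ L]
namespace SuperLie
variable {S : SuperLie L} {D : Fin 2 → Fin 2 → L →ₗ[ℂ] L} {Φ : Fields L} {lam : ℂ}
  {V : L → (Fin 4 → Fin 2 → L) → Prop} {Ft F : Fin 2 → Fin 2 → L}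

theorem boxD_apply (x : L) : boxD D x =
    ∑ α, ∑ β, ∑ α', ∑ β', (eps α β * eps α' β') • D β β' (D α α' x) := by
  simp [boxD]

/-- Passing the variation through each of the two derivatives yields a bracket with `ψ̃`. The second
derivative may fall on `x`, which happens twice, or on `ψ̃`, which produces the Dirac operator on
`ψ̃`. -/
theorem IsSusyD.box (hV : S.IsVariation V) (hS : S.IsSusyD V D F Φ) (hD : S.IsCovDeriv D Ft F)
    {x p} (hx : V x p) :
    V (boxD D x) fun c γ => boxD D (p c γ) -
      (2 : ℂ) • ∑ α', ∑ β', eps α' β' • S.br (Φ.psiT c α') (D γ β' x) -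
      S.br (∑ α', ∑ β', eps α' β' • D γ β' (Φ.psiT c α')) x := by
  rw [boxD_apply]
  refine hV.congr (hV.sum _ fun α => hV.sum _ fun β => hV.sum _ fun α' => hV.sum _ fun β' =>
    hV.smul _ (hS.deriv _ _ (hS.deriv _ _ hx))) fun c γ => ?_
  rw [boxD_apply]
  rcases fin2_cases γ with rfl | rfl <;>
    simp only [Fin.sum_univ_two, eps_zero_zero, eps_zero_one, eps_one_zero, eps_one_one,
        zero_smul, zero_add, add_zero, mul_zero, zero_mul, mul_one, map_add, map_smul, hD.leibniz,
        one_mul, LinearMap.add_apply, LinearMap.smul_apply] <;> module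

/-- The square of the Dirac operator is `-½ □` minus a curvature term. Only `F` contributes to the
latter; the symmetry of `F̃` removes the other part of the curvature. -/
theorem box_eq_dirac (hD : S.IsCovDeriv D Ft F) (x : Fin 2 → L) (γ : Fin 2) :
    boxD D (x γ) = -(2 : ℂ) • ∑ α', ∑ β', eps α' β' • D γ β' (∑ β, ∑ α, eps β α • D α α' (x β)) -
      (2 : ℂ) • ∑ β, ∑ α, eps β α • S.br (F γ α) (x β) := by
  have c1 := hD.comm 0 0 0 1 (x 1)
  have c2 := hD.comm 1 0 1 1 (x 0)
  have c3 := hD.comm 0 0 1 1 (x γ)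
  have c4 := hD.comm 0 1 1 0 (x γ)
  have hF := hD.symm 1 0
  have hFt := hD.symmT 1 0
  rw [boxD_apply]
  rcases fin2_cases γ with rfl | rfl <;>
    simp only [Fin.sum_univ_two, eps_zero_zero, eps_zero_one, eps_one_zero, eps_one_one, map_add,
        zero_smul, zero_add, add_zero, mul_zero, mul_one, map_smul, hF, hFt] at c1 c2 c3 c4 ⊢
  · linear_combination (norm := module) c4 - c3 + (2 : ℂ) • c1
  · linear_combination (norm := module) c3 - c4 - (2 : ℂ) • c2

end SuperLie
end ChiralSuperspace

/-! ### Trilinear terms in the variation of the field equation for `φ`. -/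

namespace ChiralSuperspace

variable {L : Type*} [AddCommGroup L] [Module ℂ L]
namespace SuperLie
variable {S : SuperLie L} {D : Fin 2 → Fin 2 → L →ₗ[ℂ] L} {Φ : Fields L} {lam : ℂ}
  {V : L → (Fin 4 → Fin 2 → L) → Prop} {Ft F : Fin 2 → Fin 2 → L}

-- All terms of type `ψφφ` in the variation of the `φ` equation, stripped of `λ`: the first two come
-- from the source of the `ψ̃` equation, the third from the Yukawa term, the last sum from the cubic
-- term. Rewritten with `[φ, [φ, ψ]]` by Jacobi and skewness, they cancel in each of the `6 × 4`
-- components.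
set_option maxHeartbeats 4000000 in
theorem cubic_variation (h : S.Graded Φ) (γ : Fin 2) (c a b : Fin 4) :
    (2 : ℂ) • S.br (∑ d, S.br (Φ.psi d γ) (Φ.phi c d)) (Φ.phi a b) +
      (4 : ℂ) • ∑ d, eps4 c a b d •
        ∑ e, S.br (∑ f, S.br (Φ.psi f γ) (Φ.phi e f)) (raise Φ.phi d e) +
      (2 : ℂ) • ∑ d, ∑ e, eps4 a b d e •
        S.br (∑ f, S.br (Φ.phi c f) (raise Φ.phi d f)) (Φ.psi e γ) -
      ∑ d, ∑ e,
        (S.br (qphi Φ c γ d a) (S.br (raise Φ.phi d e) (Φ.phi b e)) +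
          S.br (Φ.phi d a) (S.br (raise (qphi Φ c γ) d e) (Φ.phi b e) +
            S.br (raise Φ.phi d e) (qphi Φ c γ b e)) -
          (S.br (qphi Φ c γ d b) (S.br (raise Φ.phi d e) (Φ.phi a e)) +
          S.br (Φ.phi d b) (S.br (raise (qphi Φ c γ) d e) (Φ.phi a e) +
            S.br (raise Φ.phi d e) (qphi Φ c γ a e)))) = 0 := by
  have h0 : ∀ a b d, S.br (Φ.psi d γ) (Φ.phi a b) = -S.br (Φ.phi a b) (Φ.psi d γ) :=
    fun a b d => S.skew' (h.phi_even _ _)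
  have h1 : ∀ a b d x y, S.br (S.br (Φ.phi a b) (Φ.psi d γ)) (Φ.phi x y) =
      -S.br (Φ.phi x y) (S.br (Φ.phi a b) (Φ.psi d γ)) :=
    fun a b d x y => S.skew' (h.phi_even _ _)
  have h3 : ∀ a b c e d, S.br (S.br (Φ.phi a b) (Φ.phi c e)) (Φ.psi d γ) =
      S.br (Φ.phi a b) (S.br (Φ.phi c e) (Φ.psi d γ)) -
        S.br (Φ.phi c e) (S.br (Φ.phi a b) (Φ.psi d γ)) := by
    intro a b c e d
    rw [S.jacobi_even (Φ.phi a b) (Φ.phi c e) (Φ.psi d γ) (h.phi_even _ _)]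
    abel
  have h2 : ∀ a b c e d, S.br (Φ.psi d γ) (S.br (Φ.phi a b) (Φ.phi c e)) =
      S.br (Φ.phi c e) (S.br (Φ.phi a b) (Φ.psi d γ)) -
        S.br (Φ.phi a b) (S.br (Φ.phi c e) (Φ.psi d γ)) := by
    intro a b c e d
    rw [S.skew' (by rw [S.par_br, h.phi_even, h.phi_even]), h3]
    abel
  have hq : ∀ b d, raise (qphi Φ c γ) b d =
      (if c = b then Φ.psi d γ else 0) - (if c = d then Φ.psi b γ else 0) :=
    fun b d => raise_eps4 (fun d => Φ.psi d γ) c b d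
  have r := raise_table h.phi_skew
  have s := phi_table h.phi_skew
  refine eq_zero_of_skew (f := fun a b =>
    (2 : ℂ) • S.br (∑ d, S.br (Φ.psi d γ) (Φ.phi c d)) (Φ.phi a b) +
      (4 : ℂ) • ∑ d, eps4 c a b d •
        ∑ e, S.br (∑ f, S.br (Φ.psi f γ) (Φ.phi e f)) (raise Φ.phi d e) +
      (2 : ℂ) • ∑ d, ∑ e, eps4 a b d e •
        S.br (∑ f, S.br (Φ.phi c f) (raise Φ.phi d f)) (Φ.psi e γ) -
      ∑ d, ∑ e,
        (S.br (qphi Φ c γ d a) (S.br (raise Φ.phi d e) (Φ.phi b e)) +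
          S.br (Φ.phi d a) (S.br (raise (qphi Φ c γ) d e) (Φ.phi b e) +
            S.br (raise Φ.phi d e) (qphi Φ c γ b e)) -
          (S.br (qphi Φ c γ d b) (S.br (raise Φ.phi d e) (Φ.phi a e)) +
          S.br (Φ.phi d b) (S.br (raise (qphi Φ c γ) d e) (Φ.phi a e) +
            S.br (raise Φ.phi d e) (qphi Φ c γ a e))))) (fun a b => ?_) ?_ ?_ ?_ ?_ ?_ ?_ a b
  · simp only [(eps4_rotate _ a b _).2.1, h.phi_skew a b, (eps4_rotate a b _ _).1, neg_smul,
      Finset.sum_neg_distrib, map_neg, smul_neg, Finset.sum_sub_distrib]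
    abel
  all_goals
    revert c
    refine forall_fin4 ?_ ?_ ?_ ?_ <;> intro hq <;> simp only [hq] <;>
    simp only [Fin.sum_univ_four, eps4_same, eps4_perm, qphi, zero_smul, one_smul, neg_smul, r, s,
      Fin.reduceEq, if_true, if_false, add_zero, zero_add, smul_zero, map_zero, map_neg, map_add,
      map_sub, LinearMap.zero_apply, LinearMap.neg_apply, LinearMap.add_apply, LinearMap.sub_apply,
      sub_zero, zero_sub, sub_self, neg_zero, neg_neg, smul_neg] <;>
    simp only [h0, h1, h2, h3, map_neg, neg_neg, LinearMap.neg_apply] <;> module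

end SuperLie
end ChiralSuperspace

/-! ### Variation of the field equation for `φ`. -/

namespace ChiralSuperspace

variable {L : Type*} [AddCommGroup L] [Module ℂ L]
namespace SuperLie
variable {S : SuperLie L} {D : Fin 2 → Fin 2 → L →ₗ[ℂ] L} {Φ : Fields L} {lam : ℂ}
  {V : L → (Fin 4 → Fin 2 → L) → Prop} {Ft F : Fin 2 → Fin 2 → L}

/-- Expanding the symbol times the dual of `χ` by `sum_eps4_raise` trades the dual for `χ` itself.
It is used with `y = ψ̃`, and with `χ = Dφ` for the field equation of `φ` or `χ = φ` for closure on
`ψ̃`. -/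
theorem psiT_phi_variation {χ : Fin 4 → Fin 4 → L}
    (hχ : ∀ a b, χ a b = -χ b a) (y : Fin 4 → L) (a b c : Fin 4) :
    (∑ d, eps4 c a b d • ∑ e, S.br (y e) (raise χ d e)) + S.br (y c) (χ a b) =
      S.br (y a) (χ c b) - S.br (y b) (χ c a) := by
  have h1 : ∀ e, ∑ d, eps4 c a b d • raise χ d e = (if e = c then χ b a else 0) +
      (if e = a then χ c b else 0) + (if e = b then χ a c else 0) := by
    intro e
    rw [← sum_eps4_raise hχ]
    refine Finset.sum_congr rfl fun d _ => ?_
    rw [raise_skew d e, (eps4_rotate c a b d).2.2, neg_smul, smul_neg, neg_neg]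
  simp only [Finset.smul_sum, ← map_smul]
  rw [Finset.sum_comm]
  simp only [← map_sum, h1, map_add, map_ite_zero, Finset.sum_add_distrib, Finset.sum_ite_eq',
    Finset.mem_univ, if_true]
  rw [hχ b a, hχ a c]
  simp only [map_neg]
  abel

theorem sum_eps4_swap (f : Fin 4 → Fin 4 → L) (a b : Fin 4) :
    ∑ d, ∑ e, eps4 a b d e • f e d = -∑ d, ∑ e, eps4 a b d e • f d e := by
  rw [Finset.sum_comm]
  simp only [← Finset.sum_neg_distrib]
  refine Finset.sum_congr rfl fun d _ => Finset.sum_congr rfl fun e _ => ?_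
  rw [(eps4_rotate a b e d).2.2, neg_smul]

/-- Skewness of the symbol in `de` makes the variations of the two `ψ` factors contribute equally,
which explains the factors `2`. -/
theorem yukawa_variation (h : S.Graded Φ) (γ : Fin 2) (c a b : Fin 4) :
    ∑ d, ∑ e, eps4 a b d e • ∑ α, ∑ β, eps α β •
      (S.br (S.qpsi Φ c γ d α) (Φ.psi e β) - S.br (Φ.psi d α) (S.qpsi Φ c γ e β)) =
    (2 : ℂ) • ∑ d, ∑ e, eps4 a b d e •
        S.br (∑ f, S.br (Φ.phi c f) (raise Φ.phi d f)) (Φ.psi e γ) -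
      (2 : ℂ) • ∑ d, eps4 c a b d • ∑ β, ∑ α, eps β α • S.br (Φ.B γ α) (Φ.psi d β) := by
  set K : Fin 4 → L := fun d => ∑ f, S.br (Φ.phi c f) (raise Φ.phi d f) with hK
  have hKe : ∀ d, S.par (K d) = K d := fun d => by
    simp only [hK, map_sum, S.par_br, raise, map_smul, h.phi_even]
  set y : Fin 4 → L := fun d => ∑ β, ∑ α, eps β α • S.br (Φ.B γ α) (Φ.psi d β) with hy
  have e1 : ∀ d e, ∑ α, ∑ β, eps α β •
      (S.br (S.qpsi Φ c γ d α) (Φ.psi e β) - S.br (Φ.psi d α) (S.qpsi Φ c γ e β)) =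
      S.br (K d) (Φ.psi e γ) - S.br (K e) (Φ.psi d γ) - (if c = d then y e else 0) +
        (if c = e then y d else 0) := by
    intro d e
    have h1 : ∀ α, S.br (Φ.psi d α) (K e) = -S.br (K e) (Φ.psi d α) := fun α => S.skew' (hKe e)
    have h2 : ∀ α β, S.br (Φ.psi d α) (Φ.B γ β) = -S.br (Φ.B γ β) (Φ.psi d α) :=
      fun α β => S.skew' (h.B_even _ _)
    simp only [qpsi, ← show ∀ d, K d = ∑ f, S.br (Φ.phi c f) (raise Φ.phi d f) from fun d => rfl,
      map_add, map_neg, map_smul, LinearMap.add_apply, LinearMap.neg_apply, LinearMap.smul_apply,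
      map_ite_zero, h1, hy]
    have hite : ∀ (P : Prop) [Decidable P] (x : L →ₗ[ℂ] L) (y : L),
        (if P then x else 0) y = if P then x y else 0 := fun P _ x y => by split_ifs <;> simp
    rcases fin2_cases γ with rfl | rfl <;>
      simp only [Fin.sum_univ_two, eps_zero_zero, eps_zero_one, eps_one_zero, eps_one_one, hite] <;>
      split_ifs <;> (try simp only [h2]) <;> module
  have e2 : ∑ d, ∑ e, eps4 a b d e • (if c = d then y e else 0) = ∑ d, eps4 c a b d • y d := by
    simp only [smul_ite, smul_zero]
    rw [Finset.sum_comm]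
    simp only [Finset.sum_ite_eq, Finset.mem_univ, if_true]
    refine Finset.sum_congr rfl fun d _ => ?_
    rw [(eps4_rotate a b c d).2.1, (eps4_rotate a c b d).1, neg_neg]
  have e3 := sum_eps4_swap (fun d e => S.br (K d) (Φ.psi e γ)) a b
  have e4 := sum_eps4_swap (fun d e => if c = d then y e else 0) a b
  rw [e2] at e4
  simp only [e1]
  simp only [smul_add, smul_sub, Finset.sum_add_distrib, Finset.sum_sub_distrib, e2, e3]
  have e5 : ∑ d, ∑ e, eps4 a b d e • (if c = e then y d else 0) = -∑ d, eps4 c a b d • y d := e4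
  rw [e5]
  simp only [hy]
  module

/-- Since `φ` varies into `ψ`, the Weitzenböck formula turns `□` of the variation into the Dirac
operator applied to the `ψ` equation. The `ψ̃ψ̃` and Yukawa terms complete the defects of `ψ`, `ψ̃`
and `F - λB`; what is left over is `λ` times `cubic_variation`. -/
theorem IsSusyD.resPhi (hV : S.IsVariation V) (hS : S.IsSusyD V D F Φ) (hD : S.IsCovDeriv D Ft F)
    (hΦ : S.Graded Φ) (a b) :
    V (S.resPhi D Φ lam a b) fun c γ =>
      -S.br (S.resPsiT D Φ lam c γ) (Φ.phi a b) -
        (2 : ℂ) • ∑ d, eps4 c a b d • (∑ α', ∑ β', eps α' β' • D γ β' (S.resPsi D Φ d α') +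
          ∑ e, S.br (S.resPsiT D Φ lam e γ) (raise Φ.phi d e) +
          ∑ β, ∑ α, eps β α • S.br (F γ α - lam • Φ.B γ α) (Φ.psi d β)) := by
  refine hV.congr (hV.sub (hS.box hV hD (hS.phi _ _)) (hV.sub (hV.add
    (hV.smul _ <| hV.sum _ fun α' => hV.sum _ fun β' => hV.smul _ <|
      hV.sub (hV.br_odd (hΦ.psiT_odd _ _) (hS.psiT _ _) (hS.psiT _ _))
        (hV.br_odd (hΦ.psiT_odd _ _) (hS.psiT _ _) (hS.psiT _ _)))
    (hV.smul _ <| hV.sum _ fun d => hV.sum _ fun e => hV.smul _ <| hV.sum _ fun α => hV.sum _ fun β =>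
      hV.smul _ <| hV.br_odd (hΦ.psi_odd _ _) (hS.psi _ _) (hS.psi _ _)))
    (hV.smul _ <| hV.smul _ <| hV.sum _ fun d => hV.sum _ fun e => hV.sub
      (hV.br_even (hΦ.phi_even _ _) (hS.phi _ _) <|
        hV.br_even (by rw [raise]; simp [hΦ.phi_even]) (hV.raise hS.phi _ _) (hS.phi _ _))
      (hV.br_even (hΦ.phi_even _ _) (hS.phi _ _) <|
        hV.br_even (by rw [raise]; simp [hΦ.phi_even]) (hV.raise hS.phi _ _) (hS.phi _ _)))))
    fun c γ => ?_
  have hcub := cubic_variation hΦ γ c a b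
  have hbox : boxD D (qphi Φ c γ a b) = -(2 : ℂ) • ∑ d, eps4 c a b d • (∑ α', ∑ β', eps α' β' •
      D γ β' (∑ β, ∑ α, eps β α • D α α' (Φ.psi d β)) +
      ∑ β, ∑ α, eps β α • S.br (F γ α) (Φ.psi d β)) := by
    simp only [qphi, map_sum (boxD D), map_smul (boxD D), box_eq_dirac hD (Φ.psi _)]
    rw [Finset.smul_sum]
    refine Finset.sum_congr rfl fun d _ => ?_
    module
  have hmul : ∀ d, ∑ α', ∑ β', eps α' β' • D γ β' (∑ e, S.br (Φ.psiT e α') (raise Φ.phi d e)) =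
      ∑ e, S.br (∑ α', ∑ β', eps α' β' • D γ β' (Φ.psiT e α')) (raise Φ.phi d e) +
      ∑ α', ∑ β', eps α' β' • ∑ e, S.br (Φ.psiT e α')
        (raise (fun x y => D γ β' (Φ.phi x y)) d e) := by
    intro d
    simp only [← map_raise, map_sum, hD.leibniz, Finset.sum_add_distrib, smul_add,
      LinearMap.sum_apply, map_smul, LinearMap.smul_apply, Finset.smul_sum]
    congr 1
    rw [Finset.sum_congr rfl fun α' _ => Finset.sum_comm, Finset.sum_comm]
  have hpsi : ∑ α', ∑ β', eps α' β' • (S.br (qpsiT D Φ c γ a α') (Φ.psiT b β') -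
      S.br (Φ.psiT a α') (qpsiT D Φ c γ b β') - (S.br (qpsiT D Φ c γ b α') (Φ.psiT a β') -
      S.br (Φ.psiT b α') (qpsiT D Φ c γ a β'))) = -(4 : ℂ) • ∑ α', ∑ β', eps α' β' •
      ((∑ d, eps4 c a b d • ∑ e, S.br (Φ.psiT e α') (raise (fun x y => D γ β' (Φ.phi x y)) d e)) +
        S.br (Φ.psiT c α') (D γ β' (Φ.phi a b))) := by
    have h1 : ∀ α' β', (∑ d, eps4 c a b d • ∑ e, S.br (Φ.psiT e α')
        (raise (fun x y => D γ β' (Φ.phi x y)) d e)) +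
        S.br (Φ.psiT c α') (D γ β' (Φ.phi a b)) = S.br (Φ.psiT a α') (D γ β' (Φ.phi c b)) -
          S.br (Φ.psiT b α') (D γ β' (Φ.phi c a)) := fun α' β' =>
      psiT_phi_variation (χ := fun x y => D γ β' (Φ.phi x y))
        (fun x y => by rw [hΦ.phi_skew x y, map_neg]) (fun e => Φ.psiT e α') a b c
    have h2 : ∀ x y z α' β', S.br (D γ α' (Φ.phi x y)) (Φ.psiT z β') =
        -S.br (Φ.psiT z β') (D γ α' (Φ.phi x y)) := fun x y z α' β' =>
      S.skew _ _ (by rw [hD.par, hΦ.phi_even])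
    simp only [h1, qpsiT, map_smul, LinearMap.smul_apply, h2, Fin.sum_univ_two, eps_zero_zero,
      eps_zero_one, eps_one_zero, eps_one_one]
    module
  have hsum : ∑ d, eps4 c a b d • ∑ α', ∑ β', eps α' β' • ∑ e, S.br (Φ.psiT e α')
        (raise (fun x y => D γ β' (Φ.phi x y)) d e) = ∑ α', ∑ β', eps α' β' •
      (∑ d, eps4 c a b d • ∑ e, S.br (Φ.psiT e α') (raise (fun x y => D γ β' (Φ.phi x y)) d e)) := by
    simp only [Fin.sum_univ_two, Finset.smul_sum, smul_add, Finset.sum_add_distrib,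
      smul_comm (eps4 _ _ _ _)]
  rw [hpsi, yukawa_variation hΦ, hbox]
  simp only [SuperLie.resPsi, SuperLie.resPsiT, map_sub, LinearMap.sub_apply, map_smul,
    LinearMap.smul_apply,
    smul_sub, smul_add, Finset.sum_sub_distrib, Finset.sum_add_distrib, hmul, hsum]
  simp only [fun c a b d (x : L) => smul_comm (eps4 c a b d) (2 * lam) x,
    fun α β (x : L) => smul_comm (eps α β) lam x,
    fun c a b d (x : L) => smul_comm (eps4 c a b d) lam x, ← Finset.smul_sum]
  simp only [Finset.sum_sub_distrib, Finset.sum_add_distrib] at hcub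
  linear_combination (norm := module) (-lam) • hcub

end SuperLie
end ChiralSuperspace

/-! ### Closure of the supersymmetry algebra on `ψ̃`. -/

namespace ChiralSuperspace

variable {L : Type*} [AddCommGroup L] [Module ℂ L]
namespace SuperLie
variable {S : SuperLie L} {D : Fin 2 → Fin 2 → L →ₗ[ℂ] L} {Φ : Fields L} {lam : ℂ}
  {V : L → (Fin 4 → Fin 2 → L) → Prop} {Ft F : Fin 2 → Fin 2 → L}

/-- The second variation of `ψ̃_{cβ'}`. -/
def rpsiT (S : SuperLie L) (D : Fin 2 → Fin 2 → L →ₗ[ℂ] L) (Φ : Fields L) (a : Fin 4) (α : Fin 2)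
    (b : Fin 4) (β : Fin 2) (c : Fin 4) (β' : Fin 2) : L :=
  (2 : ℂ) • (D β β' (qphi Φ a α b c) + eps α β • S.br (Φ.psiT a β') (Φ.phi b c))

theorem IsSusyD.qpsiT (hV : S.IsVariation V) (hS : S.IsSusyD V D F Φ) (b β c β') :
    V (qpsiT D Φ b β c β') fun a α => S.rpsiT D Φ a α b β c β' :=
  hV.smul _ (hS.deriv _ _ (hS.phi _ _))

/-- The supersymmetry algebra closes on `ψ̃` up to the field equation of `ψ`. -/
theorem closure_psiT (hΦ : S.Graded Φ) (a α b β c β') :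
    S.rpsiT D Φ a α b β c β' + S.rpsiT D Φ b β a α c β' =
      (2 * eps α β) • (S.br (Φ.phi a b) (Φ.psiT c β') +
        ∑ d, eps4 a b c d • S.resPsi D Φ d β') := by
  have h := psiT_phi_variation (S := S) hΦ.phi_skew (fun e => Φ.psiT e β') a b c
  have h1 : ∀ d, eps4 b a c d = -eps4 a b c d := fun d => (eps4_rotate _ _ _ _).1
  have h2 : ∀ d, eps4 c a b d = eps4 a b c d := fun d => by
    rw [(eps4_rotate c a b d).1, (eps4_rotate a c b d).2.1, neg_neg]
  simp only [h2, hΦ.phi_skew c b, hΦ.phi_skew c a, map_neg] at h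
  rw [S.skew _ _ (hΦ.phi_even a b)]
  simp only [rpsiT, resPsi, qphi, h1, map_sum, map_smul, smul_sub, Finset.sum_sub_distrib,
    neg_smul, Finset.sum_neg_distrib, map_neg]
  rcases fin2_cases α with rfl | rfl <;> rcases fin2_cases β with rfl | rfl <;>
    simp only [eps_zero_zero, eps_zero_one, eps_one_zero, eps_one_one, Fin.sum_univ_two, smul_add,
      Finset.sum_add_distrib, zero_smul, add_zero, zero_add, mul_zero,
      one_smul, neg_smul, smul_neg, Finset.sum_neg_distrib]
  · module
  · linear_combination (norm := module) (2 : ℂ) • h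
  · linear_combination (norm := module) (-2 : ℂ) • h
  · module

end SuperLie

/-! ### Super-fields, abstractly -/

/-- The algebraic structure of super-fields on chiral superspace: derivatives `∂_{αα'}` and
`∂_{aα}`, multiplication by `θ^{aα}` and restriction to `θ = 0`. -/
structure SuperCalc (L : Type*) [AddCommGroup L] [Module ℂ L] extends SuperLie L where
  dx : Fin 2 → Fin 2 → L →ₗ[ℂ] L
  dth : Fin 4 → Fin 2 → L →ₗ[ℂ] L
  th : Fin 4 → Fin 2 → L →ₗ[ℂ] L
  body : L →ₗ[ℂ] L
  dx_br : ∀ α α' x y, dx α α' (br x y) = br (dx α α' x) y + br x (dx α α' y)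
  dx_dx : ∀ α α' β β' x, dx α α' (dx β β' x) = dx β β' (dx α α' x)
  par_dx : ∀ α α' x, par (dx α α' x) = dx α α' (par x)
  dx_th : ∀ α α' a β x, dx α α' (th a β x) = th a β (dx α α' x)
  dx_dth : ∀ α α' a β x, dx α α' (dth a β x) = dth a β (dx α α' x)
  dth_br : ∀ a α x y, dth a α (br x y) = br (dth a α x) y + br (par x) (dth a α y)
  dth_dth : ∀ a α b β x, dth a α (dth b β x) = -dth b β (dth a α x)
  par_dth : ∀ a α x, par (dth a α x) = -dth a α (par x)
  th_br : ∀ a α x y, th a α (br x y) = br (th a α x) y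
  br_th : ∀ a α x y, br x (th a α y) = th a α (br (par x) y)
  th_th : ∀ a α b β x, th a α (th b β x) = -th b β (th a α x)
  par_th : ∀ a α x, par (th a α x) = -th a α (par x)
  dth_th : ∀ a α b β x, dth a α (th b β x) =
    (if a = b ∧ α = β then x else 0) - th b β (dth a α x)
  body_br : ∀ x y, body (br x y) = br (body x) (body y)
  body_dx : ∀ α α' x, body (dx α α' x) = dx α α' (body x)
  body_th : ∀ a α x, body (th a α x) = 0
  dth_body : ∀ a α x, dth a α (body x) = 0
  sub_body_mem : ∀ x, x - body x ∈ ⨆ i : Fin 4 × Fin 2, LinearMap.range (th i.1 i.2)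

/-! ### Filtration by degree in `θ` and inversion of the Euler operator. -/

namespace SuperCalc

variable (S : SuperCalc L)

/-- The super-fields of degree at least `n` in the `θ^{aα}`. -/
def fil : ℕ → Submodule ℂ L
  | 0 => ⊤
  | n + 1 => ⨆ i : Fin 4 × Fin 2, (fil n).map (S.th i.1 i.2)

/-- The Euler operator. -/
def euler : L →ₗ[ℂ] L := ∑ a, ∑ α, S.th a α ∘ₗ S.dth a α

variable {S}

theorem euler_apply (x : L) : S.euler x = ∑ a, ∑ α, S.th a α (S.dth a α x) := by
  simp [euler, LinearMap.sum_apply]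

theorem fil_zero (x : L) : x ∈ S.fil 0 := by simp [fil]

theorem fil_succ_le {n : ℕ} {P : Submodule ℂ L}
    (h : ∀ a α, ∀ x ∈ S.fil n, S.th a α x ∈ P) : S.fil (n + 1) ≤ P := by
  refine iSup_le fun i => ?_
  rintro _ ⟨x, hx, rfl⟩
  exact h _ _ x hx

theorem th_mem_fil {n : ℕ} {x : L} (a α) (hx : x ∈ S.fil n) : S.th a α x ∈ S.fil (n + 1) :=
  (le_iSup (fun i : Fin 4 × Fin 2 => (S.fil n).map (S.th i.1 i.2)) (a, α)) ⟨x, hx, rfl⟩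

theorem fil_succ_le_self (n : ℕ) : S.fil (n + 1) ≤ S.fil n := by
  induction n with
  | zero => exact fun x _ => fil_zero x
  | succ n ih => exact fil_succ_le fun a α x hx => th_mem_fil a α (ih hx)

theorem fil_antitone {m n : ℕ} (h : m ≤ n) : S.fil n ≤ S.fil m :=
  antitone_nat_of_succ_le (f := S.fil) fil_succ_le_self h

theorem par_mem_fil {n : ℕ} {x : L} (hx : x ∈ S.fil n) : S.par x ∈ S.fil n := by
  induction n generalizing x with
  | zero => exact fil_zero _
  | succ n ih =>
    refine fil_succ_le (P := (S.fil (n + 1)).comap S.par) (fun a α y hy => ?_) hx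
    rw [Submodule.mem_comap, S.par_th]
    exact neg_mem (th_mem_fil _ _ (ih hy))

theorem dx_mem_fil {n : ℕ} {x : L} (α α') (hx : x ∈ S.fil n) : S.dx α α' x ∈ S.fil n := by
  induction n generalizing x with
  | zero => exact fil_zero _
  | succ n ih =>
    refine fil_succ_le (P := (S.fil (n + 1)).comap (S.dx α α')) (fun a β y hy => ?_) hx
    rw [Submodule.mem_comap, S.dx_th]
    exact th_mem_fil _ _ (ih hy)

theorem br_mem_fil_right {n : ℕ} {x y : L} (hy : y ∈ S.fil n) : S.br x y ∈ S.fil n := by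
  induction n generalizing x y with
  | zero => exact fil_zero _
  | succ n ih =>
    refine fil_succ_le (P := (S.fil (n + 1)).comap (S.br x)) (fun a β z hz => ?_) hy
    rw [Submodule.mem_comap, S.br_th]
    exact th_mem_fil _ _ (ih hz)

theorem br_mem_fil {m n : ℕ} {x y : L} (hx : x ∈ S.fil m) (hy : y ∈ S.fil n) :
    S.br x y ∈ S.fil (m + n) := by
  induction m generalizing x with
  | zero => simpa using br_mem_fil_right hy
  | succ m ih =>
    refine fil_succ_le (P := (S.fil (m + 1 + n)).comap (S.br.flip y)) (fun a β z hz => ?_) hx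
    rw [Submodule.mem_comap, LinearMap.flip_apply, ← S.th_br]
    have := th_mem_fil a β (ih hz)
    rwa [show m + n + 1 = m + 1 + n by omega] at this

theorem br_mem_fil_left {n : ℕ} {x y : L} (hx : x ∈ S.fil n) : S.br x y ∈ S.fil n := by
  simpa using br_mem_fil hx (fil_zero y)

theorem sum_ite_prod {M : Type*} [AddCommMonoid M] {f : Fin 4 → Fin 2 → M} (a : Fin 4) (α : Fin 2) :
    ∑ b, ∑ β, (if a = b ∧ α = β then f b β else 0) = f a α := by
  simp only [ite_and]
  simp

theorem euler_th (a α) (x : L) : S.euler (S.th a α x) = S.th a α x + S.th a α (S.euler x) := by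
  have h : ∀ b β, S.th b β (S.dth b β (S.th a α x)) =
      (if a = b ∧ α = β then S.th b β x else 0) + S.th a α (S.th b β (S.dth b β x)) := by
    intro b β
    rw [S.dth_th, map_sub, S.th_th b β a α, sub_neg_eq_add]
    congr 1
    by_cases h : a = b ∧ α = β
    · obtain ⟨rfl, rfl⟩ := h; simp
    · rw [if_neg h, if_neg (fun h' => h ⟨h'.1.symm, h'.2.symm⟩), map_zero]
  simp only [euler_apply, h, Finset.sum_add_distrib, map_sum]
  rw [sum_ite_prod]

/-- On the `n`-th graded piece `𝒟` is multiplication by `n`, because each factor `θ^{aα}` shifts it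
by one. -/
theorem euler_sub_mem_fil {n : ℕ} {x : L} (hx : x ∈ S.fil n) :
    S.euler x - (n : ℂ) • x ∈ S.fil (n + 1) := by
  induction n generalizing x with
  | zero =>
    rw [Nat.cast_zero, zero_smul, sub_zero, euler_apply]
    exact Submodule.sum_mem _ fun a _ => Submodule.sum_mem _ fun α _ => th_mem_fil _ _ (fil_zero _)
  | succ n ih =>
    refine fil_succ_le (P := (S.fil (n + 2)).comap (S.euler - ((n + 1 : ℕ) : ℂ) • LinearMap.id))
      (fun a α y hy => ?_) hx
    have h := th_mem_fil a α (ih hy)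
    rw [Submodule.mem_comap]
    convert h using 1
    simp only [LinearMap.sub_apply, LinearMap.smul_apply, LinearMap.id_apply, euler_th, map_sub,
      map_smul]
    push_cast
    module

/-- On the `n`-th graded piece the bracket with `w` vanishes, so `𝒟 + ad w + c` is the nonzero
number `n + c` there. -/
theorem mem_fil_succ_of_euler {w x : L} (hw : w ∈ S.fil 1) {c n : ℕ} (hn : 0 < n + c)
    (hx : x ∈ S.fil n) (h : S.euler x + S.br w x + (c : ℂ) • x ∈ S.fil (n + 1)) :
    x ∈ S.fil (n + 1) := by
  have h1 := euler_sub_mem_fil hx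
  have h2 : S.br w x ∈ S.fil (n + 1) := by
    have := br_mem_fil hw hx
    rwa [add_comm] at this
  have h3 : ((n + c : ℕ) : ℂ) • x ∈ S.fil (n + 1) := by
    have := Submodule.sub_mem _ (Submodule.sub_mem _ h h1) h2
    convert this using 1
    push_cast
    module
  exact (Submodule.smul_mem_iff _ (Nat.cast_ne_zero.2 hn.ne')).1 h3

theorem mem_fil_of_euler {w x : L} (hw : w ∈ S.fil 1) {c k m : ℕ} (hk : 0 < k + c)
    (hx : x ∈ S.fil k) (h : S.euler x + S.br w x + (c : ℂ) • x ∈ S.fil m) : x ∈ S.fil m := by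
  rcases le_total m k with hmk | hmk
  · exact fil_antitone hmk hx
  · induction m, hmk using Nat.le_induction with
    | base => exact hx
    | succ m hkm ih =>
      exact mem_fil_succ_of_euler hw (by omega) (ih (fil_succ_le_self _ h)) h

theorem fil_eq_span (n : ℕ) {x : L} (hx : x ∈ S.fil n) :
    x ∈ Submodule.span ℂ {y | ∃ (l : List (Fin 4 × Fin 2)) (z : L), l.length = n ∧
      y = l.foldr (fun i => S.th i.1 i.2) z} := by
  induction n generalizing x with
  | zero => exact Submodule.subset_span ⟨[], x, rfl, rfl⟩
  | succ n ih =>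
    refine fil_succ_le (fun a α y hy => ?_) hx
    rw [← Submodule.mem_comap]
    refine (Submodule.span_le.2 ?_) (ih hy)
    rintro _ ⟨l, z, rfl, rfl⟩
    exact Submodule.subset_span ⟨(a, α) :: l, z, rfl, rfl⟩

theorem th_self (a α) (x : L) : S.th a α (S.th a α x) = 0 := by
  have h := S.th_th a α a α x
  rw [eq_neg_iff_add_eq_zero, ← two_smul ℂ] at h
  simpa using h

theorem th_foldr_of_mem (l : List (Fin 4 × Fin 2)) (i : Fin 4 × Fin 2) (hi : i ∈ l) (z : L) :
    S.th i.1 i.2 (l.foldr (fun i => S.th i.1 i.2) z) = 0 := by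
  induction l with
  | nil => simp at hi
  | cons j l ih =>
    rcases List.mem_cons.1 hi with rfl | h
    · exact th_self _ _ _
    · rw [List.foldr_cons, S.th_th, ih h, map_zero, neg_zero]

theorem foldr_eq_zero (l : List (Fin 4 × Fin 2)) (hl : ¬l.Nodup) (z : L) :
    l.foldr (fun i => S.th i.1 i.2) z = 0 := by
  induction l with
  | nil => simp at hl
  | cons j l ih =>
    rw [List.nodup_cons, not_and_or, not_not] at hl
    rcases hl with h | h
    · exact th_foldr_of_mem l j h z
    · rw [List.foldr_cons, ih h, map_zero]

/-- Among nine factors chosen from eight anticommuting `θ^{aα}` one occurs twice. -/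
theorem eq_zero_of_mem_fil {x : L} (hx : x ∈ S.fil 9) : x = 0 := by
  rw [← Submodule.mem_bot ℂ]
  refine (Submodule.span_le.2 ?_) (fil_eq_span 9 hx)
  rintro _ ⟨l, z, hl, rfl⟩
  refine foldr_eq_zero l (fun h => ?_) z
  have := h.length_le_card
  simp [hl] at this

/-- Dividing by `n + c` solves the equation up to an error of degree `n + 1`. The induction on `9 -
n` corrects the error until the degree reaches nine. -/
theorem exists_euler_eq {c n : ℕ} (hn : 0 < n + c) {x : L} (hx : x ∈ S.fil n) :
    ∃ y ∈ S.fil n, S.euler y + (c : ℂ) • y = x := by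
  induction k : 9 - n generalizing n x with
  | zero =>
    have : x = 0 := eq_zero_of_mem_fil (fil_antitone (by omega) hx)
    exact ⟨0, zero_mem _, by simp [this]⟩
  | succ k ih =>
    have h0 : ((n + c : ℕ) : ℂ) ≠ 0 := Nat.cast_ne_zero.2 hn.ne'
    set z := ((n + c : ℕ) : ℂ)⁻¹ • x with hz
    have hz' : z ∈ S.fil n := Submodule.smul_mem _ _ hx
    have h1 := euler_sub_mem_fil hz'
    have h2 : x = ((n + c : ℕ) : ℂ) • z := by rw [hz, smul_inv_smul₀ h0]
    obtain ⟨y, hy, hy'⟩ := ih (n := n + 1) (by omega) (neg_mem h1) (by omega)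
    refine ⟨z + y, add_mem hz' (fil_succ_le_self _ hy), ?_⟩
    rw [map_add, h2, smul_add]
    push_cast
    linear_combination (norm := module) hy'

theorem body_eq_zero_iff {x : L} : S.body x = 0 ↔ x ∈ S.fil 1 := by
  constructor
  · intro h
    have := S.sub_body_mem x
    rw [h, sub_zero] at this
    refine (iSup_le fun i => ?_ : _ ≤ S.fil 1) this
    rintro _ ⟨y, rfl⟩
    exact th_mem_fil _ _ (fil_zero y)
  · intro h
    refine fil_succ_le (P := LinearMap.ker S.body) (fun a α y _ => ?_) h
    exact S.body_th _ _ _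

theorem sub_body_mem_fil (x : L) : x - S.body x ∈ S.fil 1 := by
  refine (iSup_le fun i => ?_ : _ ≤ S.fil 1) (S.sub_body_mem x)
  rintro _ ⟨y, rfl⟩
  exact th_mem_fil _ _ (fil_zero y)

theorem euler_body (x : L) : S.euler (S.body x) = 0 := by
  simp [euler_apply, S.dth_body]

theorem par_euler (x : L) : S.par (S.euler x) = S.euler (S.par x) := by
  simp [euler_apply, S.par_th, S.par_dth]

end SuperCalc
end ChiralSuperspace

namespace ChiralSuperspace

variable {L : Type*} [AddCommGroup L] [Module ℂ L]

/-! ### Super-connections, abstractly -/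

/-- The components of a super-connection with values in `L`. -/
structure Conn (L : Type*) where
  bos : Fin 2 → Fin 2 → L
  fer : Fin 4 → Fin 2 → L

namespace SuperLie

variable {S : SuperLie L}

theorem exists_even_add_odd (S : SuperLie L) (x : L) :
    ∃ y z, S.par y = y ∧ S.par z = -z ∧ x = y + z := by
  refine ⟨(1 / 2 : ℂ) • (x + S.par x), (1 / 2 : ℂ) • (x - S.par x), ?_, ?_, ?_⟩
  · rw [map_smul, map_add, S.par_par]; module
  · rw [map_smul, map_sub, S.par_par]; module
  · module

/-- For the odd part of `y` this is the odd Jacobi axiom; for the even part the even axiom is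
applied with `y`, not `x`, as the acting element. -/
theorem br_br_odd {x : L} (hx : S.par x = -x) (y z : L) :
    S.br x (S.br y z) = S.br (S.br x y) z + S.br (S.par y) (S.br x z) := by
  obtain ⟨e, o, he, ho, rfl⟩ := S.exists_even_add_odd y
  have h1 := S.jacobi_even e x z he
  have h2 := S.jacobi_odd x o z hx ho
  rw [S.skew e x he, map_neg, LinearMap.neg_apply] at h1
  simp only [map_add, LinearMap.add_apply, he, ho, map_neg, LinearMap.neg_apply]
  linear_combination (norm := module) h2 - h1

theorem br_odd_right {y : L} (hy : S.par y = -y) (x : L) : S.br x y = -S.br y (S.par x) := by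
  obtain ⟨e, o, he, ho, rfl⟩ := S.exists_even_add_odd x
  simp only [map_add, LinearMap.add_apply, he, ho, map_neg, S.skew e y he, S.symm o y ho hy]
  abel

end SuperLie

namespace SuperCalc

variable (S : SuperCalc L)

/-- Gradings of the components of a connection. -/
structure GradedConn (A : Conn L) : Prop where
  bos_even : ∀ α α', S.par (A.bos α α') = A.bos α α'
  fer_odd : ∀ a α, S.par (A.fer a α) = -A.fer a α

/-- `∇_{αα'}`. -/
def covB (A : Fin 2 → Fin 2 → L) (α α' : Fin 2) : L →ₗ[ℂ] L := S.dx α α' + S.br (A α α')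

/-- `∇_{aα}`. -/
def covF (A : Conn L) (a : Fin 4) (α : Fin 2) : L →ₗ[ℂ] L := S.dth a α + S.br (A.fer a α)

/-- `[∇_{αα'}, ∇_{ββ'}]`. -/
def curvBB (A : Fin 2 → Fin 2 → L) (α α' β β' : Fin 2) : L :=
  S.dx α α' (A β β') - S.dx β β' (A α α') + S.br (A α α') (A β β')

/-- `[∇_{aα}, ∇_{ββ'}]`. -/
def curvFB (A : Conn L) (a : Fin 4) (α β β' : Fin 2) : L :=
  S.dth a α (A.bos β β') - S.dx β β' (A.fer a α) + S.br (A.fer a α) (A.bos β β')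

/-- `{∇_{aα}, ∇_{bβ}}`. -/
def curvFF (A : Conn L) (a : Fin 4) (α : Fin 2) (b : Fin 4) (β : Fin 2) : L :=
  S.dth a α (A.fer b β) + S.dth b β (A.fer a α) + S.br (A.fer a α) (A.fer b β)

/-- The part of the curvature symmetric in dotted indices. -/
def Ft (A : Fin 2 → Fin 2 → L) (α' β' : Fin 2) : L :=
  (1 / 2 : ℂ) • ∑ α, ∑ β, eps α β • S.curvBB A α α' β β'

/-- The part of the curvature symmetric in undotted indices. -/
def Fa (A : Fin 2 → Fin 2 → L) (α β : Fin 2) : L :=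
  (1 / 2 : ℂ) • ∑ α', ∑ β', eps α' β' • S.curvBB A α α' β β'

/-- Multiplication by `θ^a_α`. -/
def thLow (a : Fin 4) (α : Fin 2) : L →ₗ[ℂ] L := ∑ β, eps β α • S.th a β

variable {S} {A : Conn L}

theorem covB_apply (A : Fin 2 → Fin 2 → L) (α α' x) :
    S.covB A α α' x = S.dx α α' x + S.br (A α α') x := rfl

theorem covF_apply (a α x) : S.covF A a α x = S.dth a α x + S.br (A.fer a α) x := rfl

theorem thLow_apply (a α) (x : L) : S.thLow a α x = ∑ β, eps β α • S.th a β x := by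
  simp [thLow]

theorem covB_br (hA : S.GradedConn A) (α α' x y) :
    S.covB A.bos α α' (S.br x y) = S.br (S.covB A.bos α α' x) y + S.br x (S.covB A.bos α α' y) := by
  simp only [covB_apply, S.dx_br, S.jacobi_even _ x y (hA.bos_even _ _), map_add,
    LinearMap.add_apply]
  abel

theorem covF_br (hA : S.GradedConn A) (a α x y) :
    S.covF A a α (S.br x y) = S.br (S.covF A a α x) y + S.br (S.par x) (S.covF A a α y) := by
  simp only [covF_apply, S.dth_br, SuperLie.br_br_odd (hA.fer_odd _ _), map_add,
    LinearMap.add_apply]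
  abel

theorem par_covB (hA : S.GradedConn A) (α α' x) :
    S.par (S.covB A.bos α α' x) = S.covB A.bos α α' (S.par x) := by
  simp only [covB_apply, map_add, S.par_dx, S.par_br, hA.bos_even]

theorem covB_th (hA : S.GradedConn A) (α α' a β x) :
    S.covB A.bos α α' (S.th a β x) = S.th a β (S.covB A.bos α α' x) := by
  simp only [covB_apply, map_add, S.dx_th, S.br_th, hA.bos_even]

theorem covF_th (hA : S.GradedConn A) (a α b β x) :
    S.covF A a α (S.th b β x) = (if a = b ∧ α = β then x else 0) - S.th b β (S.covF A a α x) := by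
  simp only [covF_apply, map_add, S.dth_th, S.br_th, hA.fer_odd, map_neg, LinearMap.neg_apply]
  abel

theorem curvBB_skew (hA : S.GradedConn A) (α α' β β') :
    S.curvBB A.bos α α' β β' = -S.curvBB A.bos β β' α α' := by
  simp only [curvBB, S.skew (A.bos α α') _ (hA.bos_even _ _)]
  abel

theorem covB_comm (hA : S.GradedConn A) (α α' β β' x) :
    S.covB A.bos α α' (S.covB A.bos β β' x) - S.covB A.bos β β' (S.covB A.bos α α' x) =
      S.br (S.curvBB A.bos α α' β β') x := by
  have h := S.jacobi_even (A.bos α α') (A.bos β β') x (hA.bos_even _ _)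
  simp only [covB_apply, curvBB, map_add, map_sub, LinearMap.add_apply, LinearMap.sub_apply,
    S.dx_br, S.dx_dx α α' β β', h]
  abel

theorem covF_covB (hA : S.GradedConn A) (a α β β' x) :
    S.covF A a α (S.covB A.bos β β' x) - S.covB A.bos β β' (S.covF A a α x) =
      S.br (S.curvFB A a α β β') x := by
  have h := SuperLie.br_br_odd (hA.fer_odd a α) (A.bos β β') x
  simp only [covB_apply, covF_apply, curvFB, map_add, map_sub, LinearMap.add_apply,
    LinearMap.sub_apply, S.dx_br, S.dth_br, S.dx_dth β β' a α, h, hA.bos_even]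
  abel

theorem covF_covF (hA : S.GradedConn A) (a α b β x) :
    S.covF A a α (S.covF A b β x) + S.covF A b β (S.covF A a α x) =
      S.br (S.curvFF A a α b β) x := by
  have h := S.jacobi_odd (A.fer a α) (A.fer b β) x (hA.fer_odd _ _) (hA.fer_odd _ _)
  simp only [covF_apply, curvFF, map_add, LinearMap.add_apply, S.dth_br, S.dth_dth b β a α, h,
    hA.fer_odd, map_neg, LinearMap.neg_apply]
  abel

/-- A tensor skew under exchange of index pairs splits into a part skew in undotted and symmetric in
dotted indices, and one of the opposite type. The two-valued skew pairs are multiples of `ε`. -/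
theorem curvBB_eq (hA : S.GradedConn A) (α α' β β') : S.curvBB A.bos α α' β β' =
    eps α β • S.Ft A.bos α' β' + eps α' β' • S.Fa A.bos α β := by
  have h := curvBB_skew hA
  have h0 : ∀ α α', S.curvBB A.bos α α' α α' = 0 := fun α α' => by
    have := h α α' α α'
    rw [eq_neg_iff_add_eq_zero, ← two_smul ℂ] at this
    simpa using this
  have h1 := h 0 1 0 0
  have h2 := h 1 0 0 0
  have h3 := h 1 1 0 0
  have h4 := h 1 0 0 1
  have h5 := h 1 1 0 1
  have h6 := h 1 1 1 0
  simp only [Ft, Fa, Fin.sum_univ_two]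
  rcases fin2_cases α with rfl | rfl <;> rcases fin2_cases α' with rfl | rfl <;>
    rcases fin2_cases β with rfl | rfl <;> rcases fin2_cases β' with rfl | rfl <;>
    simp only [eps_zero_zero, eps_zero_one, eps_one_zero, eps_one_one, h0, h1, h2, h3, h4, h5, h6]
      <;> module

theorem Fa_symm (hA : S.GradedConn A) (α β) : S.Fa A.bos α β = S.Fa A.bos β α := by
  have h := curvBB_skew hA
  simp only [Fa, Fin.sum_univ_two, eps_zero_zero, eps_zero_one, eps_one_zero, eps_one_one,
    h β 0 α 1, h β 1 α 0]
  module

theorem Ft_symm (hA : S.GradedConn A) (α' β') : S.Ft A.bos α' β' = S.Ft A.bos β' α' := by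
  have h := curvBB_skew hA
  simp only [Ft, Fin.sum_univ_two, eps_zero_zero, eps_zero_one, eps_one_zero, eps_one_one,
    h 0 β' 1 α', h 1 β' 0 α']
  module

theorem isCovDeriv (hA : S.GradedConn A) :
    S.IsCovDeriv (S.covB A.bos) (S.Ft A.bos) (S.Fa A.bos) where
  leibniz := covB_br hA
  par := par_covB hA
  comm α α' β β' x := by
    rw [covB_comm hA, curvBB_eq hA]
    simp
  symm := Fa_symm hA
  symmT := Ft_symm hA

/-! ### Bianchi identities: graded Jacobi for three covariant derivatives. -/

theorem bianchi_FBB (hA : S.GradedConn A) (a α β β' γ γ') :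
    S.covF A a α (S.curvBB A.bos β β' γ γ') =
      S.covB A.bos β β' (S.curvFB A a α γ γ') - S.covB A.bos γ γ' (S.curvFB A a α β β') := by
  have h := SuperLie.br_br_odd (hA.fer_odd a α) (A.bos β β') (A.bos γ γ')
  have h2 := S.skew (A.bos γ γ') (S.br (A.fer a α) (A.bos β β')) (hA.bos_even _ _)
  have h3 : ∀ x, S.br (A.bos γ γ') (S.dx β β' x) = -S.br (S.dx β β' x) (A.bos γ γ') :=
    fun x => S.skew _ _ (hA.bos_even _ _)
  have h4 : ∀ x, S.br (A.bos γ γ') (S.dth a α x) = -S.br (S.dth a α x) (A.bos γ γ') :=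
    fun x => S.skew _ _ (hA.bos_even _ _)
  have h6 : S.br (A.bos β β') (S.dx γ γ' (A.fer a α)) =
      -S.br (S.dx γ γ' (A.fer a α)) (A.bos β β') := S.skew _ _ (hA.bos_even _ _)
  simp only [covB_apply, covF_apply, curvFB, curvBB, map_add, map_sub,
    S.dx_br, S.dth_br, S.dx_dth _ _ a α, hA.bos_even, h, h2, h3, h4, h6,
    S.dx_dx γ γ' β β']
  abel

theorem bianchi_FFB (hA : S.GradedConn A) (a α b β γ γ') :
    S.covF A a α (S.curvFB A b β γ γ') + S.covF A b β (S.curvFB A a α γ γ') =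
      -S.covB A.bos γ γ' (S.curvFF A a α b β) := by
  have h := S.jacobi_odd (A.fer a α) (A.fer b β) (A.bos γ γ') (hA.fer_odd _ _) (hA.fer_odd _ _)
  have h1 := S.skew (A.bos γ γ') (S.br (A.fer a α) (A.fer b β)) (hA.bos_even _ _)
  have h2 : ∀ x, S.br (A.bos γ γ') (S.dth a α x) = -S.br (S.dth a α x) (A.bos γ γ') :=
    fun x => S.skew _ _ (hA.bos_even _ _)
  have h3 : ∀ x, S.br (A.bos γ γ') (S.dth b β x) = -S.br (S.dth b β x) (A.bos γ γ') :=
    fun x => S.skew _ _ (hA.bos_even _ _)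
  have h4 : S.br (S.dx γ γ' (A.fer a α)) (A.fer b β) = S.br (A.fer b β) (S.dx γ γ' (A.fer a α)) :=
    S.symm _ _ (by rw [S.par_dx, hA.fer_odd, map_neg]) (hA.fer_odd _ _)
  simp only [covB_apply, covF_apply, curvFB, curvFF, map_add, map_sub,
    S.dx_br, S.dth_br, S.dx_dth _ _ a α, S.dx_dth _ _ b β, hA.fer_odd, h, h1,
    h2, h3, h4, S.dth_dth b β a α, map_neg, LinearMap.neg_apply]
  abel

theorem bianchi_FFF (hA : S.GradedConn A) (a α b β c γ) :
    S.covF A a α (S.curvFF A b β c γ) + S.covF A b β (S.curvFF A c γ a α) +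
      S.covF A c γ (S.curvFF A a α b β) = 0 := by
  have h := S.jacobi_odd (A.fer a α) (A.fer b β) (A.fer c γ) (hA.fer_odd _ _) (hA.fer_odd _ _)
  have h1 : S.br (A.fer c γ) (S.br (A.fer a α) (A.fer b β)) =
      -S.br (S.br (A.fer a α) (A.fer b β)) (A.fer c γ) :=
    S.skew' (by rw [S.par_br, hA.fer_odd, hA.fer_odd, map_neg, map_neg, LinearMap.neg_apply,
      neg_neg])
  have h0 : S.br (A.fer c γ) (A.fer a α) = S.br (A.fer a α) (A.fer c γ) :=
    S.symm _ _ (hA.fer_odd _ _) (hA.fer_odd _ _)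
  have h3 : ∀ b β c γ d δ, S.br (A.fer c γ) (S.dth b β (A.fer d δ)) =
      -S.br (S.dth b β (A.fer d δ)) (A.fer c γ) := fun b β c γ d δ =>
    S.skew' (by rw [S.par_dth, hA.fer_odd, map_neg, neg_neg])
  simp only [covF_apply, curvFF, map_add,
    S.dth_br, hA.fer_odd, h0, h, h1, h3, S.dth_dth b β a α, S.dth_dth c γ a α, S.dth_dth c γ b β,
    map_neg, LinearMap.neg_apply]
  abel

end SuperCalc
end ChiralSuperspace

namespace ChiralSuperspace

variable {L : Type*} [AddCommGroup L] [Module ℂ L]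
namespace SuperCalc
variable (S : SuperCalc L)

/-! ### Covariant derivatives as variations -/

/-- `q a α` is `∇_{aα} x` up to terms of degree `n` in `θ`. -/
def VarMod (A : Conn L) (n : ℕ) (x : L) (q : Fin 4 → Fin 2 → L) : Prop :=
  ∀ a α, S.covF A a α x - q a α ∈ S.fil n

/-- `q a α` and `∇_{aα} x` have the same contraction with `θ^{aα}`. -/
def VarRad (A : Conn L) (x : L) (q : Fin 4 → Fin 2 → L) : Prop :=
  ∑ a, ∑ α, S.th a α (S.covF A a α x - q a α) = 0

/-- The operator `θ^{aα} ∇_{aα}`. -/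
def radial (A : Conn L) : L →ₗ[ℂ] L := ∑ a, ∑ α, S.th a α ∘ₗ S.covF A a α

/-- The relations between super-connection and multiplet, contracted with `θ^{aα}`. -/
structure RadialRel (A : Conn L) (Φ : Fields L) : Prop where
  curvFB : ∀ β β', ∑ a, ∑ α, S.th a α (S.curvFB A a α β β') = ∑ a, S.thLow a β (Φ.psiT a β')
  curvFF : ∀ b β, ∑ a, ∑ α, S.th a α (S.curvFF A a α b β) =
    (2 : ℂ) • ∑ a, S.thLow a β (Φ.phi a b)
  psiT : ∀ b α', S.VarRad A (Φ.psiT b α') fun a α => SuperLie.qpsiT (S.covB A.bos) Φ a α b α'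
  phi : ∀ b c, S.VarRad A (Φ.phi b c) fun a α => SuperLie.qphi Φ a α b c
  psi : ∀ b β, S.VarRad A (Φ.psi b β) fun a α => S.qpsi Φ a α b β
  B : ∀ β γ, S.VarRad A (Φ.B β γ) fun a α => S.qB Φ a α β γ

variable {S} {A : Conn L} {Φ : Fields L} {lam : ℂ}

theorem radial_apply (A : Conn L) (x : L) :
    S.radial A x = ∑ a, ∑ α, S.th a α (S.covF A a α x) := by
  simp [radial]

theorem sum_th_mem_fil {n : ℕ} {f : Fin 4 → Fin 2 → L} (hf : ∀ a α, f a α ∈ S.fil n) :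
    ∑ a, ∑ α, S.th a α (f a α) ∈ S.fil (n + 1) :=
  Submodule.sum_mem _ fun a _ => Submodule.sum_mem _ fun α _ => th_mem_fil _ _ (hf a α)

theorem radial_eq (A : Conn L) (x : L) :
    S.radial A x = S.euler x + S.br (∑ a, ∑ α, S.th a α (A.fer a α)) x := by
  simp only [radial_apply, covF_apply, map_add, S.th_br, Finset.sum_add_distrib, euler_apply,
    map_sum, LinearMap.sum_apply]

/-- In any gauge `θ∇` is `𝒟` plus the bracket with `θ^{aα}A_{aα}`, which has positive degree, so the
estimates for `𝒟` carry over. -/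
theorem mem_fil_of_radial {x : L} {c k m : ℕ} (hk : 0 < k + c)
    (hx : x ∈ S.fil k) (h : S.radial A x + (c : ℂ) • x ∈ S.fil m) : x ∈ S.fil m := by
  rw [radial_eq] at h
  exact mem_fil_of_euler (sum_th_mem_fil fun _ _ => fil_zero _) hk hx h

theorem varRad_iff {x : L} {q : Fin 4 → Fin 2 → L} :
    S.VarRad A x q ↔ S.radial A x = ∑ a, ∑ α, S.th a α (q a α) := by
  rw [VarRad, radial_apply, ← sub_eq_zero (b := ∑ a, ∑ α, S.th a α (q a α))]
  simp only [map_sub, Finset.sum_sub_distrib]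

/-- The Schouten identity contracted with `θ`. -/
theorem thLow_schouten (a : Fin 4) (β γ : Fin 2) (f : Fin 2 → L) :
    ∑ α, S.th a α (eps β γ • f α) = S.thLow a γ (f β) - S.thLow a β (f γ) := by
  simp only [thLow_apply, Fin.sum_univ_two, map_smul]
  rcases fin2_cases β with rfl | rfl <;> rcases fin2_cases γ with rfl | rfl <;>
    simp only [eps_zero_zero, eps_zero_one, eps_one_zero, eps_one_one] <;> module

theorem isVariation_varMod (hA : S.GradedConn A) (n : ℕ) : S.IsVariation (S.VarMod A n) where
  zero a α := by simp
  add h h' a α := by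
    rw [map_add, add_sub_add_comm]; exact add_mem (h a α) (h' a α)
  smul c x p h a α := by
    rw [map_smul, ← smul_sub]; exact Submodule.smul_mem _ _ (h a α)
  br_even {x y p q} hx h h' a α := by
    have : S.covF A a α (S.br x y) - (S.br (p a α) y + S.br x (q a α)) =
        S.br (S.covF A a α x - p a α) y + S.br x (S.covF A a α y - q a α) := by
      rw [covF_br hA, hx, map_sub, map_sub, LinearMap.sub_apply]; abel
    rw [this]
    exact add_mem (br_mem_fil_left (h a α)) (br_mem_fil_right (h' a α))
  br_odd {x y p q} hx h h' a α := by
    have : S.covF A a α (S.br x y) - (S.br (p a α) y - S.br x (q a α)) =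
        S.br (S.covF A a α x - p a α) y - S.br x (S.covF A a α y - q a α) := by
      rw [covF_br hA, hx, map_sub, map_sub, LinearMap.sub_apply, map_neg, LinearMap.neg_apply]
      abel
    rw [this]
    exact sub_mem (br_mem_fil_left (h a α)) (br_mem_fil_right (h' a α))

/-- Contraction with `θ^{aα}` makes the odd derivation even. The sign required for odd `x` is the
one from moving `θ^{aα}` past `x`. -/
theorem isVariation_varRad (hA : S.GradedConn A) : S.IsVariation (S.VarRad A) where
  zero := by simp [VarRad]
  add h h' := by
    rw [varRad_iff] at *
    simp only [map_add, h, h', Finset.sum_add_distrib]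
  smul c x p h := by
    rw [varRad_iff] at *
    simp only [map_smul, h, Finset.smul_sum]
  br_even {x y p q} hx h h' := by
    have : ∀ a α, S.th a α (S.covF A a α (S.br x y) - (S.br (p a α) y + S.br x (q a α))) =
        S.br (S.th a α (S.covF A a α x - p a α)) y +
          S.br x (S.th a α (S.covF A a α y - q a α)) := fun a α => by
      rw [covF_br hA, hx, S.br_th, hx, ← S.th_br, ← map_add, map_sub (S.br x), map_sub S.br,
        LinearMap.sub_apply]
      congr 1; abel
    rw [VarRad] at *
    simp only [this, Finset.sum_add_distrib, ← map_sum, ← LinearMap.sum_apply, h, h']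
    simp
  br_odd {x y p q} hx h h' := by
    have : ∀ a α, S.th a α (S.covF A a α (S.br x y) - (S.br (p a α) y - S.br x (q a α))) =
        S.br (S.th a α (S.covF A a α x - p a α)) y +
          S.br x (S.th a α (S.covF A a α y - q a α)) := fun a α => by
      rw [covF_br hA, hx, S.br_th, hx, ← S.th_br, ← map_add, map_sub (S.br (-x)), map_sub S.br,
        LinearMap.sub_apply, map_neg, LinearMap.neg_apply, LinearMap.neg_apply]
      congr 1; abel
    rw [VarRad] at *
    simp only [this, Finset.sum_add_distrib, ← map_sum, ← LinearMap.sum_apply, h, h']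
    simp

theorem covB_mem_fil {n : ℕ} {x : L} (B : Fin 2 → Fin 2 → L) (α α') (hx : x ∈ S.fil n) :
    S.covB B α α' x ∈ S.fil n :=
  add_mem (dx_mem_fil _ _ hx) (br_mem_fil_right hx)

theorem VarMod.covB (hA : S.GradedConn A) {n : ℕ} {β β' : Fin 2}
    (hX : ∀ a α, S.curvFB A a α β β' - eps α β • Φ.psiT a β' ∈ S.fil n) {x p}
    (h : S.VarMod A n x p) : S.VarMod A n (S.covB A.bos β β' x) fun a α =>
      S.covB A.bos β β' (p a α) + eps α β • S.br (Φ.psiT a β') x := by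
  intro a α
  have h1 := covF_covB hA a α β β' x
  have : S.covF A a α (S.covB A.bos β β' x) -
      (S.covB A.bos β β' (p a α) + eps α β • S.br (Φ.psiT a β') x) =
      S.covB A.bos β β' (S.covF A a α x - p a α) +
        S.br (S.curvFB A a α β β' - eps α β • Φ.psiT a β') x := by
    simp only [map_sub, LinearMap.sub_apply, ← h1, map_smul, LinearMap.smul_apply]
    abel
  rw [this]
  exact add_mem (covB_mem_fil _ _ _ (h a α)) (br_mem_fil_left (hX a α))

/-- Commuting `θ∇` with `∇_{ββ'}` involves the mixed curvature only in contracted form, so the full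
curvature constraint is not presupposed. -/
theorem VarRad.covB (hA : S.GradedConn A) {β β' : Fin 2}
    (hX : ∑ a, ∑ α, S.th a α (S.curvFB A a α β β') = ∑ a, S.thLow a β (Φ.psiT a β')) {x p}
    (h : S.VarRad A x p) : S.VarRad A (S.covB A.bos β β' x) fun a α =>
      S.covB A.bos β β' (p a α) + eps α β • S.br (Φ.psiT a β') x := by
  rw [varRad_iff] at *
  have h1 : ∀ a α, S.th a α (S.covF A a α (S.covB A.bos β β' x)) =
      S.covB A.bos β β' (S.th a α (S.covF A a α x)) +
        S.br (S.th a α (S.curvFB A a α β β')) x := fun a α => by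
    rw [covB_th hA, ← S.th_br, ← covF_covB hA, map_sub]; abel
  rw [radial_apply] at h ⊢
  simp only [h1, Finset.sum_add_distrib, ← map_sum, ← LinearMap.sum_apply, h, hX]
  simp only [map_sum, covB_th hA, thLow_apply, LinearMap.sum_apply, map_smul,
    LinearMap.smul_apply, ← S.th_br, map_add, Finset.sum_add_distrib]

/-- The variation of the anti-self-dual curvature, from the Bianchi identity. -/
theorem VarRad.Fa (hA : S.GradedConn A)
    (hX : ∀ β β', ∑ a, ∑ α, S.th a α (S.curvFB A a α β β') = ∑ a, S.thLow a β (Φ.psiT a β'))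
    (β γ) : S.VarRad A (S.Fa A.bos β γ) fun a α =>
      SuperLie.qF (S.covB A.bos) Φ a α β γ := by
  have h : ∀ β' γ', S.radial A (S.curvBB A.bos β β' γ γ') =
      S.covB A.bos β β' (∑ a, S.thLow a γ (Φ.psiT a γ')) -
        S.covB A.bos γ γ' (∑ a, S.thLow a β (Φ.psiT a β')) := fun β' γ' => by
    rw [radial_apply, ← hX, ← hX]
    simp only [bianchi_FBB hA, map_sub, map_sum, covB_th hA, Finset.sum_sub_distrib]
  rw [varRad_iff]
  simp only [SuperCalc.Fa, SuperLie.qF, map_smul, map_sum, h, thLow_apply, covB_th hA, map_neg,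
    map_add,
    Fin.sum_univ_two, neg_smul, Finset.sum_add_distrib, Finset.sum_neg_distrib, smul_add,
    ← Finset.smul_sum]
  rcases fin2_cases β with rfl | rfl <;> rcases fin2_cases γ with rfl | rfl <;>
    simp only [eps_zero_zero, eps_zero_one, eps_one_zero, eps_one_one, zero_smul, one_smul,
      neg_smul, smul_neg, smul_zero, zero_add, add_zero] <;> module

theorem varMod_Fa (hA : S.GradedConn A) {n : ℕ}
    (hX : ∀ a α β β', S.curvFB A a α β β' - eps α β • Φ.psiT a β' ∈ S.fil n) (β γ) :
    S.VarMod A n (S.Fa A.bos β γ) fun a α => SuperLie.qF (S.covB A.bos) Φ a α β γ := by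
  intro a α
  have : S.covF A a α (S.Fa A.bos β γ) - SuperLie.qF (S.covB A.bos) Φ a α β γ =
      (1 / 2 : ℂ) • ∑ β', ∑ γ', eps β' γ' •
        (S.covB A.bos β β' (S.curvFB A a α γ γ' - eps α γ • Φ.psiT a γ') -
        S.covB A.bos γ γ' (S.curvFB A a α β β' - eps α β • Φ.psiT a β')) := by
    simp only [SuperCalc.Fa, SuperLie.qF, map_smul, map_add, bianchi_FBB hA, map_sub,
      Fin.sum_univ_two,
      eps_zero_zero, eps_zero_one, eps_one_zero, eps_one_one]
    module
  rw [this]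
  exact Submodule.smul_mem _ _ (Submodule.sum_mem _ fun _ _ => Submodule.sum_mem _ fun _ _ =>
    Submodule.smul_mem _ _ (sub_mem (covB_mem_fil _ _ _ (hX _ _ _ _)) (covB_mem_fil _ _ _ (hX _ _ _ _))))

theorem RadialRel.isSusyD (hA : S.GradedConn A) (h : S.RadialRel A Φ) :
    S.IsSusyD (S.VarRad A) (S.covB A.bos) (S.Fa A.bos) Φ where
  phi := h.phi
  psi := h.psi
  B := h.B
  psiT := h.psiT
  F := VarRad.Fa hA h.curvFB
  deriv β β' _ _ := VarRad.covB hA (h.curvFB β β')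

theorem isSusyD_varMod (hA : S.GradedConn A) {n : ℕ} (h : S.IsSusy (S.VarMod A n) Φ)
    (hpsiT : ∀ b α', S.VarMod A n (Φ.psiT b α')
      fun a α => SuperLie.qpsiT (S.covB A.bos) Φ a α b α')
    (hX : ∀ a α β β', S.curvFB A a α β β' - eps α β • Φ.psiT a β' ∈ S.fil n) :
    S.IsSusyD (S.VarMod A n) (S.covB A.bos) (S.Fa A.bos) Φ where
  phi := h.phi
  psi := h.psi
  B := h.B
  psiT := hpsiT
  F := varMod_Fa hA hX
  deriv _ _ _ _ := VarMod.covB hA fun _ _ => hX _ _ _ _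

end SuperCalc
end ChiralSuperspace

namespace ChiralSuperspace

variable {L : Type*} [AddCommGroup L] [Module ℂ L]
namespace SuperCalc
variable (S : SuperCalc L)

/-! ### From radial relations to the super-field relations -/

/-- The super-field relations between connection and multiplet. -/
structure Rel (lam : ℂ) (A : Conn L) (Φ : Fields L) : Prop where
  curvFB : ∀ β β', ∑ a, ∑ α, S.th a α (S.curvFB A a α β β') = ∑ a, S.thLow a β (Φ.psiT a β')
  curvFF : ∀ b β, ∑ a, ∑ α, S.th a α (S.curvFF A a α b β) =
    (2 : ℂ) • ∑ a, S.thLow a β (Φ.phi a b)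
  Ft : ∀ a α α' β', S.covF A a α (S.Ft A.bos α' β') = (1 / 2 : ℂ) •
    (S.covB A.bos α α' (Φ.psiT a β') + S.covB A.bos α β' (Φ.psiT a α'))
  psiT : ∀ a α b α', S.covF A a α (Φ.psiT b α') = SuperLie.qpsiT (S.covB A.bos) Φ a α b α'
  phi : ∀ a α b c, S.covF A a α (Φ.phi b c) = SuperLie.qphi Φ a α b c
  psi : ∀ a α b β, S.covF A a α (Φ.psi b β) = S.qpsi Φ a α b β
  B : ∀ a α β γ, S.covF A a α (Φ.B β γ) = S.qB Φ a α β γ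
  asd : ∀ α β, S.Fa A.bos α β = lam • Φ.B α β

/-- The field equations. -/
structure FE (lam : ℂ) (A : Fin 2 → Fin 2 → L) (Φ : Fields L) : Prop where
  B : ∀ α α', S.resB (S.covB A) Φ α α' = 0
  psiT : ∀ a α, S.resPsiT (S.covB A) Φ lam a α = 0
  phi : ∀ a b, S.resPhi (S.covB A) Φ lam a b = 0
  psi : ∀ a α', S.resPsi (S.covB A) Φ a α' = 0
  asd : ∀ α β, S.Fa A α β - lam • Φ.B α β = 0

/-- The defects of the field equations are of degree `n` in `θ`. -/
structure FEMod (lam : ℂ) (A : Fin 2 → Fin 2 → L) (Φ : Fields L) (n : ℕ) : Prop where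
  B : ∀ α α', S.resB (S.covB A) Φ α α' ∈ S.fil n
  psiT : ∀ a α, S.resPsiT (S.covB A) Φ lam a α ∈ S.fil n
  phi : ∀ a b, S.resPhi (S.covB A) Φ lam a b ∈ S.fil n
  psi : ∀ a α', S.resPsi (S.covB A) Φ a α' ∈ S.fil n
  asd : ∀ α β, S.Fa A α β - lam • Φ.B α β ∈ S.fil n

variable {S} {A : Conn L} {Φ : Fields L} {lam : ℂ}

/-- The contraction of `q` with `θ^{aα}` has degree `n + 1`, and `θ∇` is injective in positive
degree. Vanishing of `x` at `θ = 0` fixes the integration constant. -/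
theorem VarRad.mem_fil {n : ℕ} {x : L} {q : Fin 4 → Fin 2 → L} (h : S.VarRad A x q)
    (hx : x ∈ S.fil 1) (hq : ∀ a α, q a α ∈ S.fil n) : x ∈ S.fil (n + 1) := by
  rw [varRad_iff] at h
  refine mem_fil_of_radial (A := A) (c := 0) (k := 1) (by omega) hx ?_
  rw [h, Nat.cast_zero, zero_smul, add_zero]
  exact sum_th_mem_fil hq

/-- Each defect varies into brackets and derivatives of defects, none of which lowers the degree,
and the contraction with `θ^{aα}` gains one. -/
theorem RadialRel.feMod_succ (hA : S.GradedConn A) (hΦ : S.Graded Φ) (h : S.RadialRel A Φ) {n : ℕ}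
    (h1 : S.FEMod lam A.bos Φ 1) (hn : S.FEMod lam A.bos Φ n) : S.FEMod lam A.bos Φ (n + 1) := by
  have hV := isVariation_varRad hA
  have hS := h.isSusyD hA
  have hD := isCovDeriv hA
  have hbr : ∀ x y, x ∈ S.fil n → S.br x y ∈ S.fil n := fun x y => br_mem_fil_left
  refine ⟨fun α α' => ?_, fun a α => ?_, fun a b => ?_, fun a α' => ?_, fun α β => ?_⟩
  · refine (hS.resB hV hD hΦ α α').mem_fil (h1.B _ _) fun a δ => Submodule.smul_mem _ _ ?_
    exact Submodule.sum_mem _ fun b _ => hbr _ _ (hn.psi _ _)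
  · refine (hS.resPsiT hV hD hΦ a α).mem_fil (h1.psiT _ _) fun b β => ?_
    exact sub_mem (Submodule.smul_mem _ _ (hn.phi _ _))
      (Submodule.smul_mem _ _ (hbr _ _ (hn.asd _ _)))
  · refine (hS.resPhi hV hD hΦ a b).mem_fil (h1.phi _ _) fun c γ => ?_
    refine sub_mem (hbr _ _ (neg_mem (hn.psiT _ _)) |> fun h => by simpa using h)
      (Submodule.smul_mem _ _ (Submodule.sum_mem _ fun d _ => Submodule.smul_mem _ _
      (add_mem (add_mem ?_ ?_) ?_)))
    · exact Submodule.sum_mem _ fun _ _ => Submodule.sum_mem _ fun _ _ =>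
        Submodule.smul_mem _ _ (covB_mem_fil _ _ _ (hn.psi _ _))
    · exact Submodule.sum_mem _ fun _ _ => hbr _ _ (hn.psiT _ _)
    · exact Submodule.sum_mem _ fun _ _ => Submodule.sum_mem _ fun _ _ =>
        Submodule.smul_mem _ _ (hbr _ _ (hn.asd _ _))
  · refine (hS.resPsi hV hD hΦ a α').mem_fil (h1.psi _ _) fun b β => ?_
    split_ifs
    · exact hn.B _ _
    · exact zero_mem _
  · refine (hS.resF hV α β).mem_fil (h1.asd _ _) fun b β => Submodule.smul_mem _ _ ?_
    exact add_mem (Submodule.smul_mem _ _ (hn.psiT _ _)) (Submodule.smul_mem _ _ (hn.psiT _ _))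

theorem RadialRel.fe (hA : S.GradedConn A) (hΦ : S.Graded Φ) (h : S.RadialRel A Φ)
    (h1 : S.FEMod lam A.bos Φ 1) : S.FE lam A.bos Φ := by
  have hn : ∀ n, S.FEMod lam A.bos Φ (n + 1) := fun n => by
    induction n with
    | zero => exact h1
    | succ n ih => exact h.feMod_succ hA hΦ h1 ih
  have h9 := hn 8
  exact ⟨fun _ _ => eq_zero_of_mem_fil (h9.B _ _), fun _ _ => eq_zero_of_mem_fil (h9.psiT _ _),
    fun _ _ => eq_zero_of_mem_fil (h9.phi _ _), fun _ _ => eq_zero_of_mem_fil (h9.psi _ _),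
    fun _ _ => eq_zero_of_mem_fil (h9.asd _ _)⟩

theorem covF_sum_th (hA : S.GradedConn A) (b β) (g : Fin 4 → Fin 2 → L) :
    S.covF A b β (∑ a, ∑ α, S.th a α (g a α)) =
      g b β - ∑ a, ∑ α, S.th a α (S.covF A b β (g a α)) := by
  simp only [map_sum, covF_th hA, Finset.sum_sub_distrib]
  congr 1
  exact sum_ite_prod b β

theorem covF_sum_thLow (hA : S.GradedConn A) (b β γ) (g : Fin 4 → L) :
    S.covF A b β (∑ a, S.thLow a γ (g a)) =
      eps β γ • g b - ∑ a, S.thLow a γ (S.covF A b β (g a)) := by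
  have h := covF_sum_th hA b β fun a α => eps α γ • g a
  simpa only [map_smul, ← thLow_apply] using h

/-- Let `X_{bβ} = ∇_{bβ} f - q_{bβ}`. Applying `θ∇ + 1` and anticommuting `∇_{bβ}` to the left, the
curvature term is known from `hFF` and cancels by closure against the two second variations. What
remains is the contraction of `θ` with the error of `∇_{bβ} q`, of degree `n + 1`. As `θ∇ + 1` is
injective in every degree, no initial condition on `X` is needed. -/
theorem closure_step (hA : S.GradedConn A)
    (hFF : ∀ b β, ∑ a, ∑ α, S.th a α (S.curvFF A a α b β) =
      (2 : ℂ) • ∑ a, S.thLow a β (Φ.phi a b))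
    {n : ℕ} {f : L} {q : Fin 4 → Fin 2 → L} {r : Fin 4 → Fin 2 → Fin 4 → Fin 2 → L}
    (hq : S.VarRad A f q) (hr : ∀ b β, S.VarRad A (q b β) fun a α => r a α b β)
    (hrn : ∀ b β, S.VarMod A n (q b β) fun a α => r a α b β)
    (hc : ∀ a α b β, r a α b β + r b β a α = (2 * eps α β) • S.br (Φ.phi a b) f) :
    S.VarMod A (n + 1) f q := by
  intro b β
  refine mem_fil_of_radial (A := A) (c := 1) (k := 0) (by omega) (fil_zero _) ?_
  have hr' := varRad_iff.1 (hr b β)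
  have hq' := varRad_iff.1 hq
  rw [radial_apply] at hq'
  have h1 : ∀ a α, S.covF A a α (S.covF A b β f) =
      S.br (S.curvFF A a α b β) f - S.covF A b β (S.covF A a α f) := fun a α => by
    rw [← covF_covF hA]; abel
  have h2 := covF_sum_th hA b β fun a α => S.covF A a α f
  rw [hq', covF_sum_th hA] at h2
  have h3 : S.radial A (S.covF A b β f) =
      (∑ a, ∑ α, S.th a α ((2 * eps α β) • S.br (Φ.phi a b) f)) -
        ∑ a, ∑ α, S.th a α (S.covF A b β (S.covF A a α f)) := by
    simp only [radial_apply, h1, map_sub, S.th_br, Finset.sum_sub_distrib, ← map_sum,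
      ← LinearMap.sum_apply, hFF]
    congr 1
    simp only [map_smul, map_sum, thLow_apply, LinearMap.smul_apply, LinearMap.sum_apply,
      Finset.smul_sum, S.th_br, smul_smul]
  have h4 : S.radial A (S.covF A b β f - q b β) + ((1 : ℕ) : ℂ) • (S.covF A b β f - q b β) =
      -∑ a, ∑ α, S.th a α (S.covF A b β (q a α) - r b β a α) := by
    have h5 : ∀ a α, S.th a α (r b β a α) = S.th a α ((2 * eps α β) • S.br (Φ.phi a b) f) -
        S.th a α (r a α b β) := fun a α => by rw [← hc, map_add]; abel
    simp only [map_sub, h5, Finset.sum_sub_distrib, h3, hr', Nat.cast_one]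
    linear_combination (norm := module) -h2
  rw [h4]
  exact neg_mem (sum_th_mem_fil fun a α => hrn a α b β)

/-- The argument of `closure_step` with a Bianchi identity in place of closure: `θ∇ + 1` sends the
difference to a contraction of `θ` with the error in the derivative of `ψ̃`. -/
theorem curvFB_step (hA : S.GradedConn A) (h : S.RadialRel A Φ) (hΦ : S.Graded Φ) {n : ℕ}
    (hn : ∀ b α', S.VarMod A n (Φ.psiT b α')
      fun a α => SuperLie.qpsiT (S.covB A.bos) Φ a α b α') (b β γ γ') :
    S.curvFB A b β γ γ' - eps β γ • Φ.psiT b γ' ∈ S.fil (n + 1) := by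
  refine mem_fil_of_radial (A := A) (c := 1) (k := 0) (by omega) (fil_zero _) ?_
  have h1 : ∀ a α, S.covF A a α (S.curvFB A b β γ γ') = -S.covF A b β (S.curvFB A a α γ γ') -
      S.covB A.bos γ γ' (S.curvFF A a α b β) := fun a α => by
    rw [← neg_eq_iff_eq_neg.2 (bianchi_FFB hA a α b β γ γ')]; abel
  have h2 := covF_sum_th hA b β fun a α => S.curvFB A a α γ γ'
  rw [h.curvFB, covF_sum_thLow hA] at h2
  have h3 : S.radial A (S.curvFB A b β γ γ') =
      -∑ a, ∑ α, S.th a α (S.covF A b β (S.curvFB A a α γ γ')) -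
        (2 : ℂ) • ∑ a, S.thLow a β (S.covB A.bos γ γ' (Φ.phi a b)) := by
    have := congrArg (S.covB A.bos γ γ') (h.curvFF b β)
    simp only [map_smul, map_sum, thLow_apply, covB_th hA] at this
    simp only [radial_apply, h1, map_sub, map_neg, Finset.sum_sub_distrib, this, thLow_apply,
      Finset.sum_neg_distrib]
  have h4 := varRad_iff.1 (h.psiT b γ')
  have h5 : eps β γ • S.radial A (Φ.psiT b γ') =
      -(2 : ℂ) • ∑ a, (S.thLow a γ (S.covB A.bos β γ' (Φ.phi b a)) +
        S.thLow a β (S.covB A.bos γ γ' (Φ.phi a b))) := by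
    have h6 : ∀ a, S.thLow a γ (S.covB A.bos β γ' (Φ.phi b a)) +
        S.thLow a β (S.covB A.bos γ γ' (Φ.phi a b)) =
        -∑ α, S.th a α (eps β γ • S.covB A.bos α γ' (Φ.phi a b)) := fun a => by
      rw [thLow_schouten a β γ fun α => S.covB A.bos α γ' (Φ.phi a b), hΦ.phi_skew b a, map_neg,
        map_neg]
      abel
    rw [h4]
    simp only [h6, SuperLie.qpsiT, map_smul, ← Finset.smul_sum, Finset.sum_neg_distrib]
    module
  have h7 : S.radial A (S.curvFB A b β γ γ' - eps β γ • Φ.psiT b γ') +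
      ((1 : ℕ) : ℂ) • (S.curvFB A b β γ γ' - eps β γ • Φ.psiT b γ') =
      -∑ a, S.thLow a γ (S.covF A b β (Φ.psiT a γ') -
        SuperLie.qpsiT (S.covB A.bos) Φ b β a γ') := by
    rw [map_sub, map_smul, h5, h3]
    simp only [map_sub, SuperLie.qpsiT, Finset.sum_sub_distrib, Finset.sum_add_distrib, map_smul,
      ← Finset.smul_sum, Nat.cast_one]
    linear_combination (norm := module) -h2
  rw [h7]
  refine neg_mem (Submodule.sum_mem _ fun a _ => ?_)
  rw [thLow_apply]
  exact Submodule.sum_mem _ fun α _ => Submodule.smul_mem _ _ (th_mem_fil _ _ (hn _ _ _ _))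

/-- The five statements are raised in degree together, since the second variation of one field uses
the first variations of others. The field equation of `ψ` enters because closure on `ψ̃` holds only
modulo it. -/
theorem RadialRel.varMod (hA : S.GradedConn A) (hΦ : S.Graded Φ) (h : S.RadialRel A Φ)
    (hpsi : ∀ a α', S.resPsi (S.covB A.bos) Φ a α' = 0) (n : ℕ) :
    S.IsSusy (S.VarMod A n) Φ ∧
    (∀ b α', S.VarMod A n (Φ.psiT b α') fun a α => SuperLie.qpsiT (S.covB A.bos) Φ a α b α') ∧
    ∀ a α β β', S.curvFB A a α β β' - eps α β • Φ.psiT a β' ∈ S.fil n := by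
  induction n with
  | zero =>
    exact ⟨⟨fun _ _ _ _ => fil_zero _, fun _ _ _ _ => fil_zero _, fun _ _ _ _ => fil_zero _⟩,
      fun _ _ _ _ => fil_zero _, fun _ _ _ _ => fil_zero _⟩
  | succ n ih =>
    have hV := isVariation_varRad hA
    have hS := h.isSusyD hA
    have hVn := isVariation_varMod hA n
    have hSn := isSusyD_varMod hA ih.1 ih.2.1 ih.2.2
    refine ⟨⟨fun b c => ?_, fun b β => ?_, fun β γ => ?_⟩, fun b α' => ?_,
      curvFB_step hA h hΦ ih.2.1⟩
    · exact closure_step hA h.curvFF (h.phi b c) (fun d δ => hV.qphi h.psi d δ b c)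
        (fun d δ => hVn.qphi ih.1.psi d δ b c) fun a α d δ => SuperLie.closure_phi hΦ a α d δ b c
    · exact closure_step hA h.curvFF (h.psi b β) (fun d δ => hV.qpsi hΦ h.phi h.B d δ b β)
        (fun d δ => hVn.qpsi hΦ ih.1.phi ih.1.B d δ b β)
        fun a α d δ => SuperLie.closure_psi hΦ a α d δ b β
    · exact closure_step hA h.curvFF (h.B β γ) (fun d δ => hV.qB hΦ h.phi h.psi d δ β γ)
        (fun d δ => hVn.qB hΦ ih.1.phi ih.1.psi d δ β γ)
        fun a α d δ => SuperLie.closure_B hΦ a α d δ β γ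
    · refine closure_step hA h.curvFF (h.psiT b α') (fun d δ => hS.qpsiT hV d δ b α')
        (fun d δ => hSn.qpsiT hVn d δ b α') fun a α d δ => ?_
      rw [SuperLie.closure_psiT hΦ]
      simp only [hpsi, smul_zero, Finset.sum_const_zero, add_zero]

theorem covF_Ft (hA : S.GradedConn A)
    (hX : ∀ a α β β', S.curvFB A a α β β' = eps α β • Φ.psiT a β') (a α α' β') :
    S.covF A a α (S.Ft A.bos α' β') = (1 / 2 : ℂ) •
      (S.covB A.bos α α' (Φ.psiT a β') + S.covB A.bos α β' (Φ.psiT a α')) := by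
  simp only [SuperCalc.Ft, map_smul, bianchi_FBB hA, hX, map_add, Fin.sum_univ_two]
  rcases fin2_cases α with rfl | rfl <;>
    simp only [eps_zero_zero, eps_zero_one, eps_one_zero, eps_one_one] <;> module

theorem RadialRel.rel (hA : S.GradedConn A) (hΦ : S.Graded Φ) (h : S.RadialRel A Φ)
    (h1 : S.FEMod lam A.bos Φ 1) : S.Rel lam A Φ := by
  have hfe := h.fe hA hΦ h1
  obtain ⟨hs, hT, hX⟩ := h.varMod hA hΦ hfe.psi 9
  have h0 : ∀ {x y : L}, x - y ∈ S.fil 9 → x = y := fun h => sub_eq_zero.1 (eq_zero_of_mem_fil h)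
  exact ⟨h.curvFB, h.curvFF, covF_Ft hA fun _ _ _ _ => h0 (hX _ _ _ _), fun _ _ _ _ => h0 (hT _ _ _ _),
    fun _ _ _ _ => h0 (hs.phi _ _ _ _), fun _ _ _ _ => h0 (hs.psi _ _ _ _),
    fun _ _ _ _ => h0 (hs.B _ _ _ _), fun _ _ => sub_eq_zero.1 (hfe.asd _ _)⟩

end SuperCalc
end ChiralSuperspace

namespace ChiralSuperspace

variable {L : Type*} [AddCommGroup L] [Module ℂ L]

/-! ### Linear algebra of the Levi-Civita symbol -/

/-- The indices `c` and `d` are the complement of `{a, b}`; fixing them reduces a contraction with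
the symbol to a single term. -/
theorem exists_eps4_ne_zero {a b : Fin 4} (hab : a ≠ b) : ∃ c d, eps4 b c d a ≠ 0 ∧
    eps4 a c d b = -eps4 b c d a ∧ (∀ e, e ≠ a → eps4 b c d e = 0) ∧
    ∀ e, e ≠ b → eps4 a c d e = 0 := by
  have h : ∀ a b : Fin 4, a ≠ b → ∃ c d : Fin 4, c ≠ d ∧ a ≠ c ∧ a ≠ d ∧ b ≠ c ∧ b ≠ d ∧
      ∀ e, e = a ∨ e = b ∨ e = c ∨ e = d := by decide
  obtain ⟨c, d, hcd, hac, had, hbc, hbd, he⟩ := h a b hab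
  refine ⟨c, d, ?_, ?_, fun e hea => ?_, fun e heb => ?_⟩
  · have : ∀ a b c d : Fin 4, c ≠ d → a ≠ c → a ≠ d → b ≠ c → b ≠ d → a ≠ b →
        ((((c.val : ℤ) - b.val) * ((d.val : ℤ) - b.val) * ((a.val : ℤ) - b.val) *
      ((d.val : ℤ) - c.val) * ((a.val : ℤ) - c.val) * ((a.val : ℤ) - d.val)) / 12) ≠ 0 := by
      decide
    rw [eps4_eq]
    exact Int.cast_ne_zero.2 (this a b c d hcd hac had hbc hbd hab)
  · rw [(eps4_rotate a c d b).1, (eps4_rotate c a d b).2.1, (eps4_rotate c d a b).2.2,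
      (eps4_rotate c d b a).2.1, (eps4_rotate c b d a).1]
    ring
  · rcases he e with rfl | rfl | rfl | rfl
    · exact absurd rfl hea
    all_goals simp [eps4_same]
  · rcases he e with rfl | rfl | rfl | rfl
    · simp [eps4_same]
    · exact absurd rfl heb
    all_goals simp [eps4_same]

theorem eq_zero_of_eps4_closure (p : Fin 4 → Fin 2 → Fin 4 → Fin 2 → L)
    (h : ∀ a α b β c d, ∑ e, eps4 b c d e • p a α e β + ∑ e, eps4 a c d e • p b β e α = 0)
    (ht : ∀ α β, ∑ a, (p a α a β + p a β a α) = 0) (a α e β) : p a α e β = 0 := by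
  have hoff : ∀ {a e}, a ≠ e → ∀ α β, p a α e β = 0 := by
    intro a e hae α β
    obtain ⟨c, d, h0, -, h1, -⟩ := exists_eps4_ne_zero hae.symm
    have h2 : eps4 c a d e ≠ 0 := by
      rw [(eps4_rotate c a d e).1]; exact neg_ne_zero.2 h0
    -- The repeated index `a` makes the second symbol vanish.
    have h3 := h a α c β a d
    have h4 : ∀ e', eps4 a a d e' = 0 := fun e' => (eps4_same a d e').1
    simp only [h4, zero_smul, Finset.sum_const_zero, add_zero] at h3
    rw [Finset.sum_eq_single e (fun e' _ he' => by
      rw [(eps4_rotate c a d e').1, h1 e' he', neg_zero, zero_smul]) (by simp)] at h3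
    exact (smul_eq_zero.1 h3).resolve_left h2
  have hdiag : ∀ {a b}, a ≠ b → ∀ α β, p a α a β = p b β b α := by
    intro a b hab α β
    obtain ⟨c, d, h0, h1, h2, h3⟩ := exists_eps4_ne_zero hab
    have h4 := h a α b β c d
    rw [Finset.sum_eq_single a (fun e' _ he' => by rw [h2 e' he', zero_smul]) (by simp),
      Finset.sum_eq_single b (fun e' _ he' => by rw [h3 e' he', zero_smul]) (by simp), h1,
      neg_smul, ← sub_eq_add_neg, ← smul_sub] at h4
    exact sub_eq_zero.1 ((smul_eq_zero.1 h4).resolve_left h0)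
  by_cases hae : a = e
  · subst hae
    -- Each comparison of diagonal entries exchanges `α` and `β`. The cycle `0, 1, 2, 0` has odd
    -- length, so the diagonal is symmetric in the spinor indices, and then the trace condition
    -- kills it.
    have hs : ∀ α β, p 0 α 0 β = p 0 β 0 α := fun α β => by
      rw [hdiag (show (0 : Fin 4) ≠ 1 by decide), hdiag (show (1 : Fin 4) ≠ 2 by decide),
        hdiag (show (2 : Fin 4) ≠ 0 by decide)]
    have h0 : ∀ a α β, p a α a β = p 0 α 0 β := fun a α β => by
      by_cases ha : a = 0
      · rw [ha]
      · rw [hdiag ha, hs]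
    have h1 := ht α β
    simp only [h0, Fin.sum_univ_four, hs β α] at h1
    rw [h0]
    linear_combination (norm := module) (1 / 8 : ℂ) • h1
  · exact hoff hae α β

/-- Cyclicity and skewness in one pair make `f` totally skew, hence dual to a vector in four
dimensions. The `6` is `3!`, and the minus sign comes from moving `d` past three indices. -/
theorem eq_sum_eps4_of_skew (f : Fin 4 → Fin 4 → Fin 4 → L) (h1 : ∀ a b c, f a b c = f b c a)
    (h2 : ∀ a b c, f a b c = -f a c b) (a b c : Fin 4) :
    f a b c = ∑ d, eps4 a b c d • -((1 / 6 : ℂ) • ∑ e, ∑ g, ∑ h, eps4 d e g h • f e g h) := by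
  have z1 : ∀ a b, f a b b = 0 := fun a b => by
    have := h2 a b b
    rw [eq_neg_iff_add_eq_zero, ← two_smul ℂ] at this
    simpa using this
  have z2 : ∀ a b, f b a b = 0 := fun a b => by rw [h1, z1]
  have z3 : ∀ a b, f b b a = 0 := fun a b => by rw [h1, z2]
  have r : ∀ a b c, f b a c = -f a b c := fun a b c => by rw [h1 b a c, h2 a c b]
  have s1 := r 0 1 2
  have s2 := r 0 1 3
  have s3 := r 0 2 3
  have s4 := r 1 2 3
  have t1 := h1 0 1 2
  have t2 := h1 0 1 3
  have t3 := h1 0 2 3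
  have t4 := h1 1 2 3
  have t1' := h1 2 0 1
  have t2' := h1 3 0 1
  have t3' := h1 3 0 2
  have t4' := h1 3 1 2
  have u1 := h1 1 0 2
  have u2 := h1 1 0 3
  have u3 := h1 2 0 3
  have u4 := h1 2 1 3
  have v1 := h1 2 1 0
  have v2 := h1 3 1 0
  have v3 := h1 3 2 0
  have v4 := h1 3 2 1
  have y : ∀ d, -((1 / 6 : ℂ) • ∑ e, ∑ g, ∑ h, eps4 d e g h • f e g h) =
      ![-f 1 2 3, f 0 2 3, -f 0 1 3, f 0 1 2] d := by
    refine forall_fin4 ?_ ?_ ?_ ?_ <;>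
      simp only [Fin.sum_univ_four, eps4_same, eps4_perm, zero_smul, add_zero, zero_add, t1', t2',
        t3', t4', ← t1, ← t2, ← t3, ← t4, ← u1, ← u2, ← u3, ← u4, v1, v2, v3, v4, s1, s2, s3, s4]
    · simp; module
    · simp; module
    · simp; module
    · simp; module
  simp only [y]
  revert a b c
  refine forall_fin4 ?_ ?_ ?_ ?_ <;> refine forall_fin4 ?_ ?_ ?_ ?_ <;>
    refine forall_fin4 ?_ ?_ ?_ ?_ <;>
    simp [Fin.sum_univ_four, eps4_same, eps4_perm, z1, z2, z3, t1', t2',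
        t3', t4', ← t1, ← t2, ← t3, ← t4, ← u1, ← u2, ← u3, ← u4, v1, v2, v3, v4, s1, s2, s3, s4]

end ChiralSuperspace

namespace ChiralSuperspace

variable {L : Type*} [AddCommGroup L] [Module ℂ L]
namespace SuperCalc
variable (S : SuperCalc L)

/-! ### Constraint equations, super-field relations and field equations -/

/-- The multiplet determined by a super-connection. -/
def mult (A : Conn L) : Fields L where
  psiT a α' := (1 / 2 : ℂ) • ∑ α, ∑ β, eps α β • S.curvFB A a α β α'
  phi a b := (1 / 4 : ℂ) • ∑ α, ∑ β, eps α β • S.curvFF A a α b β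
  psi a α := -((1 / 6 : ℂ) • ∑ b, ∑ c, ∑ d, eps4 a b c d • S.covF A b α
    ((1 / 4 : ℂ) • ∑ α, ∑ β, eps α β • S.curvFF A c α d β))
  B α β := (1 / 4 : ℂ) • ∑ a, (1 / 2 : ℂ) •
    (S.covF A a α (-((1 / 6 : ℂ) • ∑ b, ∑ c, ∑ d, eps4 a b c d • S.covF A b β
      ((1 / 4 : ℂ) • ∑ α, ∑ β, eps α β • S.curvFF A c α d β))) +
    S.covF A a β (-((1 / 6 : ℂ) • ∑ b, ∑ c, ∑ d, eps4 a b c d • S.covF A b α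
      ((1 / 4 : ℂ) • ∑ α, ∑ β, eps α β • S.curvFF A c α d β))))

/-- The constraint equations. -/
structure Constr (lam : ℂ) (A : Conn L) : Prop where
  fermi_bose : ∀ a α β β', S.curvFB A a α β β' + S.curvFB A a β α β' = 0
  fermi_fermi : ∀ a α b β, S.curvFF A a α b β + S.curvFF A a β b α = 0
  asd : ∀ α β, S.Fa A.bos α β = lam • (S.mult A).B α β

variable {S} {A : Conn L} {Φ : Fields L} {lam : ℂ}

theorem mult_psi (A : Conn L) (a α) : (S.mult A).psi a α =
    -((1 / 6 : ℂ) • ∑ b, ∑ c, ∑ d, eps4 a b c d • S.covF A b α ((S.mult A).phi c d)) := rfl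

theorem mult_B (A : Conn L) (α β) : (S.mult A).B α β = (1 / 4 : ℂ) • ∑ a, (1 / 2 : ℂ) •
    (S.covF A a α ((S.mult A).psi a β) + S.covF A a β ((S.mult A).psi a α)) := rfl

theorem eq_eps_smul_of_skew {f : Fin 2 → Fin 2 → L} (h : ∀ α β, f α β + f β α = 0) (α β) :
    f α β = eps α β • ((1 / 2 : ℂ) • ∑ α, ∑ β, eps α β • f α β) := by
  have h0 := h 0 0
  have h1 := h 1 1
  have h2 := h 0 1
  simp only [Fin.sum_univ_two]
  rcases fin2_cases α with rfl | rfl <;> rcases fin2_cases β with rfl | rfl <;>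
    simp only [eps_zero_zero, eps_zero_one, eps_one_zero, eps_one_one]
  · linear_combination (norm := module) (1 / 2 : ℂ) • h0
  · linear_combination (norm := module) (1 / 2 : ℂ) • h2
  · linear_combination (norm := module) (1 / 2 : ℂ) • h2
  · linear_combination (norm := module) (1 / 2 : ℂ) • h1

theorem Constr.curvFB (h : S.Constr lam A) (a α β β') :
    S.curvFB A a α β β' = eps α β • (S.mult A).psiT a β' :=
  eq_eps_smul_of_skew (f := fun α β => S.curvFB A a α β β') (fun α β => h.fermi_bose a α β β') α β

theorem Constr.curvFF (h : S.Constr lam A) (a α b β) :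
    S.curvFF A a α b β = (2 * eps α β) • (S.mult A).phi a b := by
  rw [eq_eps_smul_of_skew (f := fun α β => S.curvFF A a α b β)
    (fun α β => h.fermi_fermi a α b β) α β]
  simp only [mult]
  module

theorem covF_psiT_of_curv (hA : S.GradedConn A) (hΦ : S.Graded Φ)
    (hX : ∀ a α β β', S.curvFB A a α β β' = eps α β • Φ.psiT a β')
    (hY : ∀ a α b β, S.curvFF A a α b β = (2 * eps α β) • Φ.phi a b) (a α b α') :
    S.covF A a α (Φ.psiT b α') = SuperLie.qpsiT (S.covB A.bos) Φ a α b α' := by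
  -- Repeating `α` gives `ε_{αα} = 0`, so only the derivative of `ψ̃_b` survives on the left. A
  -- value of `β` different from `α` then isolates the relation.
  have h := fun β => bianchi_FFB hA b β a α α α'
  simp only [hX, hY, map_smul] at h
  have h0 := h 0
  have h1 := h 1
  rw [SuperLie.qpsiT, hΦ.phi_skew a b, map_neg]
  rcases fin2_cases α with rfl | rfl <;>
    simp only [eps_zero_zero, eps_zero_one, eps_one_zero, eps_one_one, mul_zero, zero_smul,
      one_smul, mul_one, neg_smul, mul_neg, zero_add] at h0 h1
  · linear_combination (norm := module) (-1 : ℂ) • h1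
  · linear_combination (norm := module) h0

theorem Constr.covF_phi (hA : S.GradedConn A) (hΦ : S.Graded (S.mult A)) (h : S.Constr lam A)
    (a α b c) : S.covF A a α ((S.mult A).phi b c) = SuperLie.qphi (S.mult A) a α b c := by
  have hcyc : ∀ a b c, S.covF A a α ((S.mult A).phi b c) =
      S.covF A b α ((S.mult A).phi c a) := by
    intro a b c
    -- With two equal spinor indices the third curvature term vanishes. The remaining two give
    -- cyclicity once the third index differs from `α`, so one of the values `0`, `1` suffices.
    have h1 := bianchi_FFF hA a α b α c 0
    have h2 := bianchi_FFF hA a α b α c 1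
    simp only [h.curvFF, map_smul] at h1 h2
    rcases fin2_cases α with rfl | rfl <;>
      simp only [eps_zero_zero, eps_zero_one, eps_one_zero, eps_one_one, mul_zero, zero_smul,
        mul_one, neg_smul, mul_neg, add_zero] at h1 h2
    · linear_combination (norm := module) (1 / 2 : ℂ) • h2
    · linear_combination (norm := module) (-1 / 2 : ℂ) • h1
  exact eq_sum_eps4_of_skew (fun a b c => S.covF A a α ((S.mult A).phi b c)) hcyc
    (fun a b c => by rw [hΦ.phi_skew b c, map_neg]) a b c

/-- Closure on `φ` read backwards. The curvature gives the anticommutator of two derivatives of `φ`,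
and this fixes the derivative of `ψ` except for the trace symmetric in spinor indices, which is the
definition of `B`. -/
theorem Constr.covF_psi (hA : S.GradedConn A) (hΦ : S.Graded (S.mult A)) (h : S.Constr lam A)
    (a α b β) : S.covF A a α ((S.mult A).psi b β) = S.qpsi (S.mult A) a α b β := by
  rw [← sub_eq_zero]
  refine eq_zero_of_eps4_closure (fun a α b β =>
    S.covF A a α ((S.mult A).psi b β) - S.qpsi (S.mult A) a α b β) (fun a α b β c d => ?_)
    (fun α β => ?_) a α b β
  · have h1 := SuperLie.closure_phi hΦ a α b β c d
    have h2 := covF_covF hA a α b β ((S.mult A).phi c d)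
    rw [h.covF_phi hA hΦ, h.covF_phi hA hΦ, h.curvFF, map_smul, LinearMap.smul_apply, ← h1] at h2
    simp only [SuperLie.qphi, SuperLie.rphi, map_sum, map_smul] at h2
    simp only [smul_sub, Finset.sum_sub_distrib]
    linear_combination (norm := module) h2
  · have h1 := mult_B (S := S) A α β
    have h2 := hΦ.B_symm β α
    simp only [SuperLie.qpsi, Finset.sum_add_distrib, Finset.sum_sub_distrib, if_true,
      eps_symm β α, h2] at h1 ⊢
    simp only [← Finset.smul_sum, Finset.sum_neg_distrib, Finset.sum_const, Finset.card_univ,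
      Fintype.card_fin, neg_smul, Finset.sum_add_distrib] at h1 ⊢
    linear_combination (norm := module) (-8 : ℂ) • h1

theorem Constr.covF_B (hA : S.GradedConn A) (hΦ : S.Graded (S.mult A)) (h : S.Constr lam A)
    (a α β γ) : S.covF A a α ((S.mult A).B β γ) = S.qB (S.mult A) a α β γ := by
  -- For `b ≠ a` only one of the two second derivatives of `ψ^b` contains a derivative of `B`, so
  -- closure on `ψ` determines it.
  obtain ⟨b, hb⟩ : ∃ b, b ≠ a := exists_ne a
  have h1 := SuperLie.closure_psi hΦ a α b β b γ
  have h2 := covF_covF hA a α b β ((S.mult A).psi b γ)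
  rw [h.covF_psi hA hΦ, h.covF_psi hA hΦ, h.curvFF, map_smul, LinearMap.smul_apply, ← h1] at h2
  simp only [SuperLie.qpsi, SuperLie.rpsi, map_sum, map_smul, map_add, map_neg, covF_br hA,
    hΦ.phi_even, h.covF_phi hA hΦ, if_true, if_neg hb.symm, map_zero] at h2
  have h3 : ∀ (d e f : Fin 4) (δ : Fin 2), S.covF A d δ (raise (S.mult A).phi e f) =
      raise (SuperLie.qphi (S.mult A) d δ) e f := fun d e f δ => by
    rw [map_raise]
    simp only [h.covF_phi hA hΦ]
  simp only [h3] at h2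
  linear_combination (norm := module) h2

theorem Constr.rel (hA : S.GradedConn A) (hΦ : S.Graded (S.mult A)) (h : S.Constr lam A) :
    S.Rel lam A (S.mult A) where
  curvFB β β' := by simp only [h.curvFB, thLow_apply, map_smul]
  curvFF b β := by simp only [h.curvFF, thLow_apply, map_smul, Finset.smul_sum, smul_smul]
  Ft := covF_Ft hA h.curvFB
  psiT := covF_psiT_of_curv hA hΦ h.curvFB h.curvFF
  phi := h.covF_phi hA hΦ
  psi := h.covF_psi hA hΦ
  B := h.covF_B hA hΦ
  asd := h.asd

/-! ### From the super-field relations to the constraints and the field equations. -/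

theorem Rel.radialRel (h : S.Rel lam A Φ) : S.RadialRel A Φ where
  curvFB := h.curvFB
  curvFF := h.curvFF
  psiT _ _ := by simp [VarRad, h.psiT]
  phi _ _ := by simp [VarRad, h.phi]
  psi _ _ := by simp [VarRad, h.psi]
  B _ _ := by simp [VarRad, h.B]

theorem varMod_of_eq {n : ℕ} {x : L} {q : Fin 4 → Fin 2 → L} (h : ∀ a α, S.covF A a α x = q a α) :
    S.VarMod A n x q := fun a α => by rw [h, sub_self]; exact zero_mem _

theorem Rel.curvFB_eq (hA : S.GradedConn A) (hΦ : S.Graded Φ) (h : S.Rel lam A Φ) (a α β β') :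
    S.curvFB A a α β β' = eps α β • Φ.psiT a β' :=
  sub_eq_zero.1 (eq_zero_of_mem_fil (curvFB_step hA h.radialRel hΦ (n := 8)
    (fun b α' => varMod_of_eq fun a α => h.psiT a α b α') a α β β'))

/-- The Bianchi identity moves two free derivatives to the left of `θ`, and each returns one copy of
the curvature. Thus `θ∇ + 2` annihilates the difference, which must be zero. -/
theorem Rel.curvFF_eq (hA : S.GradedConn A) (hΦ : S.Graded Φ) (h : S.Rel lam A Φ) (b β c γ) :
    S.curvFF A b β c γ = (2 * eps β γ) • Φ.phi b c := by
  refine sub_eq_zero.1 (eq_zero_of_mem_fil (mem_fil_of_radial (S := S) (A := A) (c := 2) (k := 0)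
    (by omega) (fil_zero _) ?_))
  have hs : ∀ a α b β, S.curvFF A a α b β = S.curvFF A b β a α := fun a α b β => by
    rw [SuperCalc.curvFF, SuperCalc.curvFF, S.symm _ _ (hA.fer_odd a α) (hA.fer_odd b β)]; abel
  have h1 : ∀ a α, S.covF A a α (S.curvFF A b β c γ) = -S.covF A b β (S.curvFF A a α c γ) -
      S.covF A c γ (S.curvFF A a α b β) := fun a α => by
    have := bianchi_FFF hA a α b β c γ
    rw [hs c γ a α] at this
    linear_combination (norm := module) this
  have h2 := covF_sum_th hA b β fun a α => S.curvFF A a α c γ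
  have h3 := covF_sum_th hA c γ fun a α => S.curvFF A a α b β
  rw [h.curvFF, map_smul, covF_sum_thLow hA] at h2 h3
  simp only [h.phi] at h2 h3
  have h4 : ∀ a, S.thLow a γ (SuperLie.qphi Φ b β a c) + S.thLow a β (SuperLie.qphi Φ c γ a b) =
      -∑ α, S.th a α (eps β γ • SuperLie.qphi Φ a α b c) := fun a => by
    have e1 : SuperLie.qphi Φ b β a c = -SuperLie.qphi Φ a β b c := by
      simp only [SuperLie.qphi, (eps4_rotate b a c _).1, neg_smul, Finset.sum_neg_distrib]
    have e2 : SuperLie.qphi Φ c γ a b = SuperLie.qphi Φ a γ b c := by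
      simp only [SuperLie.qphi, (eps4_rotate c a b _).1, (eps4_rotate a c b _).2.1, neg_neg]
    rw [thLow_schouten a β γ fun α => SuperLie.qphi Φ a α b c, e1, e2, map_neg]
    abel
  have h5 : eps β γ • S.radial A (Φ.phi b c) = -∑ a, (S.thLow a γ (SuperLie.qphi Φ b β a c) +
      S.thLow a β (SuperLie.qphi Φ c γ a b)) := by
    simp only [h4, radial_apply, h.phi, map_smul, Finset.sum_neg_distrib, neg_neg,
      Finset.smul_sum]
  have h6 : S.radial A (S.curvFF A b β c γ) =
      -∑ a, ∑ α, S.th a α (S.covF A b β (S.curvFF A a α c γ)) -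
        ∑ a, ∑ α, S.th a α (S.covF A c γ (S.curvFF A a α b β)) := by
    simp only [radial_apply, h1, map_sub, map_neg, Finset.sum_sub_distrib, Finset.sum_neg_distrib]
  have h7 : S.radial A (S.curvFF A b β c γ - (2 * eps β γ) • Φ.phi b c) +
      ((2 : ℕ) : ℂ) • (S.curvFF A b β c γ - (2 * eps β γ) • Φ.phi b c) = 0 := by
    rw [hs c γ b β, eps_symm γ β, hΦ.phi_skew c b] at h3
    rw [map_sub, map_smul, h6]
    simp only [Finset.sum_add_distrib] at h5
    push_cast
    linear_combination (norm := module) -h2 - h3 - (2 : ℂ) • h5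
  rw [h7]
  exact zero_mem _

theorem Rel.isSusyD (hA : S.GradedConn A) (hΦ : S.Graded Φ) (h : S.Rel lam A Φ) :
    S.IsSusyD (S.VarMod A 9) (S.covB A.bos) (S.Fa A.bos) Φ :=
  isSusyD_varMod hA ⟨fun b c => varMod_of_eq fun a α => h.phi a α b c,
    fun b β => varMod_of_eq fun a α => h.psi a α b β,
    fun β γ => varMod_of_eq fun a α => h.B a α β γ⟩
    (fun b α' => varMod_of_eq fun a α => h.psiT a α b α')
    fun a α β β' => by rw [h.curvFB_eq hA hΦ, sub_self]; exact zero_mem _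

theorem VarMod.covF_eq {x : L} {q : Fin 4 → Fin 2 → L} (h : S.VarMod A 9 x q) (a α) :
    S.covF A a α x = q a α :=
  sub_eq_zero.1 (eq_zero_of_mem_fil (h a α))

theorem Rel.constr (hA : S.GradedConn A) (hΦ : S.Graded Φ) (h : S.Rel lam A Φ) :
    S.Constr lam A ∧ (∀ a α', Φ.psiT a α' = (S.mult A).psiT a α') ∧
      (∀ a b, Φ.phi a b = (S.mult A).phi a b) ∧ (∀ a α, Φ.psi a α = (S.mult A).psi a α) ∧
      ∀ α β, Φ.B α β = (S.mult A).B α β := by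
  have hT : ∀ a α', Φ.psiT a α' = (S.mult A).psiT a α' := fun a α' => by
    simp only [mult, h.curvFB_eq hA hΦ, Fin.sum_univ_two, eps_zero_zero, eps_zero_one,
      eps_one_zero, eps_one_one]
    module
  have hphi : ∀ a b, Φ.phi a b = (S.mult A).phi a b := fun a b => by
    simp only [mult, h.curvFF_eq hA hΦ, Fin.sum_univ_two, eps_zero_zero, eps_zero_one,
      eps_one_zero, eps_one_one]
    module
  have hpsi : ∀ a α, Φ.psi a α = (S.mult A).psi a α := fun a α => by
    rw [mult_psi]
    simp only [← hphi, h.phi, SuperLie.qphi]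
    revert a
    refine forall_fin4 ?_ ?_ ?_ ?_ <;>
      simp only [Fin.sum_univ_four, eps4_same, eps4_perm] <;> module
  have hB : ∀ α β, Φ.B α β = (S.mult A).B α β := fun α β => by
    rw [mult_B]
    simp only [← hpsi, h.psi, SuperLie.qpsi, if_true, eps_symm β α, hΦ.B_symm β α]
    simp only [Fin.sum_univ_four]
    module
  refine ⟨⟨fun a α β β' => ?_, fun a α b β => ?_, fun α β => ?_⟩, hT, hphi, hpsi, hB⟩
  · rw [h.curvFB_eq hA hΦ, h.curvFB_eq hA hΦ, eps_symm β α]; module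
  · rw [h.curvFF_eq hA hΦ, h.curvFF_eq hA hΦ, eps_symm β α]; module
  · rw [h.asd, hB]

/-- Differentiating `F = λB` gives the equation of `ψ̃`, and differentiating that gives the equation
of `φ`. The equation of `ψ` is the obstruction to closure on `ψ̃`, which the known curvature forces
to vanish; its derivative is the equation of `B`. -/
theorem Rel.fe (hA : S.GradedConn A) (hΦ : S.Graded Φ) (h : S.Rel lam A Φ) :
    S.FE lam A.bos Φ := by
  have hV := isVariation_varMod hA 9
  have hS := h.isSusyD hA hΦ
  have hD := isCovDeriv hA
  have hF : ∀ α β, S.Fa A.bos α β - lam • Φ.B α β = 0 := fun α β => by rw [h.asd, sub_self]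
  have hT : ∀ a γ, S.resPsiT (S.covB A.bos) Φ lam a γ = 0 := fun a γ => by
    have h1 := (hS.resF hV (lam := lam) γ γ).covF_eq a
    simp only [hF, map_zero] at h1
    have h2 := h1 0
    have h3 := h1 1
    rcases fin2_cases γ with rfl | rfl <;>
      simp only [eps_zero_zero, eps_zero_one, eps_one_zero, eps_one_one] at h2 h3
    · linear_combination (norm := module) (-1 : ℂ) • h3
    · linear_combination (norm := module) h2
  have hP : ∀ a b, S.resPhi (S.covB A.bos) Φ lam a b = 0 := fun a b => by
    have h1 := (hS.resPsiT hV hD hΦ (lam := lam) b 1).covF_eq a 0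
    simpa only [hT, hF, map_zero, LinearMap.zero_apply, smul_zero, sub_zero, eps_zero_one,
      one_smul, eq_comm] using h1
  have hpsi : ∀ d α', S.resPsi (S.covB A.bos) Φ d α' = 0 := fun d α' => by
    obtain ⟨a, hd⟩ : ∃ a, a ≠ d := exists_ne d
    -- With `a, b, c` complementary to `d`, the sum in `closure_psiT` retains only the defect with
    -- index `d`.
    obtain ⟨b, c, h0, -, h1, -⟩ := exists_eps4_ne_zero hd.symm
    have h2 := SuperLie.closure_psiT (D := S.covB A.bos) hΦ a 0 b 1 c α'
    have h3 := covF_covF hA a 0 b 1 (Φ.psiT c α')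
    have h4 : ∀ a α b β, S.covF A a α (S.covF A b β (Φ.psiT c α')) =
        S.rpsiT (S.covB A.bos) Φ a α b β c α' := fun a α b β => by
      rw [h.psiT]
      exact (hS.qpsiT hV b β c α').covF_eq a α
    rw [h4, h4, h2, h.curvFF_eq hA hΦ, map_smul, LinearMap.smul_apply,
      Finset.sum_eq_single d (fun e _ he => by rw [h1 e he, zero_smul]) (by simp), smul_add,
      add_eq_left, eps_zero_one, smul_smul] at h3
    exact (smul_eq_zero.1 h3).resolve_left (by simpa using h0)
  refine ⟨fun α α' => ?_, hT, hP, hpsi, hF⟩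
  have h1 := (hS.resPsi hV hD hΦ 0 α').covF_eq 0 α
  rw [hpsi, map_zero] at h1
  simpa [eq_comm] using h1

end SuperCalc
end ChiralSuperspace

namespace ChiralSuperspace

variable {L : Type*} [AddCommGroup L] [Module ℂ L]

/-- Apply a map to all components of a multiplet. -/
def Fields.map (T : L → L) (Φ : Fields L) : Fields L where
  psiT a α' := T (Φ.psiT a α')
  phi a b := T (Φ.phi a b)
  psi a α := T (Φ.psi a α)
  B α β := T (Φ.B α β)

namespace SuperCalc
variable (S : SuperCalc L)

/-! ### Restriction of the field equations to `θ = 0` -/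

variable {S} {A : Conn L} {Φ : Fields L} {lam : ℂ}

theorem body_covB (B : Fin 2 → Fin 2 → L) (α α' x) :
    S.body (S.covB B α α' x) = S.covB (fun α α' => S.body (B α α')) α α' (S.body x) := by
  simp only [covB_apply, map_add, S.body_dx, S.body_br]

theorem body_Fa (B : Fin 2 → Fin 2 → L) (α β) :
    S.body (S.Fa B α β) = S.Fa (fun α α' => S.body (B α α')) α β := by
  simp only [Fa, curvBB, map_smul, map_sum, map_add, map_sub, S.body_dx, S.body_br]

theorem body_resB (B : Fin 2 → Fin 2 → L) (α α') : S.body (S.resB (S.covB B) Φ α α') =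
    S.resB (S.covB fun α α' => S.body (B α α')) (Φ.map S.body) α α' := by
  simp only [SuperLie.resB, raise, map_smul, map_sum, map_add, body_covB, S.body_br, Fields.map]

theorem body_resPsiT (B : Fin 2 → Fin 2 → L) (a α) : S.body (S.resPsiT (S.covB B) Φ lam a α) =
    S.resPsiT (S.covB fun α α' => S.body (B α α')) (Φ.map S.body) lam a α := by
  simp only [SuperLie.resPsiT, map_smul, map_sum, map_sub, body_covB, S.body_br, Fields.map]

theorem body_resPsi (B : Fin 2 → Fin 2 → L) (a α') : S.body (S.resPsi (S.covB B) Φ a α') =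
    S.resPsi (S.covB fun α α' => S.body (B α α')) (Φ.map S.body) a α' := by
  simp only [SuperLie.resPsi, raise, map_smul, map_sum, map_sub, body_covB, S.body_br, Fields.map]

theorem body_resPhi (B : Fin 2 → Fin 2 → L) (a b) : S.body (S.resPhi (S.covB B) Φ lam a b) =
    S.resPhi (S.covB fun α α' => S.body (B α α')) (Φ.map S.body) lam a b := by
  simp only [SuperLie.resPhi, SuperLie.boxD_apply, map_raise S.body, map_smul, map_sum, map_sub,
    map_add, body_covB, S.body_br, Fields.map]

theorem FE.body (h : S.FE lam A.bos Φ) :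
    S.FE lam (fun α α' => S.body (A.bos α α')) (Φ.map S.body) where
  B α α' := by rw [← body_resB, h.B, map_zero]
  psiT a α := by rw [← body_resPsiT, h.psiT, map_zero]
  phi a b := by rw [← body_resPhi, h.phi, map_zero]
  psi a α' := by rw [← body_resPsi, h.psi, map_zero]
  asd α β := by
    have := congrArg S.body (h.asd α β)
    rwa [map_sub, body_Fa, map_smul, map_zero] at this

theorem feMod_one_of_body
    (h : S.FE lam (fun α α' => S.body (A.bos α α')) (Φ.map S.body)) : S.FEMod lam A.bos Φ 1 where
  B α α' := by rw [← body_eq_zero_iff, body_resB, h.B]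
  psiT a α := by rw [← body_eq_zero_iff, body_resPsiT, h.psiT]
  phi a b := by rw [← body_eq_zero_iff, body_resPhi, h.phi]
  psi a α' := by rw [← body_eq_zero_iff, body_resPsi, h.psi]
  asd α β := by
    rw [← body_eq_zero_iff, map_sub, body_Fa, map_smul]
    exact h.asd α β

/-! ### Radial gauge and recursion relations -/

variable (S) in
/-- The right-hand sides of the recursion relations for the multiplet. -/
def rhs (A : Conn L) (Φ : Fields L) : Fields L where
  psiT a α' := -(2 : ℂ) • ∑ b, ∑ α, S.th b α (S.covB A.bos α α' (Φ.phi a b))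
  phi a b := ∑ c, ∑ d, eps4 a b c d • ∑ α, S.th c α (Φ.psi d α)
  psi a α := ∑ β, S.th a β (Φ.B α β) -
    ∑ b, ∑ c, S.thLow b α (S.br (Φ.phi b c) (raise Φ.phi a c))
  B α β := -(2 : ℂ) • (1 / 2 : ℂ) • ∑ a, ∑ b,
    (S.thLow a α (S.br (Φ.psi b β) (Φ.phi a b)) + S.thLow a β (S.br (Φ.psi b α) (Φ.phi a b)))

variable (S) in
/-- The right-hand sides of the recursion relations for the connection. -/
def rhsConn (Φ : Fields L) : Conn L where
  bos α α' := ∑ a, S.thLow a α (Φ.psiT a α')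
  fer a α := (2 : ℂ) • ∑ b, S.thLow b α (Φ.phi b a)

variable (S) in
/-- The recursion relations, without those for the curvature. -/
structure Rec (A : Conn L) (Φ : Fields L) : Prop where
  psiT : ∀ a α', S.euler (Φ.psiT a α') = (S.rhs A Φ).psiT a α'
  phi : ∀ a b, S.euler (Φ.phi a b) = (S.rhs A Φ).phi a b
  psi : ∀ a α, S.euler (Φ.psi a α) = (S.rhs A Φ).psi a α
  B : ∀ α β, S.euler (Φ.B α β) = (S.rhs A Φ).B α β
  bos : ∀ α α', S.euler (A.bos α α') = (S.rhsConn Φ).bos α α'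
  fer : ∀ a α, A.fer a α + S.euler (A.fer a α) = (S.rhsConn Φ).fer a α

theorem sum_th_qpsiT (hΦ : S.Graded Φ) (b α') :
    ∑ a, ∑ α, S.th a α (SuperLie.qpsiT (S.covB A.bos) Φ a α b α') = (S.rhs A Φ).psiT b α' := by
  simp only [SuperLie.qpsiT, rhs, hΦ.phi_skew b, map_neg, Finset.sum_neg_distrib, map_smul,
    ← Finset.smul_sum]
  module

theorem sum_th_qphi (b c) :
    ∑ a, ∑ α, S.th a α (SuperLie.qphi Φ a α b c) = (S.rhs A Φ).phi b c := by
  simp only [SuperLie.qphi, rhs, map_sum, map_smul, Finset.smul_sum]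
  refine Finset.sum_congr rfl fun a _ => ?_
  rw [Finset.sum_comm]
  refine Finset.sum_congr rfl fun d _ => ?_
  rw [(eps4_rotate a b c d).1, (eps4_rotate b a c d).2.1, neg_neg]

theorem sum_th_qpsi (hΦ : S.Graded Φ) (b β) :
    ∑ a, ∑ α, S.th a α (S.qpsi Φ a α b β) = (S.rhs A Φ).psi b β := by
  have h : ∀ a, ∑ α, S.th a α (if a = b then Φ.B α β else 0) =
      if a = b then ∑ α, S.th b α (Φ.B β α) else 0 := fun a => by
    split_ifs with h
    · subst h; simp only [hΦ.B_symm β]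
    · simp
  simp only [SuperLie.qpsi, rhs, map_add, map_neg, map_smul, Finset.sum_add_distrib,
    Finset.sum_neg_distrib, h, Finset.sum_ite_eq', Finset.mem_univ, if_true, ← thLow_apply]
  simp only [map_sum]
  abel

theorem sum_th_qB (β γ) :
    ∑ a, ∑ α, S.th a α (S.qB Φ a α β γ) = (S.rhs A Φ).B β γ := by
  simp only [SuperLie.qB, rhs, map_add, map_smul, Finset.sum_add_distrib,
    ← Finset.smul_sum, ← thLow_apply]
  simp only [map_sum]

theorem radial_eq_euler (hr : ∑ a, ∑ α, S.th a α (A.fer a α) = 0) (x : L) :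
    S.radial A x = S.euler x := by
  rw [radial_eq, hr, map_zero, LinearMap.zero_apply, add_zero]

theorem sum_th_curvFB (hr : ∑ a, ∑ α, S.th a α (A.fer a α) = 0) (β β') :
    ∑ a, ∑ α, S.th a α (S.curvFB A a α β β') = S.euler (A.bos β β') := by
  simp only [curvFB, map_add, map_sub, Finset.sum_add_distrib, Finset.sum_sub_distrib, S.th_br,
    ← S.dx_th, ← map_sum, ← LinearMap.sum_apply, hr]
  simp [euler_apply]

/-- The undifferentiated `A_{bβ}` arises from differentiating the gauge condition:
`θ^{aα}∂_{bβ}A_{aα} = A_{bβ}`. -/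
theorem sum_th_curvFF (hr : ∑ a, ∑ α, S.th a α (A.fer a α) = 0) (b β) :
    ∑ a, ∑ α, S.th a α (S.curvFF A a α b β) = A.fer b β + S.euler (A.fer b β) := by
  have h := congrArg (S.dth b β) hr
  simp only [map_sum, S.dth_th, map_zero, Finset.sum_sub_distrib] at h
  rw [sum_ite_prod] at h
  simp only [curvFF, map_add, Finset.sum_add_distrib, S.th_br,
    ← LinearMap.sum_apply, ← map_sum, hr]
  simp only [map_zero, LinearMap.zero_apply, add_zero]
  rw [← sub_eq_zero.1 h, ← euler_apply]
  abel

theorem sum_swap {M : Type*} [AddCommMonoid M] (f : Fin 4 → Fin 2 → Fin 4 → Fin 2 → M) :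
    ∑ a, ∑ α, ∑ b, ∑ β, f a α b β = ∑ a, ∑ α, ∑ b, ∑ β, f b β a α := by
  have h := Finset.sum_comm (s := Finset.univ) (t := Finset.univ)
    (f := fun i j : Fin 4 × Fin 2 => f i.1 i.2 j.1 j.2)
  simpa only [Fintype.sum_prod_type] using h

/-- The recursion for `A_{aα}` gives `𝒟(θ^{aα}A_{aα})` as a contraction of two `θ` with `φ`.
Exchanging the index pairs yields a sign from each of the `θ`, `ε` and `φ`, so it equals its own
negative; and `𝒟` is injective in positive degree. -/
theorem Rec.radial (hΦ : S.Graded Φ) (h : S.Rec A Φ) :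
    ∑ a, ∑ α, S.th a α (A.fer a α) = 0 := by
  have h1 : S.euler (∑ a, ∑ α, S.th a α (A.fer a α)) = 0 := by
    have h2 : ∀ a α, S.euler (S.th a α (A.fer a α)) = S.th a α ((S.rhsConn Φ).fer a α) :=
      fun a α => by rw [euler_th, ← map_add, h.fer]
    simp only [map_sum, h2, rhsConn, map_smul, thLow_apply, ← Finset.smul_sum]
    rw [smul_eq_zero]
    right
    have h3 : ∑ a, ∑ α, ∑ b, ∑ β, eps β α • S.th a α (S.th b β (Φ.phi b a)) =
        -∑ a, ∑ α, ∑ b, ∑ β, eps β α • S.th a α (S.th b β (Φ.phi b a)) := by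
      have h4 : ∀ a α b β, eps β α • S.th a α (S.th b β (Φ.phi b a)) =
          -(eps α β • S.th b β (S.th a α (Φ.phi a b))) := fun a α b β => by
        rw [hΦ.phi_skew b a, S.th_th, eps_symm β α, map_neg, map_neg, neg_neg, neg_smul]
      rw [sum_swap, ← neg_eq_iff_eq_neg]
      simp only [← Finset.sum_neg_distrib, ← h4]
      exact sum_swap fun a α b β => eps β α • S.th a α (S.th b β (Φ.phi b a))
    rw [eq_neg_iff_add_eq_zero, ← two_smul ℂ] at h3
    exact (smul_eq_zero.1 h3).resolve_left two_ne_zero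
  refine eq_zero_of_mem_fil (mem_fil_of_euler (S := S) (w := 0) (c := 0) (k := 1) (zero_mem _)
    (by omega) (sum_th_mem_fil fun _ _ => fil_zero _) ?_)
  rw [h1]
  simp

theorem Rec.radialRel (hΦ : S.Graded Φ) (hr : ∑ a, ∑ α, S.th a α (A.fer a α) = 0)
    (h : S.Rec A Φ) : S.RadialRel A Φ where
  curvFB β β' := by rw [sum_th_curvFB hr, h.bos]; rfl
  curvFF b β := by rw [sum_th_curvFF hr, h.fer]; rfl
  psiT b α' := by rw [varRad_iff, radial_eq_euler hr, h.psiT, sum_th_qpsiT hΦ]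
  phi b c := by rw [varRad_iff, radial_eq_euler hr, h.phi, sum_th_qphi]
  psi b β := by rw [varRad_iff, radial_eq_euler hr, h.psi, sum_th_qpsi hΦ]
  B β γ := by rw [varRad_iff, radial_eq_euler hr, h.B, sum_th_qB]

theorem RadialRel.toRec (hΦ : S.Graded Φ) (hr : ∑ a, ∑ α, S.th a α (A.fer a α) = 0)
    (h : S.RadialRel A Φ) : S.Rec A Φ where
  bos β β' := by rw [← sum_th_curvFB hr, h.curvFB]; rfl
  fer b β := by rw [← sum_th_curvFF hr, h.curvFF]; rfl
  psiT b α' := by rw [← radial_eq_euler hr, varRad_iff.1 (h.psiT b α'), sum_th_qpsiT hΦ]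
  phi b c := by rw [← radial_eq_euler hr, varRad_iff.1 (h.phi b c), sum_th_qphi]
  psi b β := by rw [← radial_eq_euler hr, varRad_iff.1 (h.psi b β), sum_th_qpsi hΦ]
  B β γ := by rw [← radial_eq_euler hr, varRad_iff.1 (h.B β γ), sum_th_qB]

theorem Rel.euler_Ft (hr : ∑ a, ∑ α, S.th a α (A.fer a α) = 0) (h : S.Rel lam A Φ) (α' β') :
    S.euler (S.Ft A.bos α' β') = ∑ a, ∑ α, S.th a α ((1 / 2 : ℂ) •
      (S.covB A.bos α α' (Φ.psiT a β') + S.covB A.bos α β' (Φ.psiT a α'))) := by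
  rw [← radial_eq_euler hr, radial_apply]
  simp only [h.Ft]

end SuperCalc
end ChiralSuperspace

namespace ChiralSuperspace

variable {L : Type*} [AddCommGroup L] [Module ℂ L]

/-! ### Solving equations degree by degree in `θ` -/

/-- A contraction principle in which agreement to degree nine is equality: consecutive iterates
agree to one more degree each time, so the ninth is fixed. -/
theorem exists_fixed_point {X : Type*} (T : X → X) (Good : X → Prop) (R : ℕ → X → X → Prop)
    (hgood : ∀ p, Good p → Good (T p)) (h0 : ∀ p q, R 0 p q)
    (hstep : ∀ n p q, Good p → Good q → R n p q → R (n + 1) (T p) (T q))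
    (h9 : ∀ p q, R 9 p q → p = q) {x : X} (hx : Good x) : ∃ p, Good p ∧ T p = p := by
  have hg : ∀ n, Good (T^[n] x) := fun n => by
    induction n with
    | zero => exact hx
    | succ n ih => rw [Function.iterate_succ_apply']; exact hgood _ ih
  have hR : ∀ n, R n (T^[n] (T x)) (T^[n] x) := fun n => by
    induction n with
    | zero => exact h0 _ _
    | succ n ih =>
      rw [Function.iterate_succ_apply', Function.iterate_succ_apply']
      exact hstep _ _ _ (by simpa using hg (n + 1)) (hg n) ih
  refine ⟨T^[9] x, hg 9, ?_⟩
  rw [← Function.iterate_succ_apply' T 9 x, Function.iterate_succ_apply]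
  exact h9 _ _ (hR 9)

theorem fixed_point_unique {X : Type*} (T : X → X) (Good : X → Prop) (R : ℕ → X → X → Prop)
    (h0 : ∀ p q, R 0 p q) (hstep : ∀ n p q, Good p → Good q → R n p q → R (n + 1) (T p) (T q))
    (h9 : ∀ p q, R 9 p q → p = q) {p q : X} (hp : Good p) (hq : Good q) (hTp : T p = p)
    (hTq : T q = q) : p = q := by
  have hR : ∀ n, R n p q := fun n => by
    induction n with
    | zero => exact h0 _ _
    | succ n ih => rw [← hTp, ← hTq]; exact hstep _ _ _ hp hq ih
  exact h9 _ _ (hR 9)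

namespace SuperCalc
variable (S : SuperCalc L)

/-- Equality up to terms of degree `n` in `θ`. -/
def Eqv (n : ℕ) (x y : L) : Prop := x - y ∈ S.fil n

open Classical in
/-- The inverse of `𝒟 + c` on super-fields of degree at least `1 - c`. -/
def eulerInv (c : ℕ) (x : L) : L :=
  if h : ∃ y ∈ S.fil (1 - c), S.euler y + (c : ℂ) • y = x then h.choose else 0

variable {S} {A : Conn L} {Φ : Fields L} {lam : ℂ} {n : ℕ}

namespace Eqv

theorem zero (x y : L) : S.Eqv 0 x y := fil_zero _

theorem eq {x y : L} (h : S.Eqv 9 x y) : x = y := sub_eq_zero.1 (eq_zero_of_mem_fil h)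

theorem refl (x : L) : S.Eqv n x x := by rw [Eqv, sub_self]; exact zero_mem _

theorem mono {x y : L} {m} (h : S.Eqv m x y) (hmn : n ≤ m) : S.Eqv n x y := fil_antitone hmn h

theorem add {x y x' y' : L} (h : S.Eqv n x y) (h' : S.Eqv n x' y') :
    S.Eqv n (x + x') (y + y') := by
  rw [Eqv, add_sub_add_comm]; exact add_mem h h'

theorem sub {x y x' y' : L} (h : S.Eqv n x y) (h' : S.Eqv n x' y') :
    S.Eqv n (x - x') (y - y') := by
  rw [Eqv, sub_sub_sub_comm]; exact sub_mem h h'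

theorem smul (c : ℂ) {x y : L} (h : S.Eqv n x y) : S.Eqv n (c • x) (c • y) := by
  rw [Eqv, ← smul_sub]; exact Submodule.smul_mem _ _ h

theorem sum {ι : Type*} [Fintype ι] {x y : ι → L} (h : ∀ i, S.Eqv n (x i) (y i)) :
    S.Eqv n (∑ i, x i) (∑ i, y i) := by
  rw [Eqv, ← Finset.sum_sub_distrib]; exact Submodule.sum_mem _ fun i _ => h i

theorem br {x y x' y' : L} (h : S.Eqv n x y) (h' : S.Eqv n x' y') :
    S.Eqv n (S.br x x') (S.br y y') := by
  have : S.br x x' - S.br y y' = S.br (x - y) x' + S.br y (x' - y') := by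
    simp only [map_sub, LinearMap.sub_apply]; abel
  rw [Eqv, this]
  exact add_mem (br_mem_fil_left h) (br_mem_fil_right h')

theorem covB {B B' : Fin 2 → Fin 2 → L} {x y : L} {α α' : Fin 2}
    (hB : S.Eqv n (B α α') (B' α α')) (h : S.Eqv n x y) :
    S.Eqv n (S.covB B α α' x) (S.covB B' α α' y) := by
  refine add ?_ (br hB h)
  rw [Eqv, ← map_sub]; exact dx_mem_fil _ _ h

theorem th (a α) {x y : L} (h : S.Eqv n x y) : S.Eqv (n + 1) (S.th a α x) (S.th a α y) := by
  rw [Eqv, ← map_sub]; exact th_mem_fil _ _ h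

theorem thLow (a α) {x y : L} (h : S.Eqv n x y) :
    S.Eqv (n + 1) (S.thLow a α x) (S.thLow a α y) := by
  simp only [thLow_apply]
  exact sum fun _ => smul _ (th _ _ h)

theorem raise {φ φ' : Fin 4 → Fin 4 → L} (h : ∀ a b, S.Eqv n (φ a b) (φ' a b)) (a b) :
    S.Eqv n (raise φ a b) (ChiralSuperspace.raise φ' a b) :=
  smul _ (sum fun _ => sum fun _ => smul _ (h _ _))

end Eqv

/-- The subtraction is truncated: for `c = 0` positive degree is required, for `c ≥ 1` nothing. In
its range the default value `0` of `eulerInv` is never taken. -/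
theorem eulerInv_spec {c : ℕ} {x : L} (hx : x ∈ S.fil (1 - c)) :
    S.eulerInv c x ∈ S.fil (1 - c) ∧ S.euler (S.eulerInv c x) + (c : ℂ) • S.eulerInv c x = x := by
  have h : ∃ y ∈ S.fil (1 - c), S.euler y + (c : ℂ) • y = x := exists_euler_eq (by omega) hx
  rw [eulerInv, dif_pos h]
  exact h.choose_spec

theorem mem_fil_of_euler_add {c m : ℕ} {y : L} (hy : y ∈ S.fil (1 - c))
    (h : S.euler y + (c : ℂ) • y ∈ S.fil m) : y ∈ S.fil m :=
  mem_fil_of_euler (w := 0) (zero_mem _) (c := c) (k := 1 - c) (by omega) hy (by simpa using h)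

theorem eulerInv_eqv {c : ℕ} {x y : L} (hx : x ∈ S.fil (1 - c)) (hy : y ∈ S.fil (1 - c))
    (h : S.Eqv n x y) : S.Eqv n (S.eulerInv c x) (S.eulerInv c y) := by
  obtain ⟨h1, h2⟩ := eulerInv_spec hx
  obtain ⟨h3, h4⟩ := eulerInv_spec hy
  refine mem_fil_of_euler_add (c := c) (sub_mem h1 h3) ?_
  have : S.euler (S.eulerInv c x - S.eulerInv c y) +
      (c : ℂ) • (S.eulerInv c x - S.eulerInv c y) = x - y := by
    conv_rhs => rw [← h2, ← h4]
    rw [map_sub, smul_sub]; abel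
  rw [this]
  exact h

theorem eq_eulerInv {c : ℕ} {x y : L} (hx : x ∈ S.fil (1 - c)) (hy : y ∈ S.fil (1 - c))
    (h : S.euler y + (c : ℂ) • y = x) : y = S.eulerInv c x := by
  obtain ⟨h1, h2⟩ := eulerInv_spec hx
  refine Eqv.eq (mem_fil_of_euler_add (c := c) (sub_mem hy h1) ?_)
  have : S.euler (y - S.eulerInv c x) + (c : ℂ) • (y - S.eulerInv c x) = 0 := by
    rw [map_sub, smul_sub, sub_add_sub_comm, h, h2, sub_self]
  rw [this]
  exact zero_mem _

theorem eulerInv_smul {c : ℕ} (k : ℂ) {x : L} (hx : x ∈ S.fil (1 - c)) :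
    S.eulerInv c (k • x) = k • S.eulerInv c x := by
  obtain ⟨h1, h2⟩ := eulerInv_spec hx
  refine (eq_eulerInv (Submodule.smul_mem _ _ hx) (Submodule.smul_mem _ _ h1) ?_).symm
  rw [map_smul, smul_comm, ← smul_add, h2]

theorem eulerInv_neg {c : ℕ} {x : L} (hx : x ∈ S.fil (1 - c)) :
    S.eulerInv c (-x) = -S.eulerInv c x := by
  simpa using eulerInv_smul (-1) hx

theorem par_eulerInv {c : ℕ} {x : L} (hx : x ∈ S.fil (1 - c)) :
    S.par (S.eulerInv c x) = S.eulerInv c (S.par x) := by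
  obtain ⟨h1, h2⟩ := eulerInv_spec hx
  refine eq_eulerInv (par_mem_fil hx) (par_mem_fil h1) ?_
  rw [← par_euler, ← map_smul, ← map_add, h2]

/-! ### Integration of the recursion relations -/

theorem sum_thLow_mem_fil (α) (f : Fin 4 → L) : ∑ a, S.thLow a α (f a) ∈ S.fil 1 :=
  Submodule.sum_mem _ fun a _ => by
    rw [thLow_apply]
    exact Submodule.sum_mem _ fun _ _ => Submodule.smul_mem _ _ (th_mem_fil _ _ (fil_zero _))

theorem sum_thLow_mem_fil' (α) (f : Fin 4 → Fin 4 → L) :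
    ∑ a, ∑ b, S.thLow a α (f a b) ∈ S.fil 1 := by
  simp only [← map_sum]
  exact sum_thLow_mem_fil α _

theorem rhs_psiT_mem (A : Conn L) (Φ : Fields L) (a α') : (S.rhs A Φ).psiT a α' ∈ S.fil 1 :=
  Submodule.smul_mem _ _ (sum_th_mem_fil fun _ _ => fil_zero _)

theorem rhs_phi_mem (A : Conn L) (Φ : Fields L) (a b) : (S.rhs A Φ).phi a b ∈ S.fil 1 := by
  simp only [rhs]
  exact Submodule.sum_mem _ fun _ _ => Submodule.sum_mem _ fun _ _ => Submodule.smul_mem _ _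
    (Submodule.sum_mem _ fun _ _ => th_mem_fil _ _ (fil_zero _))

theorem rhs_psi_mem (A : Conn L) (Φ : Fields L) (a α) : (S.rhs A Φ).psi a α ∈ S.fil 1 :=
  sub_mem (Submodule.sum_mem _ fun _ _ => th_mem_fil _ _ (fil_zero _)) (sum_thLow_mem_fil' _ _)

theorem rhs_B_mem (A : Conn L) (Φ : Fields L) (α β) : (S.rhs A Φ).B α β ∈ S.fil 1 := by
  refine Submodule.smul_mem _ _ (Submodule.smul_mem _ _ ?_)
  simp only [Finset.sum_add_distrib]
  exact add_mem (sum_thLow_mem_fil' _ _) (sum_thLow_mem_fil' _ _)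

theorem rhsConn_bos_mem (Φ : Fields L) (α α') : (S.rhsConn Φ).bos α α' ∈ S.fil 1 := by
  simp only [rhsConn]
  exact sum_thLow_mem_fil _ _

variable (S) in
/-- One step of the integration of the recursion relations with initial values `A₀`, `Φ₀`. -/
def step (A₀ : Fin 2 → Fin 2 → L) (Φ₀ : Fields L) (p : Conn L × Fields L) : Conn L × Fields L where
  fst :=
    { bos := fun α α' => A₀ α α' + S.eulerInv 0 ((S.rhsConn p.2).bos α α')
      fer := fun a α => S.eulerInv 1 ((S.rhsConn p.2).fer a α) }
  snd :=
    { psiT := fun a α' => Φ₀.psiT a α' + S.eulerInv 0 ((S.rhs p.1 p.2).psiT a α')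
      phi := fun a b => Φ₀.phi a b + S.eulerInv 0 ((S.rhs p.1 p.2).phi a b)
      psi := fun a α => Φ₀.psi a α + S.eulerInv 0 ((S.rhs p.1 p.2).psi a α)
      B := fun α β => Φ₀.B α β + S.eulerInv 0 ((S.rhs p.1 p.2).B α β) }

variable (S) in
/-- Equality of all components up to terms of degree `n` in `θ`. -/
structure PairEqv (n : ℕ) (p q : Conn L × Fields L) : Prop where
  bos : ∀ α α', S.Eqv n (p.1.bos α α') (q.1.bos α α')
  fer : ∀ a α, S.Eqv n (p.1.fer a α) (q.1.fer a α)
  psiT : ∀ a α', S.Eqv n (p.2.psiT a α') (q.2.psiT a α')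
  phi : ∀ a b, S.Eqv n (p.2.phi a b) (q.2.phi a b)
  psi : ∀ a α, S.Eqv n (p.2.psi a α) (q.2.psi a α)
  B : ∀ α β, S.Eqv n (p.2.B α β) (q.2.B α β)

theorem PairEqv.eq {p q : Conn L × Fields L} (h : S.PairEqv 9 p q) : p = q := by
  obtain ⟨⟨b, f⟩, ⟨t, φ, ψ, B⟩⟩ := p
  obtain ⟨⟨b', f'⟩, ⟨t', φ', ψ', B'⟩⟩ := q
  obtain rfl : b = b' := funext fun _ => funext fun _ => (h.bos _ _).eq
  obtain rfl : f = f' := funext fun _ => funext fun _ => (h.fer _ _).eq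
  obtain rfl : t = t' := funext fun _ => funext fun _ => (h.psiT _ _).eq
  obtain rfl : φ = φ' := funext fun _ => funext fun _ => (h.phi _ _).eq
  obtain rfl : ψ = ψ' := funext fun _ => funext fun _ => (h.psi _ _).eq
  obtain rfl : B = B' := funext fun _ => funext fun _ => (h.B _ _).eq
  rfl

theorem PairEqv.zero (p q : Conn L × Fields L) : S.PairEqv 0 p q :=
  ⟨fun _ _ => .zero _ _, fun _ _ => .zero _ _, fun _ _ => .zero _ _, fun _ _ => .zero _ _,
    fun _ _ => .zero _ _, fun _ _ => .zero _ _⟩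

/-- Each right-hand side carries an explicit factor `θ`, and inverting `𝒟 + c` does not lower the
degree. -/
theorem PairEqv.step {A₀ : Fin 2 → Fin 2 → L} {Φ₀ : Fields L} {p q : Conn L × Fields L}
    (h : S.PairEqv n p q) : S.PairEqv (n + 1) (S.step A₀ Φ₀ p) (S.step A₀ Φ₀ q) where
  bos α α' := .add (.refl _) (eulerInv_eqv (rhsConn_bos_mem _ _ _) (rhsConn_bos_mem _ _ _)
    (by simp only [rhsConn]; exact .sum fun _ => .thLow _ _ (h.psiT _ _)))
  fer a α := eulerInv_eqv (fil_zero _) (fil_zero _)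
    (.smul _ (.sum fun _ => .thLow _ _ (h.phi _ _)))
  psiT a α' := .add (.refl _) (eulerInv_eqv (rhs_psiT_mem _ _ _ _) (rhs_psiT_mem _ _ _ _)
    (.smul _ (.sum fun _ => .sum fun _ => .th _ _ (.covB (h.bos _ _) (h.phi _ _)))))
  phi a b := .add (.refl _) (eulerInv_eqv (rhs_phi_mem _ _ _ _) (rhs_phi_mem _ _ _ _)
    (by
      simp only [rhs]
      exact .sum fun _ => .sum fun _ => .smul _ (.sum fun _ => .th _ _ (h.psi _ _))))
  psi a α := .add (.refl _) (eulerInv_eqv (rhs_psi_mem _ _ _ _) (rhs_psi_mem _ _ _ _)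
    (.sub (.sum fun _ => .th _ _ (h.B _ _)) (.sum fun _ => .sum fun _ =>
      .thLow _ _ (.br (h.phi _ _) (.raise h.phi _ _)))))
  B α β := .add (.refl _) (eulerInv_eqv (rhs_B_mem _ _ _ _) (rhs_B_mem _ _ _ _)
    (.smul _ (.smul _ (.sum fun _ => .sum fun _ => .add
      (.thLow _ _ (.br (h.psi _ _) (h.phi _ _))) (.thLow _ _ (.br (h.psi _ _) (h.phi _ _)))))))

theorem par_thLow (a α) (x : L) : S.par (S.thLow a α x) = -S.thLow a α (S.par x) := by
  simp only [thLow_apply, map_sum, map_smul, S.par_th, smul_neg, Finset.sum_neg_distrib]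

theorem rhs_graded (hA : S.GradedConn A) (hΦ : S.Graded Φ) : S.Graded (S.rhs A Φ) where
  psiT_odd a α' := by
    simp only [rhs, map_smul, map_sum, S.par_th, par_covB hA, hΦ.phi_even, Finset.sum_neg_distrib,
      smul_neg]
  phi_even a b := by
    simp only [rhs, map_smul, map_sum, S.par_th, hΦ.psi_odd, map_neg, neg_neg]
  psi_odd a α := by
    simp only [rhs, raise, map_sub, map_smul, map_sum, S.par_th, par_thLow, hΦ.B_even, S.par_br,
      hΦ.phi_even, smul_neg, Finset.sum_neg_distrib]
    abel
  B_even α β := by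
    simp only [rhs, map_add, map_smul, map_sum, par_thLow, S.par_br, hΦ.psi_odd, hΦ.phi_even,
      map_neg, LinearMap.neg_apply, neg_neg]
  phi_skew a b := by
    simp only [rhs, fun c d => (eps4_rotate a b c d).1, neg_smul, Finset.sum_neg_distrib]
  B_symm α β := by
    simp only [rhs, add_comm]

theorem step_graded {A₀ : Fin 2 → Fin 2 → L} {Φ₀ : Fields L} (hA₀ : ∀ α α', S.par (A₀ α α') = A₀ α α')
    (hΦ₀ : S.Graded Φ₀) {p : Conn L × Fields L} (hA : S.GradedConn p.1) (hΦ : S.Graded p.2) :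
    S.GradedConn (S.step A₀ Φ₀ p).1 ∧ S.Graded (S.step A₀ Φ₀ p).2 := by
  have hr := rhs_graded hA hΦ
  refine ⟨⟨fun α α' => ?_, fun a α => ?_⟩, ⟨fun a α' => ?_, fun a b => ?_, fun a α => ?_,
    fun α β => ?_, fun a b => ?_, fun α β => ?_⟩⟩
  · have h : S.par ((S.rhsConn p.2).bos α α') = (S.rhsConn p.2).bos α α' := by
      simp only [rhsConn, map_sum, par_thLow, hΦ.psiT_odd, map_neg, neg_neg]
    simp only [step, map_add, hA₀]
    rw [par_eulerInv (rhsConn_bos_mem _ _ _), h]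
  · have h : S.par ((S.rhsConn p.2).fer a α) = -(S.rhsConn p.2).fer a α := by
      simp only [rhsConn, map_sum, map_smul, par_thLow, hΦ.phi_even, Finset.sum_neg_distrib,
        smul_neg]
    simp only [step]
    rw [par_eulerInv (fil_zero _), h, eulerInv_neg (fil_zero _)]
  · simp only [step, map_add, hΦ₀.psiT_odd]
    rw [par_eulerInv (rhs_psiT_mem _ _ _ _), hr.psiT_odd, eulerInv_neg (rhs_psiT_mem _ _ _ _),
      neg_add]
  · simp only [step, map_add, hΦ₀.phi_even]
    rw [par_eulerInv (rhs_phi_mem _ _ _ _), hr.phi_even]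
  · simp only [step, map_add, hΦ₀.psi_odd]
    rw [par_eulerInv (rhs_psi_mem _ _ _ _), hr.psi_odd, eulerInv_neg (rhs_psi_mem _ _ _ _),
      neg_add]
  · simp only [step, map_add, hΦ₀.B_even]
    rw [par_eulerInv (rhs_B_mem _ _ _ _), hr.B_even]
  · simp only [step]
    rw [hΦ₀.phi_skew a b, hr.phi_skew a b, eulerInv_neg (rhs_phi_mem _ _ _ _), neg_add]
  · simp only [step]
    rw [hΦ₀.B_symm α β, hr.B_symm α β]

theorem euler_add_eulerInv {x y : L} (hx : S.body x = x) (hy : y ∈ S.fil 1) :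
    S.euler (x + S.eulerInv 0 y) = y ∧ S.body (x + S.eulerInv 0 y) = x := by
  obtain ⟨h1, h2⟩ := eulerInv_spec (c := 0) hy
  rw [Nat.cast_zero, zero_smul, add_zero] at h2
  refine ⟨?_, ?_⟩
  · rw [map_add, h2, ← hx, euler_body, zero_add]
  · rw [map_add, hx, body_eq_zero_iff.2 h1, add_zero]

theorem eq_add_eulerInv {x y z : L} (h : S.euler z = y) (hz : S.body z = x) (hy : y ∈ S.fil 1) :
    x + S.eulerInv 0 y = z := by
  rw [← eq_eulerInv (c := 0) (y := z - S.body z) hy (sub_body_mem_fil z)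
    (by rw [map_sub, euler_body, h]; simp), hz]
  abel

/-- The pairs of fields in radial gauge that satisfy the recursion relations and have given
components at `θ = 0` are the fixed points of the integration step. -/
theorem step_eq_iff {A₀ : Fin 2 → Fin 2 → L} {Φ₀ : Fields L} (hA₀ : ∀ α α', S.body (A₀ α α') = A₀ α α')
    (hΦ₀ : Φ₀.map S.body = Φ₀) (p : Conn L × Fields L) :
    S.step A₀ Φ₀ p = p ↔ S.Rec p.1 p.2 ∧ (∀ α α', S.body (p.1.bos α α') = A₀ α α') ∧
      p.2.map S.body = Φ₀ := by
  obtain ⟨⟨b, f⟩, ⟨t, φ, ψ, B⟩⟩ := p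
  obtain ⟨t₀, φ₀, ψ₀, B₀⟩ := Φ₀
  simp only [Fields.map, Fields.mk.injEq, funext_iff] at hΦ₀ ⊢
  constructor
  · intro h
    simp only [step, Prod.mk.injEq, Conn.mk.injEq, Fields.mk.injEq, funext_iff] at h
    obtain ⟨⟨h1, h2⟩, h3, h4, h5, h6⟩ := h
    have e1 := fun α α' => euler_add_eulerInv (hA₀ α α') (rhsConn_bos_mem ⟨t, φ, ψ, B⟩ α α')
    have e3 := fun a α => euler_add_eulerInv (hΦ₀.1 a α) (rhs_psiT_mem ⟨b, f⟩ ⟨t, φ, ψ, B⟩ a α)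
    have e4 := fun a α => euler_add_eulerInv (hΦ₀.2.1 a α) (rhs_phi_mem ⟨b, f⟩ ⟨t, φ, ψ, B⟩ a α)
    have e5 := fun a α => euler_add_eulerInv (hΦ₀.2.2.1 a α) (rhs_psi_mem ⟨b, f⟩ ⟨t, φ, ψ, B⟩ a α)
    have e6 := fun a α => euler_add_eulerInv (hΦ₀.2.2.2 a α) (rhs_B_mem ⟨b, f⟩ ⟨t, φ, ψ, B⟩ a α)
    simp only [h1, h3, h4, h5, h6] at e1 e3 e4 e5 e6
    refine ⟨⟨fun _ _ => (e3 _ _).1, fun _ _ => (e4 _ _).1, fun _ _ => (e5 _ _).1,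
      fun _ _ => (e6 _ _).1, fun _ _ => (e1 _ _).1, fun a α => ?_⟩, fun _ _ => (e1 _ _).2,
      fun _ _ => (e3 _ _).2, fun _ _ => (e4 _ _).2, fun _ _ => (e5 _ _).2, fun _ _ => (e6 _ _).2⟩
    have := (eulerInv_spec (S := S) (c := 1) (fil_zero ((S.rhsConn ⟨t, φ, ψ, B⟩).fer a α))).2
    rw [h2] at this
    rw [← this]
    simp [add_comm]
  · rintro ⟨h, h1, h3, h4, h5, h6⟩
    simp only [step, Prod.mk.injEq, Conn.mk.injEq, Fields.mk.injEq, funext_iff]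
    refine ⟨⟨fun _ _ => eq_add_eulerInv (h.bos _ _) (h1 _ _) (rhsConn_bos_mem _ _ _),
      fun _ _ => ?_⟩, fun _ _ => eq_add_eulerInv (h.psiT _ _) (h3 _ _) (rhs_psiT_mem _ _ _ _),
      fun _ _ => eq_add_eulerInv (h.phi _ _) (h4 _ _) (rhs_phi_mem _ _ _ _),
      fun _ _ => eq_add_eulerInv (h.psi _ _) (h5 _ _) (rhs_psi_mem _ _ _ _),
      fun _ _ => eq_add_eulerInv (h.B _ _) (h6 _ _) (rhs_B_mem _ _ _ _)⟩
    refine (eq_eulerInv (fil_zero _) (fil_zero _) ?_).symm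
    rw [← h.fer, Nat.cast_one, one_smul, add_comm]

/-- No field equation enters here: these recursion relations can be integrated from arbitrary
component fields. -/
theorem existsUnique_rec {A₀ : Fin 2 → Fin 2 → L} {Φ₀ : Fields L}
    (hA₀ : ∀ α α', S.body (A₀ α α') = A₀ α α') (hΦ₀ : Φ₀.map S.body = Φ₀)
    (hA₀' : ∀ α α', S.par (A₀ α α') = A₀ α α') (hΦ₀' : S.Graded Φ₀) :
    ∃! p : Conn L × Fields L, S.GradedConn p.1 ∧ S.Graded p.2 ∧ S.Rec p.1 p.2 ∧
      (∀ α α', S.body (p.1.bos α α') = A₀ α α') ∧ p.2.map S.body = Φ₀ := by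
  simp only [← step_eq_iff hA₀ hΦ₀]
  obtain ⟨p, hp, hTp⟩ := exists_fixed_point (S.step A₀ Φ₀)
    (fun p => S.GradedConn p.1 ∧ S.Graded p.2) S.PairEqv
    (fun p hp => step_graded hA₀' hΦ₀' hp.1 hp.2) PairEqv.zero (fun _ _ _ _ _ h => h.step)
    (fun _ _ h => h.eq) (x := (⟨A₀, fun _ _ => 0⟩, Φ₀)) ⟨⟨hA₀', by simp⟩, hΦ₀'⟩
  refine ⟨p, ⟨hp.1, hp.2, hTp⟩, fun q hq => ?_⟩
  exact fixed_point_unique (S.step A₀ Φ₀) (fun p => S.GradedConn p.1 ∧ S.Graded p.2) S.PairEqv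
    PairEqv.zero (fun _ _ _ _ _ h => h.step) (fun _ _ h => h.eq) ⟨hq.1, hq.2.1⟩ hp hq.2.2 hTp

end SuperCalc
end ChiralSuperspace

namespace ChiralSuperspace

/-! ### Exponentials of nilpotent operators and bilinear maps -/

section Exp

variable {M M' M'' : Type*} [AddCommGroup M] [Module ℂ M] [AddCommGroup M'] [Module ℂ M']
  [AddCommGroup M''] [Module ℂ M'']

/-- The exponential series, truncated after `K` terms. -/
def expSum (K : ℕ) (f : M →ₗ[ℂ] M) : M →ₗ[ℂ] M :=
  ∑ k ∈ Finset.range K, (1 / (k.factorial : ℂ)) • f ^ k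

theorem expSum_apply (K : ℕ) (f : M →ₗ[ℂ] M) (x : M) :
    expSum K f x = ∑ k ∈ Finset.range K, (1 / (k.factorial : ℂ)) • (f ^ k) x := by
  simp [expSum, LinearMap.sum_apply]

theorem exp_eq_expSum [Module ℚ M] {K : ℕ} {f : M →ₗ[ℂ] M} (hf : f ^ K = 0) :
    IsNilpotent.exp f = expSum K f := by
  rw [IsNilpotent.exp_eq_sum hf, expSum]
  refine Finset.sum_congr rfl fun k _ => ?_
  ext x
  have := Rat.cast_smul_eq_qsmul ℂ ((k.factorial : ℚ)⁻¹) ((f ^ k) x)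
  simpa using this.symm

-- On the tensor product the Leibniz rule says that `m` intertwines `h` with `f ⊗ 1 + 1 ⊗ g`. The
-- two summands commute, so the exponential of the sum factors.
open TensorProduct IsNilpotent Module.End in
theorem expSum_bilin {K : ℕ} {f : M →ₗ[ℂ] M} {g : M' →ₗ[ℂ] M'} {h : M'' →ₗ[ℂ] M''}
    (hf : f ^ K = 0) (hg : g ^ K = 0) (hh : h ^ K = 0) (m : M →ₗ[ℂ] M' →ₗ[ℂ] M'')
    (hm : ∀ u v, h (m u v) = m (f u) v + m u (g v)) (u v) :
    expSum K h (m u v) = m (expSum K f u) (expSum K g v) := by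
  let _ : Module ℚ M := Module.compHom M (algebraMap ℚ ℂ)
  let _ : Module ℚ M' := Module.compHom M' (algebraMap ℚ ℂ)
  let _ : Module ℚ M'' := Module.compHom M'' (algebraMap ℚ ℂ)
  let DL : Module.End ℂ (M ⊗[ℂ] M') := g.lTensor M
  let DR : Module.End ℂ (M ⊗[ℂ] M') := f.rTensor M'
  have h_nilL : IsNilpotent DL := IsNilpotent.map ⟨K, hg⟩ (lTensorAlgHom ℂ M' M)
  have h_nilR : IsNilpotent DR := IsNilpotent.map ⟨K, hf⟩ (rTensorAlgHom ℂ M M')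
  have h_comm : Commute DL DR := by ext; simp [DL, DR]
  have h₁ : IsNilpotent.exp h (m u v) = TensorProduct.lift m (IsNilpotent.exp (DL + DR) (u ⊗ₜ[ℂ] v)) := by
    suffices IsNilpotent.exp h ∘ₗ TensorProduct.lift m =
        TensorProduct.lift m ∘ₗ IsNilpotent.exp (DL + DR) by
      simpa using! LinearMap.congr_fun this (u ⊗ₜ[ℂ] v)
    apply commute_exp_left_of_commute (h_comm.isNilpotent_add h_nilL h_nilR) ⟨K, hh⟩
    ext u v
    simp [DL, DR, hm, add_comm]
  have h₂ : IsNilpotent.exp DL = (IsNilpotent.exp g).lTensor M :=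
    (IsNilpotent.map_exp ⟨K, hg⟩ (lTensorAlgHom ℂ M' M)).symm
  have h₃ : IsNilpotent.exp DR = (IsNilpotent.exp f).rTensor M' :=
    (IsNilpotent.map_exp ⟨K, hf⟩ (rTensorAlgHom ℂ M M')).symm
  rw [← exp_eq_expSum hf, ← exp_eq_expSum hg, ← exp_eq_expSum hh, h₁,
    exp_add_of_commute h_comm h_nilL h_nilR, h₂, h₃]
  simp

theorem expSum_succ {K : ℕ} {f : M →ₗ[ℂ] M} (hf : f ^ K = 0) : expSum (K + 1) f = expSum K f := by
  rw [expSum, Finset.sum_range_succ, hf, smul_zero, add_zero, expSum]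

end Exp

variable {L : Type*} [AddCommGroup L] [Module ℂ L]
namespace SuperCalc
variable (S : SuperCalc L)

/-! ### Gauge transformations -/

/-- The adjoint action of `exp ω`. -/
def gaugeAd (ω : L) : L →ₗ[ℂ] L := expSum 9 (S.br ω)

/-- The inhomogeneous term of a gauge transformation. -/
def gaugeInhom (ω : L) : L →ₗ[ℂ] L :=
  -∑ k ∈ Finset.range 9, (1 / ((k + 1).factorial : ℂ)) • S.br ω ^ k

/-- The gauge transform of a connection. -/
def gauge (ω : L) (A : Conn L) : Conn L where
  bos α α' := S.gaugeAd ω (A.bos α α') + S.gaugeInhom ω (S.dx α α' ω)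
  fer a α := S.gaugeAd ω (A.fer a α) + S.gaugeInhom ω (S.dth a α ω)

/-- The action of `ad ω` on covariant derivatives `c ∂ + A`, where `v = ∂ ω`. -/
def affAd (ω v : L) : ℂ × L →ₗ[ℂ] ℂ × L :=
  LinearMap.inr ℂ ℂ L ∘ₗ (LinearMap.coprod (LinearMap.toSpanSingleton ℂ L (-v)) (S.br ω))

variable {S} {A : Conn L} {Φ : Fields L} {lam : ℂ} {n : ℕ} {ω : L}

theorem affAd_apply (v : L) (u : ℂ × L) : S.affAd ω v u = (0, -u.1 • v + S.br ω u.2) := by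
  simp [affAd]

theorem br_pow_mem_fil (hω : ω ∈ S.fil 1) {x : L} (hx : x ∈ S.fil n) (k : ℕ) :
    (S.br ω ^ k) x ∈ S.fil (n + k) := by
  induction k with
  | zero => simpa using hx
  | succ k ih =>
    rw [pow_succ', Module.End.mul_apply, ← add_assoc, add_comm _ 1]
    exact br_mem_fil hω ih

theorem br_pow_nine (hω : ω ∈ S.fil 1) : S.br ω ^ 9 = 0 := by
  ext x
  simpa using eq_zero_of_mem_fil (by simpa using br_pow_mem_fil hω (fil_zero x) 9)

theorem affAd_pow_succ (v : L) (u : ℂ × L) (k : ℕ) :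
    (S.affAd ω v ^ (k + 1)) u = (0, (S.br ω ^ k) (-u.1 • v + S.br ω u.2)) := by
  induction k with
  | zero => simp [affAd_apply]
  | succ k ih =>
    rw [pow_succ', Module.End.mul_apply, ih, affAd_apply, pow_succ', Module.End.mul_apply]
    simp

/-- One application maps into the second component, and nine more brackets with `ω` annihilate it.
-/
theorem affAd_pow_ten (hω : ω ∈ S.fil 1) (v : L) : S.affAd ω v ^ 10 = 0 := by
  refine LinearMap.ext fun u => ?_
  rw [affAd_pow_succ, br_pow_nine hω]
  rfl

theorem gaugeAd_eq (hω : ω ∈ S.fil 1) : S.gaugeAd ω = expSum 10 (S.br ω) :=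
  (expSum_succ (br_pow_nine hω)).symm

/-- The exponential of one linear operator on `c∂ + A` contains both parts of the gauge
transformation. The first application turns `∂` into `-∂ω`, which shifts the factorials of the
inhomogeneous term by one. -/
theorem expSum_affAd (hω : ω ∈ S.fil 1) (v x : L) :
    expSum 10 (S.affAd ω v) (1, x) = (1, S.gaugeAd ω x + S.gaugeInhom ω v) := by
  rw [gaugeAd_eq hω, expSum_apply, expSum_apply, Finset.sum_range_succ', Finset.sum_range_succ' _ 9]
  have h : ∀ k, (1 / ((k + 1).factorial : ℂ)) • (S.affAd ω v ^ (k + 1)) (1, x) =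
      LinearMap.inr ℂ ℂ L ((1 / ((k + 1).factorial : ℂ)) • (S.br ω ^ (k + 1)) x -
        (1 / ((k + 1).factorial : ℂ)) • (S.br ω ^ k) v) := fun k => by
    rw [affAd_pow_succ, pow_succ, Module.End.mul_apply, ← smul_sub, map_smul]
    congr 1
    simp only [neg_smul, one_smul, map_add, map_neg, LinearMap.inr_apply]
    rw [sub_eq_add_neg, add_comm]
  simp only [h, ← map_sum, Finset.sum_sub_distrib]
  simp only [gaugeInhom, LinearMap.neg_apply, LinearMap.sum_apply, LinearMap.smul_apply,
    LinearMap.inr_apply]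
  ext
  · simp
  · simp; abel

theorem gaugeAd_br (hω : ω ∈ S.fil 1) (hω' : S.par ω = ω) (x y) :
    S.gaugeAd ω (S.br x y) = S.br (S.gaugeAd ω x) (S.gaugeAd ω y) :=
  expSum_bilin (br_pow_nine hω) (br_pow_nine hω) (br_pow_nine hω) S.br
    (fun u v => S.jacobi_even ω u v hω') x y

/-- Gauge covariance of `∂ + A`, where `∂` is a derivation along `ω`. -/
theorem gaugeAd_cov (hω : ω ∈ S.fil 1) (hω' : S.par ω = ω) (d : L →ₗ[ℂ] L)
    (hd : ∀ x, d (S.br ω x) = S.br (d ω) x + S.br ω (d x)) (a x : L) :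
    S.gaugeAd ω (d x + S.br a x) =
      d (S.gaugeAd ω x) + S.br (S.gaugeAd ω a + S.gaugeInhom ω (d ω)) (S.gaugeAd ω x) := by
  -- The action of `c∂ + A` on a field as a bilinear map; its Leibniz rule under `ad ω` is what
  -- `expSum_bilin` requires.
  let m : ℂ × L →ₗ[ℂ] L →ₗ[ℂ] L := LinearMap.mk₂ ℂ
    (fun u w => u.1 • d w + S.br u.2 w)
    (fun u u' w => by simp; module) (fun c u w => by simp; module)
    (fun u w w' => by simp; module) (fun c u w => by simp; module)
  have h := expSum_bilin (affAd_pow_ten hω (d ω))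
    (show S.br ω ^ 10 = 0 by rw [pow_succ, br_pow_nine hω, zero_mul])
    (show S.br ω ^ 10 = 0 by rw [pow_succ, br_pow_nine hω, zero_mul])
    m (fun u v => by
      simp only [m, LinearMap.mk₂_apply, affAd_apply, LinearMap.add_apply, LinearMap.smul_apply,
        map_add, map_smul, hd, zero_smul, neg_smul, map_neg, LinearMap.neg_apply,
        S.jacobi_even ω u.2 v hω']
      module) (1, a) x
  rw [expSum_affAd hω, ← gaugeAd_eq hω] at h
  simpa [m] using h

/-- Gauge covariance of the curvature of two covariant derivatives. -/
theorem gaugeAd_curv (hω : ω ∈ S.fil 1) (hω' : S.par ω = ω) (d e : L →ₗ[ℂ] L) (v : L)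
    (hd : ∀ x, d (S.br ω x) = S.br (d ω) x + S.br ω (d x))
    (he : ∀ x, e (S.br ω x) = S.br ω (e x) + S.br x v) (hv : e (d ω) + d v = 0) (a b : L) :
    S.gaugeAd ω (d b + e a + S.br a b) =
      d (S.gaugeAd ω b + S.gaugeInhom ω v) + e (S.gaugeAd ω a + S.gaugeInhom ω (d ω)) +
        S.br (S.gaugeAd ω a + S.gaugeInhom ω (d ω)) (S.gaugeAd ω b + S.gaugeInhom ω v) := by
  -- The curvature as a bilinear function of two covariant derivatives. The hypothesis `hv` removes
  -- the terms with second derivatives of `ω`.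
  let m : ℂ × L →ₗ[ℂ] ℂ × L →ₗ[ℂ] L := LinearMap.mk₂ ℂ
    (fun u w => u.1 • d w.2 + w.1 • e u.2 + S.br u.2 w.2)
    (fun u u' w => by simp; module) (fun c u w => by simp; module)
    (fun u w w' => by simp; module) (fun c u w => by simp; module)
  have h := expSum_bilin (affAd_pow_ten hω (d ω)) (affAd_pow_ten hω v)
    (show S.br ω ^ 10 = 0 by rw [pow_succ, br_pow_nine hω, zero_mul]) m (fun u w => by
      simp only [m, LinearMap.mk₂_apply, affAd_apply, map_add, map_smul, map_neg, neg_smul,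
        LinearMap.add_apply, LinearMap.smul_apply, LinearMap.neg_apply, zero_smul, hd, he,
        S.jacobi_even ω u.2 w.2 hω']
      linear_combination (norm := module) (u.1 * w.1) • hv) (1, a) (1, b)
  rw [expSum_affAd hω, expSum_affAd hω, ← gaugeAd_eq hω] at h
  simpa [m] using h

theorem gaugeAd_covB (hω : ω ∈ S.fil 1) (hω' : S.par ω = ω) (α α' x) :
    S.gaugeAd ω (S.covB A.bos α α' x) = S.covB (S.gauge ω A).bos α α' (S.gaugeAd ω x) :=
  gaugeAd_cov hω hω' (S.dx α α') (S.dx_br α α' ω) _ _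

theorem gaugeAd_covF (hω : ω ∈ S.fil 1) (hω' : S.par ω = ω) (a α x) :
    S.gaugeAd ω (S.covF A a α x) = S.covF (S.gauge ω A) a α (S.gaugeAd ω x) :=
  gaugeAd_cov hω hω' (S.dth a α) (fun x => by rw [S.dth_br, hω']) _ _

theorem gaugeAd_curvFB (hω : ω ∈ S.fil 1) (hω' : S.par ω = ω) (a α β β') :
    S.gaugeAd ω (S.curvFB A a α β β') = S.curvFB (S.gauge ω A) a α β β' := by
  have h := gaugeAd_curv hω hω' (S.dth a α) (-S.dx β β') (S.dx β β' ω)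
    (fun x => by rw [S.dth_br, hω']) (fun x => by
      rw [S.skew' (x := x) (y := S.dx β β' ω) (by rw [S.par_dx, hω'])]
      simp only [LinearMap.neg_apply, S.dx_br, map_neg]; abel)
    (by simp only [LinearMap.neg_apply, S.dx_dth]; abel) (A.fer a α) (A.bos β β')
  simp only [LinearMap.neg_apply, ← sub_eq_add_neg] at h
  exact h

theorem gaugeAd_curvBB (hω : ω ∈ S.fil 1) (hω' : S.par ω = ω) (α α' β β') :
    S.gaugeAd ω (S.curvBB A.bos α α' β β') = S.curvBB (S.gauge ω A).bos α α' β β' := by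
  have h := gaugeAd_curv hω hω' (S.dx α α') (-S.dx β β') (S.dx β β' ω)
    (S.dx_br α α' ω) (fun x => by
      rw [S.skew' (x := x) (y := S.dx β β' ω) (by rw [S.par_dx, hω'])]
      simp only [LinearMap.neg_apply, S.dx_br, map_neg]; abel)
    (by simp only [LinearMap.neg_apply, S.dx_dx β β']; abel) (A.bos α α') (A.bos β β')
  simp only [LinearMap.neg_apply, ← sub_eq_add_neg] at h
  exact h

theorem par_br_pow (hω' : S.par ω = ω) (k : ℕ) (x : L) :
    S.par ((S.br ω ^ k) x) = (S.br ω ^ k) (S.par x) := by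
  induction k with
  | zero => simp
  | succ k ih => simp only [pow_succ', Module.End.mul_apply, S.par_br, hω', ih]

theorem par_gaugeAd (hω' : S.par ω = ω) (x : L) :
    S.par (S.gaugeAd ω x) = S.gaugeAd ω (S.par x) := by
  simp only [gaugeAd, expSum_apply, map_sum, map_smul, par_br_pow hω']

theorem par_gaugeInhom (hω' : S.par ω = ω) (x : L) :
    S.par (S.gaugeInhom ω x) = S.gaugeInhom ω (S.par x) := by
  simp only [gaugeInhom, LinearMap.neg_apply, LinearMap.sum_apply, LinearMap.smul_apply, map_neg,
    map_sum, map_smul, par_br_pow hω']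

theorem gauge_graded (hω' : S.par ω = ω) (hA : S.GradedConn A) : S.GradedConn (S.gauge ω A) where
  bos_even α α' := by
    simp only [gauge, map_add, par_gaugeAd hω', par_gaugeInhom hω', hA.bos_even, S.par_dx, hω']
  fer_odd a α := by
    simp only [gauge, map_add, par_gaugeAd hω', par_gaugeInhom hω', hA.fer_odd, S.par_dth, hω',
      map_neg, neg_add]

theorem gaugeAd_curvFF (hω : ω ∈ S.fil 1) (hω' : S.par ω = ω) (hA : S.GradedConn A) (a α b β) :
    S.gaugeAd ω (S.curvFF A a α b β) = S.curvFF (S.gauge ω A) a α b β := by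
  -- Composition with the parity supplies the sign of an odd derivative passing an odd argument. On
  -- the odd `A_{aα}` it cancels the outer minus sign.
  have h := gaugeAd_curv hω hω' (S.dth a α) (-(S.dth b β ∘ₗ S.par)) (S.dth b β ω)
    (fun x => by rw [S.dth_br, hω']) (fun x => by
      rw [SuperLie.br_odd_right (y := S.dth b β ω) (by rw [S.par_dth, hω'])]
      simp only [LinearMap.neg_apply, LinearMap.comp_apply, S.par_br, S.dth_br, hω', map_neg]
      abel)
    (by simp only [LinearMap.neg_apply, LinearMap.comp_apply, S.par_dth, hω', S.dth_dth a α b β,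
          map_neg]; abel) (A.fer a α) (A.fer b β)
  have h1 : S.par (S.gaugeAd ω (A.fer a α) + S.gaugeInhom ω (S.dth a α ω)) =
      -(S.gaugeAd ω (A.fer a α) + S.gaugeInhom ω (S.dth a α ω)) :=
    (gauge_graded hω' hA).fer_odd a α
  simp only [LinearMap.neg_apply, LinearMap.comp_apply, hA.fer_odd, h1, map_neg, neg_neg] at h
  exact h

theorem br_pow_th (hω' : S.par ω = ω) (k : ℕ) (a α x) :
    (S.br ω ^ k) (S.th a α x) = S.th a α ((S.br ω ^ k) x) := by
  induction k with
  | zero => simp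
  | succ k ih => simp only [pow_succ', Module.End.mul_apply, ih, S.br_th, hω']

theorem gaugeAd_th (hω' : S.par ω = ω) (a α x) :
    S.gaugeAd ω (S.th a α x) = S.th a α (S.gaugeAd ω x) := by
  simp only [gaugeAd, expSum_apply, map_sum, map_smul, br_pow_th hω']

theorem gaugeInhom_th (hω' : S.par ω = ω) (a α x) :
    S.gaugeInhom ω (S.th a α x) = S.th a α (S.gaugeInhom ω x) := by
  simp only [gaugeInhom, LinearMap.neg_apply, LinearMap.sum_apply, LinearMap.smul_apply, map_neg,
    map_sum, map_smul, br_pow_th hω']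

theorem gaugeAd_thLow (hω' : S.par ω = ω) (a α x) :
    S.gaugeAd ω (S.thLow a α x) = S.thLow a α (S.gaugeAd ω x) := by
  simp only [thLow_apply, map_sum, map_smul, gaugeAd_th hω']

theorem gaugeAd_Ft (hω : ω ∈ S.fil 1) (hω' : S.par ω = ω) (α' β') :
    S.gaugeAd ω (S.Ft A.bos α' β') = S.Ft (S.gauge ω A).bos α' β' := by
  simp only [Ft, map_sum, map_smul, gaugeAd_curvBB hω hω']

theorem gaugeAd_Fa (hω : ω ∈ S.fil 1) (hω' : S.par ω = ω) (α β) :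
    S.gaugeAd ω (S.Fa A.bos α β) = S.Fa (S.gauge ω A).bos α β := by
  simp only [Fa, map_sum, map_smul, gaugeAd_curvBB hω hω']

theorem gaugeAd_sub_mem_fil (hω : ω ∈ S.fil 1) {x : L} (hx : x ∈ S.fil n) :
    S.gaugeAd ω x - x ∈ S.fil (n + 1) := by
  rw [gaugeAd, expSum_apply, Finset.sum_range_succ']
  simp only [pow_zero, Nat.factorial_zero, Nat.cast_one, div_one, one_smul, Module.End.one_apply,
    add_sub_cancel_right]
  refine Submodule.sum_mem _ fun k _ => Submodule.smul_mem _ _ ?_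
  exact fil_antitone (by omega) (br_pow_mem_fil hω hx (k + 1))

/-- The map is the identity on every graded piece. -/
theorem gaugeAd_injective (hω : ω ∈ S.fil 1) : Function.Injective (S.gaugeAd ω) := by
  rw [injective_iff_map_eq_zero]
  intro x hx
  have h : ∀ n, x ∈ S.fil n := fun n => by
    induction n with
    | zero => exact fil_zero x
    | succ n ih =>
      have := gaugeAd_sub_mem_fil hω ih
      rwa [hx, zero_sub, neg_mem_iff] at this
  exact eq_zero_of_mem_fil (h 9)

theorem map_gaugeAd_graded (hω' : S.par ω = ω) (hΦ : S.Graded Φ) :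
    S.Graded (Φ.map (S.gaugeAd ω)) where
  psiT_odd a α' := by simp only [Fields.map, par_gaugeAd hω', hΦ.psiT_odd, map_neg]
  phi_even a b := by simp only [Fields.map, par_gaugeAd hω', hΦ.phi_even]
  psi_odd a α := by simp only [Fields.map, par_gaugeAd hω', hΦ.psi_odd, map_neg]
  B_even α β := by simp only [Fields.map, par_gaugeAd hω', hΦ.B_even]
  phi_skew a b := by simp only [Fields.map]; rw [hΦ.phi_skew, map_neg]
  B_symm α β := by simp only [Fields.map]; rw [hΦ.B_symm]

/-- Both sides of each relation transform by `exp(ad ω)`, which is injective. -/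
theorem rel_gauge_iff (hω : ω ∈ S.fil 1) (hω' : S.par ω = ω) (hA : S.GradedConn A) :
    S.Rel lam (S.gauge ω A) (Φ.map (S.gaugeAd ω)) ↔ S.Rel lam A Φ := by
  have hi : ∀ {x y x' y'}, x' = S.gaugeAd ω x → y' = S.gaugeAd ω y → (x' = y' ↔ x = y) := by
    rintro x y _ _ rfl rfl
    exact (gaugeAd_injective hω).eq_iff
  have e1 : ∀ β β', (∑ a, ∑ α, S.th a α (S.curvFB (S.gauge ω A) a α β β') =
      ∑ a, S.thLow a β (S.gaugeAd ω (Φ.psiT a β'))) ↔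
      ∑ a, ∑ α, S.th a α (S.curvFB A a α β β') = ∑ a, S.thLow a β (Φ.psiT a β') := fun β β' => by
    refine hi ?_ ?_ <;> simp only [map_sum, gaugeAd_th hω', gaugeAd_thLow hω',
      gaugeAd_curvFB hω hω']
  have e2 : ∀ b β, (∑ a, ∑ α, S.th a α (S.curvFF (S.gauge ω A) a α b β) =
      (2 : ℂ) • ∑ a, S.thLow a β (S.gaugeAd ω (Φ.phi a b))) ↔
      ∑ a, ∑ α, S.th a α (S.curvFF A a α b β) = (2 : ℂ) • ∑ a, S.thLow a β (Φ.phi a b) :=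
    fun b β => by
    refine hi ?_ ?_ <;> simp only [map_sum, map_smul, gaugeAd_th hω', gaugeAd_thLow hω',
      gaugeAd_curvFF hω hω' hA]
  have e3 : ∀ a α α' β', (S.covF (S.gauge ω A) a α (S.Ft (S.gauge ω A).bos α' β') =
      (1 / 2 : ℂ) • (S.covB (S.gauge ω A).bos α α' (S.gaugeAd ω (Φ.psiT a β')) +
        S.covB (S.gauge ω A).bos α β' (S.gaugeAd ω (Φ.psiT a α')))) ↔
      S.covF A a α (S.Ft A.bos α' β') = (1 / 2 : ℂ) •
        (S.covB A.bos α α' (Φ.psiT a β') + S.covB A.bos α β' (Φ.psiT a α')) := fun a α α' β' => by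
    refine hi ?_ ?_ <;> simp only [map_smul, map_add, gaugeAd_covF hω hω', gaugeAd_covB hω hω',
      gaugeAd_Ft hω hω']
  have e4 : ∀ a α b α', (S.covF (S.gauge ω A) a α (S.gaugeAd ω (Φ.psiT b α')) =
      SuperLie.qpsiT (S.covB (S.gauge ω A).bos) (Φ.map (S.gaugeAd ω)) a α b α') ↔
      S.covF A a α (Φ.psiT b α') = SuperLie.qpsiT (S.covB A.bos) Φ a α b α' := fun a α b α' => by
    rw [SuperLie.qpsiT, SuperLie.qpsiT]
    refine hi ?_ ?_ <;> simp only [map_smul, gaugeAd_covF hω hω', gaugeAd_covB hω hω', Fields.map]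
  have e5 : ∀ a α b c, (S.covF (S.gauge ω A) a α (S.gaugeAd ω (Φ.phi b c)) =
      SuperLie.qphi (Φ.map (S.gaugeAd ω)) a α b c) ↔
      S.covF A a α (Φ.phi b c) = SuperLie.qphi Φ a α b c := fun a α b c => by
    rw [SuperLie.qphi, SuperLie.qphi]
    refine hi ?_ ?_ <;> simp only [map_smul, map_sum, gaugeAd_covF hω hω', Fields.map]
  have e6 : ∀ a α b β, (S.covF (S.gauge ω A) a α (S.gaugeAd ω (Φ.psi b β)) =
      S.qpsi (Φ.map (S.gaugeAd ω)) a α b β) ↔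
      S.covF A a α (Φ.psi b β) = S.qpsi Φ a α b β := fun a α b β => by
    rw [SuperLie.qpsi, SuperLie.qpsi]
    refine hi ?_ ?_ <;> simp only [map_smul, map_sum, map_add, map_neg, map_ite_zero,
      gaugeAd_covF hω hω', Fields.map, gaugeAd_br hω hω', map_raise (S.gaugeAd ω)]
  have e7 : ∀ a α β γ, (S.covF (S.gauge ω A) a α (S.gaugeAd ω (Φ.B β γ)) =
      S.qB (Φ.map (S.gaugeAd ω)) a α β γ) ↔
      S.covF A a α (Φ.B β γ) = S.qB Φ a α β γ := fun a α β γ => by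
    rw [SuperLie.qB, SuperLie.qB]
    refine hi ?_ ?_ <;> simp only [map_smul, map_sum, map_add, gaugeAd_covF hω hω', Fields.map,
      gaugeAd_br hω hω']
  have e8 : ∀ α β, (S.Fa (S.gauge ω A).bos α β = lam • S.gaugeAd ω (Φ.B α β)) ↔
      S.Fa A.bos α β = lam • Φ.B α β := fun α β => by
    refine hi (gaugeAd_Fa hω hω' _ _).symm (map_smul _ _ _).symm
  constructor
  · intro h
    exact ⟨fun _ _ => (e1 _ _).1 (h.curvFB _ _), fun _ _ => (e2 _ _).1 (h.curvFF _ _),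
      fun _ _ _ _ => (e3 _ _ _ _).1 (h.Ft _ _ _ _), fun _ _ _ _ => (e4 _ _ _ _).1 (h.psiT _ _ _ _),
      fun _ _ _ _ => (e5 _ _ _ _).1 (h.phi _ _ _ _), fun _ _ _ _ => (e6 _ _ _ _).1 (h.psi _ _ _ _),
      fun _ _ _ _ => (e7 _ _ _ _).1 (h.B _ _ _ _), fun _ _ => (e8 _ _).1 (h.asd _ _)⟩
  · intro h
    exact ⟨fun _ _ => (e1 _ _).2 (h.curvFB _ _), fun _ _ => (e2 _ _).2 (h.curvFF _ _),
      fun _ _ _ _ => (e3 _ _ _ _).2 (h.Ft _ _ _ _), fun _ _ _ _ => (e4 _ _ _ _).2 (h.psiT _ _ _ _),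
      fun _ _ _ _ => (e5 _ _ _ _).2 (h.phi _ _ _ _), fun _ _ _ _ => (e6 _ _ _ _).2 (h.psi _ _ _ _),
      fun _ _ _ _ => (e7 _ _ _ _).2 (h.B _ _ _ _), fun _ _ => (e8 _ _).2 (h.asd _ _)⟩

/-! ### Existence of radial gauge -/

/-- In the difference of the two brackets each error is paired with a factor of positive degree. -/
theorem Eqv.br_succ {x y x' y' : L} (hy : y ∈ S.fil 1) (hx' : x' ∈ S.fil 1) (h : S.Eqv n x y)
    (h' : S.Eqv n x' y') : S.Eqv (n + 1) (S.br x x') (S.br y y') := by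
  have : S.br x x' - S.br y y' = S.br (x - y) x' + S.br y (x' - y') := by
    simp only [map_sub, LinearMap.sub_apply]; abel
  rw [Eqv, this]
  refine add_mem (br_mem_fil h hx') ?_
  have := br_mem_fil hy h'
  rwa [add_comm] at this

theorem Eqv.br_pow {ω' x x' : L} (hω : ω ∈ S.fil 1) (hω' : ω' ∈ S.fil 1) (hx : x ∈ S.fil 1)
    (h : S.Eqv n ω ω') (h' : S.Eqv n x x') (k : ℕ) :
    S.Eqv (n + 1) ((S.br ω ^ (k + 1)) x) ((S.br ω' ^ (k + 1)) x') := by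
  induction k with
  | zero => simpa using Eqv.br_succ hω' hx h h'
  | succ k ih =>
    rw [pow_succ', pow_succ' _ (k + 1), Module.End.mul_apply, Module.End.mul_apply]
    exact Eqv.br_succ hω' (fil_antitone (by omega) (br_pow_mem_fil hω hx (k + 1))) h
      (ih.mono (Nat.le_succ n))

variable (S) in
/-- The right-hand side of the equation `𝒟 ω = …` for the parameter `ω` of the gauge transformation
to radial gauge, where `w = θ^{aα} A_{aα}`. -/
def radialRhs (w ω : L) : L :=
  S.gaugeAd ω w - ∑ k ∈ Finset.range 8, (1 / ((k + 2).factorial : ℂ)) •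
    (S.br ω ^ (k + 1)) (S.euler ω)

theorem gaugeAd_mem_fil (hω : ω ∈ S.fil 1) {x : L} (hx : x ∈ S.fil n) :
    S.gaugeAd ω x ∈ S.fil n := by
  have := add_mem (fil_succ_le_self _ (gaugeAd_sub_mem_fil hω hx)) hx
  rwa [sub_add_cancel] at this

theorem euler_mem_fil {x : L} (hx : x ∈ S.fil n) : S.euler x ∈ S.fil n := by
  have := add_mem (fil_succ_le_self _ (euler_sub_mem_fil hx)) (Submodule.smul_mem _ (n : ℂ) hx)
  rwa [sub_add_cancel] at this

theorem radialRhs_mem_fil {w : L} (hw : w ∈ S.fil 1) (hω : ω ∈ S.fil 1) :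
    S.radialRhs w ω ∈ S.fil 1 :=
  sub_mem (gaugeAd_mem_fil hω hw) (Submodule.sum_mem _ fun k _ => Submodule.smul_mem _ _
    (fil_antitone (by omega) (br_pow_mem_fil hω (euler_mem_fil hω) (k + 1))))

theorem radialRhs_eqv {w ω' : L} (hw : w ∈ S.fil 1) (hω : ω ∈ S.fil 1) (hω' : ω' ∈ S.fil 1)
    (h : S.Eqv n ω ω') : S.Eqv (n + 1) (S.radialRhs w ω) (S.radialRhs w ω') := by
  refine Eqv.sub ?_ ?_
  · rw [gaugeAd, gaugeAd, expSum_apply, expSum_apply, Finset.sum_range_succ' _ 8,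
      Finset.sum_range_succ' _ 8]
    refine Eqv.add ?_ (Eqv.refl _)
    rw [Eqv, ← Finset.sum_sub_distrib]
    exact Submodule.sum_mem _ fun k _ => Eqv.smul _ (Eqv.br_pow hω hω' hw h (Eqv.refl _) k)
  · rw [Eqv, ← Finset.sum_sub_distrib]
    refine Submodule.sum_mem _ fun k _ => Eqv.smul _
      (Eqv.br_pow hω hω' (euler_mem_fil hω) h ?_ k)
    rw [Eqv, ← map_sub]
    exact euler_mem_fil h

/-- The gauge condition on the transform reads `exp(ad ω) w = ∑ (ad ω)^k 𝒟ω / (k+1)!`. Isolating the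
term `k = 0` gives an equation for `𝒟ω` in which `ω` occurs on the right only inside brackets of
elements of positive degree, so inverting `𝒟` yields a map that gains a degree. -/
theorem exists_radial_gauge (hA : S.GradedConn A) :
    ∃ ω, S.par ω = ω ∧ ω ∈ S.fil 1 ∧ ∑ a, ∑ α, S.th a α ((S.gauge ω A).fer a α) = 0 := by
  set w := ∑ a, ∑ α, S.th a α (A.fer a α) with hwdef
  have hw : w ∈ S.fil 1 := sum_th_mem_fil fun _ _ => fil_zero _
  have hw' : S.par w = w := by simp only [hwdef, map_sum, S.par_th, hA.fer_odd, map_neg, neg_neg]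
  obtain ⟨ω, ⟨hω', hω⟩, hT⟩ := exists_fixed_point (fun ω => S.eulerInv 0 (S.radialRhs w ω))
    (fun ω => S.par ω = ω ∧ ω ∈ S.fil 1) (fun n => S.Eqv n)
    (fun ω hω => by
      have h1 := radialRhs_mem_fil hw hω.2
      refine ⟨?_, (eulerInv_spec (c := 0) h1).1⟩
      rw [par_eulerInv (c := 0) h1]
      congr 1
      simp only [radialRhs, map_sub, map_sum, map_smul, par_gaugeAd hω.1, par_br_pow hω.1,
        par_euler, hw', hω.1])
    Eqv.zero
    (fun n ω ω' hω hω' h => eulerInv_eqv (c := 0) (radialRhs_mem_fil hw hω.2)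
      (radialRhs_mem_fil hw hω'.2) (radialRhs_eqv hw hω.2 hω'.2 h))
    (fun _ _ => Eqv.eq) (x := 0) ⟨map_zero _, zero_mem _⟩
  refine ⟨ω, hω', hω, ?_⟩
  have h := (eulerInv_spec (c := 0) (radialRhs_mem_fil hw hω)).2
  rw [hT, Nat.cast_zero, zero_smul, add_zero] at h
  have h1 : ∑ a, ∑ α, S.th a α ((S.gauge ω A).fer a α) =
      S.gaugeAd ω w + S.gaugeInhom ω (S.euler ω) := by
    simp only [gauge, map_add, ← gaugeAd_th hω', ← gaugeInhom_th hω', Finset.sum_add_distrib,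
      ← map_sum, ← euler_apply, hwdef]
  rw [h1, gaugeInhom, Finset.sum_range_succ']
  simp only [LinearMap.neg_apply, LinearMap.add_apply, LinearMap.sum_apply, LinearMap.smul_apply,
    pow_zero, Module.End.one_apply, zero_add, Nat.factorial_one, Nat.cast_one, div_one, one_smul]
  rw [radialRhs] at h
  nth_rewrite 2 [h]
  abel

end SuperCalc
end ChiralSuperspace

namespace ChiralSuperspace

/-! ### The Grassmann algebra -/

section Grassmann

open CliffordAlgebra

variable {V : Type*} [AddCommGroup V] [Module ℂ V]

/-- Induction for the exterior algebra by multiplication with vectors from the left. -/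
theorem ext_left_induction {P : ExteriorAlgebra ℂ V → Prop}
    (h0 : ∀ r, P (algebraMap ℂ _ r)) (h1 : ∀ x y, P x → P y → P (x + y))
    (h2 : ∀ v x, P x → P (ExteriorAlgebra.ι ℂ v * x)) (x : ExteriorAlgebra ℂ V) : P x :=
  CliffordAlgebra.left_induction (0 : QuadraticForm ℂ V) h0 h1 (fun x v => h2 v x) x

theorem involute_ext_ι (v : V) :
    involute (ExteriorAlgebra.ι ℂ v) = -ExteriorAlgebra.ι ℂ v := involute_ι v

theorem ext_ι_mul_swap (v w : V) (x : ExteriorAlgebra ℂ V) :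
    ExteriorAlgebra.ι ℂ v * (ExteriorAlgebra.ι ℂ w * x) =
      -(ExteriorAlgebra.ι ℂ w * (ExteriorAlgebra.ι ℂ v * x)) := by
  have h := ExteriorAlgebra.ι_add_mul_swap (R := ℂ) v w
  rw [← mul_assoc, ← mul_assoc, ← neg_mul, eq_neg_of_add_eq_zero_left h]

theorem mul_ext_ι (v : V) (x : ExteriorAlgebra ℂ V) :
    x * ExteriorAlgebra.ι ℂ v = ExteriorAlgebra.ι ℂ v * involute x := by
  induction x using ext_left_induction with
  | h0 r => rw [AlgHom.commutes, Algebra.commutes]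
  | h1 x y hx hy => rw [add_mul, hx, hy, map_add, mul_add]
  | h2 w x hx => rw [mul_assoc, hx, ext_ι_mul_swap, map_mul, involute_ext_ι, neg_mul, mul_neg]

theorem contractLeft_ext_ι_mul (d : Module.Dual ℂ V) (v : V) (x : ExteriorAlgebra ℂ V) :
    contractLeft d (ExteriorAlgebra.ι ℂ v * x) =
      d v • x - ExteriorAlgebra.ι ℂ v * contractLeft d x :=
  contractLeft_ι_mul (Q := (0 : QuadraticForm ℂ V)) d v x

/-- The combination on the left is twice the even part of `x`, and even elements are central. -/
theorem even_mul_comm (x y : ExteriorAlgebra ℂ V) :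
    (x + involute x) * y = y * (x + involute x) := by
  induction y using ext_left_induction with
  | h0 r => rw [Algebra.commutes]
  | h1 y z hy hz => rw [mul_add, hy, hz, add_mul]
  | h2 w y hy =>
    rw [← mul_assoc, mul_ext_ι, map_add, involute_involute, add_comm, mul_assoc, hy, mul_assoc]

theorem odd_mul_comm (x y : ExteriorAlgebra ℂ V) :
    (x - involute x) * y = involute y * (x - involute x) := by
  induction y using ext_left_induction with
  | h0 r => rw [AlgHom.commutes, Algebra.commutes]
  | h1 y z hy hz => rw [mul_add, hy, hz, map_add, add_mul]
  | h2 w y hy =>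
    have h : involute (x - involute x) = -(x - involute x) := by
      rw [map_sub, involute_involute, neg_sub]
    rw [← mul_assoc, mul_ext_ι, h, mul_neg, neg_mul, mul_assoc, hy, map_mul, involute_ext_ι,
      neg_mul, neg_mul, mul_assoc]

theorem odd_mul_odd (x y : ExteriorAlgebra ℂ V) :
    (x - involute x) * (y - involute y) = -((y - involute y) * (x - involute x)) := by
  rw [odd_mul_comm, map_sub, involute_involute, ← neg_mul, neg_sub]

theorem contractLeft_mul (d : Module.Dual ℂ V) (x y : ExteriorAlgebra ℂ V) :
    contractLeft d (x * y) = contractLeft d x * y + involute x * contractLeft d y := by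
  induction x using ext_left_induction with
  | h0 r =>
    rw [contractLeft_algebraMap_mul, contractLeft_algebraMap, zero_mul, zero_add, AlgHom.commutes]
  | h1 x z hx hz => simp only [add_mul, map_add, hx, hz]; abel
  | h2 w x hx =>
    rw [mul_assoc, contractLeft_ext_ι_mul, contractLeft_ext_ι_mul, hx, map_mul, involute_ext_ι,
      sub_mul, mul_add, neg_mul, neg_mul, smul_mul_assoc, mul_assoc, mul_assoc]
    abel

theorem involute_contractLeft (d : Module.Dual ℂ V) (x : ExteriorAlgebra ℂ V) :
    involute (contractLeft d x) = -contractLeft d (involute x) := by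
  induction x using ext_left_induction with
  | h0 r => rw [AlgHom.commutes, contractLeft_algebraMap, map_zero, neg_zero]
  | h1 x z hx hz => simp only [map_add, hx, hz]; abel
  | h2 w x hx =>
    rw [contractLeft_ext_ι_mul, map_mul, involute_ext_ι, neg_mul, LinearMap.map_neg,
      contractLeft_ext_ι_mul, map_sub, map_smul, map_mul, hx, involute_ext_ι]
    simp only [neg_mul, mul_neg, neg_neg]

theorem contractLeft_map {d : Module.Dual ℂ V} {p : V →ₗ[ℂ] V} (h : ∀ v, d (p v) = 0)
    (x : ExteriorAlgebra ℂ V) : contractLeft d (ExteriorAlgebra.map p x) = 0 := by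
  induction x using ext_left_induction with
  | h0 r => rw [AlgHom.commutes, contractLeft_algebraMap]
  | h1 x z hx hz => simp only [map_add, hx, hz, add_zero]
  | h2 w x hx =>
    rw [map_mul, ExteriorAlgebra.map_apply_ι, contractLeft_ext_ι_mul, hx, h, zero_smul, mul_zero,
      sub_zero]

/-- Replacing the factors of a product one at a time by their images leaves errors containing some
`e i`. Anticommutation moves this factor to the front, at the cost of a sign. -/
theorem sub_map_mem {J : Type*} [Fintype J] {p : V →ₗ[ℂ] V} {e : J → V} {c : J → V → ℂ}
    (h : ∀ v, v - p v = ∑ i, c i v • e i) (x : ExteriorAlgebra ℂ V) :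
    x - ExteriorAlgebra.map p x ∈
      ⨆ i, LinearMap.range (LinearMap.mulLeft ℂ (ExteriorAlgebra.ι ℂ (e i))) := by
  set I := ⨆ i, LinearMap.range (LinearMap.mulLeft ℂ (ExteriorAlgebra.ι ℂ (e i)))
  have hI : ∀ i y, ExteriorAlgebra.ι ℂ (e i) * y ∈ I := fun i y =>
    Submodule.mem_iSup_of_mem i ⟨y, rfl⟩
  have hv : ∀ v y, y ∈ I → ExteriorAlgebra.ι ℂ v * y ∈ I := fun v y hy => by
    suffices I ≤ I.comap (LinearMap.mulLeft ℂ (ExteriorAlgebra.ι ℂ v)) from this hy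
    refine iSup_le fun i => ?_
    rintro _ ⟨y, rfl⟩
    simp only [Submodule.mem_comap, LinearMap.mulLeft_apply]
    rw [ext_ι_mul_swap]
    exact neg_mem (hI _ _)
  induction x using ext_left_induction with
  | h0 r => rw [AlgHom.commutes, sub_self]; exact zero_mem _
  | h1 x y hx hy => rw [map_add, add_sub_add_comm]; exact add_mem hx hy
  | h2 v x hx =>
    have : ExteriorAlgebra.ι ℂ v * x - ExteriorAlgebra.map p (ExteriorAlgebra.ι ℂ v * x) =
        ExteriorAlgebra.ι ℂ v * (x - ExteriorAlgebra.map p x) +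
          ∑ i, c i v • (ExteriorAlgebra.ι ℂ (e i) * ExteriorAlgebra.map p x) := by
      simp only [← smul_mul_assoc, ← Finset.sum_mul, ← map_smul, ← map_sum, ← h]
      rw [map_mul, ExteriorAlgebra.map_apply_ι, map_sub]
      noncomm_ring
    rw [this]
    exact add_mem (hv _ _ hx) (Submodule.sum_mem _ fun i _ => Submodule.smul_mem _ _ (hI _ _))

end Grassmann

/-! ### Derivatives of holomorphic functions -/

section Hol

variable {U : TopologicalSpace.Opens Spacetime}

theorem holPd_apply (i : Fin 2 × Fin 2) (f : Hol U) (x : U) :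
    (holPd i f).1 x = fderiv ℂ (holExt f) x (Pi.single i 1) := rfl

theorem holPd_mul (i : Fin 2 × Fin 2) (f g : Hol U) :
    holPd i (f * g) = holPd i f * g + f * holPd i g := by
  ext x
  have h : holExt (f * g) =ᶠ[nhds (x : Spacetime)] holExt f * holExt g :=
    holExt_eventuallyEq _ _ (fun y => by simp [holExt_apply]) x
  change fderiv ℂ (holExt (f * g)) x (Pi.single i 1) =
    fderiv ℂ (holExt f) x (Pi.single i 1) * g.1 x + f.1 x * fderiv ℂ (holExt g) x (Pi.single i 1)
  rw [h.fderiv_eq, fderiv_mul (analyticAt_holExt f x).differentiableAt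
    (analyticAt_holExt g x).differentiableAt]
  simp only [add_apply, smul_apply, smul_eq_mul,
    holExt_apply]
  ring

theorem holPd_comm (i j : Fin 2 × Fin 2) (f : Hol U) :
    holPd i (holPd j f) = holPd j (holPd i f) := by
  ext x
  have h : ∀ i j : Fin 2 × Fin 2, (holPd i (holPd j f)).1 x =
      fderiv ℂ (fderiv ℂ (holExt f)) x (Pi.single i 1) (Pi.single j 1) := fun i j => by
    have h1 : holExt (holPd j f) =ᶠ[nhds (x : Spacetime)]
        fun y => fderiv ℂ (holExt f) y (Pi.single j 1) :=
      holExt_eventuallyEq _ _ (fun y => rfl) x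
    rw [holPd_apply, h1.fderiv_eq, fderiv_clm_apply
      (analyticAt_holExt f x).fderiv.differentiableAt (differentiableAt_const _)]
    simp
  change (holPd i (holPd j f)).1 x = (holPd j (holPd i f)).1 x
  rw [h, h]
  have h2 : ContDiffAt ℂ 2 (holExt f) x := (analyticAt_holExt f x).contDiffAt
  exact (h2.isSymmSndFDerivAt (by simp)).eq _ _

end Hol

end ChiralSuperspace

namespace ChiralSuperspace

/-! ### The calculus of super-fields -/

variable {N : ℕ} {U : Opens Spacetime} {𝔤 : Type*} [LieRing 𝔤] [LieAlgebra ℂ 𝔤]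

theorem superField_induction {P : SuperField N U 𝔤 → Prop} (hadd : ∀ x y, P x → P y → P (x + y))
    (htmul : ∀ (f : Hol U) (g : Gr N) (X : 𝔤), P ((f ⊗ₜ[ℂ] g) ⊗ₜ[ℂ] X)) (x : SuperField N U 𝔤) :
    P x := by
  have h0 : P 0 := by
    have := htmul 0 0 0
    rwa [TensorProduct.tmul_zero] at this
  induction x using TensorProduct.induction_on with
  | zero => exact h0
  | add x y hx hy => exact hadd x y hx hy
  | tmul s X =>
    induction s using TensorProduct.induction_on with
    | zero => rwa [TensorProduct.zero_tmul]
    | add s t hs ht => rw [TensorProduct.add_tmul]; exact hadd _ _ hs ht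
    | tmul f g => exact htmul f g X

theorem onGr_tmul (T : Gr N →ₗ[ℂ] Gr N) (f : Hol U) (g : Gr N) (X : 𝔤) :
    onGr T ((f ⊗ₜ[ℂ] g) ⊗ₜ[ℂ] X) = (f ⊗ₜ[ℂ] T g) ⊗ₜ[ℂ] X := rfl

theorem dx_tmul (α α' : Fin 2) (f : Hol U) (g : Gr N) (X : 𝔤) :
    dx α α' ((f ⊗ₜ[ℂ] g) ⊗ₜ[ℂ] X) = (holPd (α, α') f ⊗ₜ[ℂ] g) ⊗ₜ[ℂ] X := rfl

theorem br_tmul (f f' : Hol U) (g g' : Gr N) (X X' : 𝔤) :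
    br ((f ⊗ₜ[ℂ] g) ⊗ₜ[ℂ] X) ((f' ⊗ₜ[ℂ] g') ⊗ₜ[ℂ] X') =
      ((f * f') ⊗ₜ[ℂ] (g * g')) ⊗ₜ[ℂ] ⁅X, X'⁆ := by
  rw [br, TensorProduct.map₂_apply_tmul, TensorProduct.map_tmul, LinearMap.mul_apply',
    Algebra.TensorProduct.tmul_mul_tmul]
  rfl

theorem onGr_onGr (T T' : Gr N →ₗ[ℂ] Gr N) (x : SuperField N U 𝔤) :
    onGr T (onGr T' x) = onGr (T ∘ₗ T') x := by
  induction x using superField_induction with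
  | hadd x y hx hy => simp only [map_add, hx, hy]
  | htmul f g X => rfl

theorem onGr_id (x : SuperField N U 𝔤) : onGr LinearMap.id x = x := by
  induction x using superField_induction with
  | hadd x y hx hy => simp only [map_add, hx, hy]
  | htmul f g X => rfl

theorem onGr_neg (T : Gr N →ₗ[ℂ] Gr N) (x : SuperField N U 𝔤) : onGr (-T) x = -onGr T x := by
  simp [onGr, LinearMap.lTensor_neg, LinearMap.rTensor_neg]

theorem onGr_sub (T T' : Gr N →ₗ[ℂ] Gr N) (x : SuperField N U 𝔤) :
    onGr (T - T') x = onGr T x - onGr T' x := by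
  simp [onGr, LinearMap.lTensor_sub, LinearMap.rTensor_sub]

theorem onGr_zero (x : SuperField N U 𝔤) : onGr 0 x = 0 := by
  simp [onGr]

theorem dx_onGr (α α' : Fin 2) (T : Gr N →ₗ[ℂ] Gr N) (x : SuperField N U 𝔤) :
    dx α α' (onGr T x) = onGr T (dx α α' x) := by
  induction x using superField_induction with
  | hadd x y hx hy => simp only [map_add, hx, hy]
  | htmul f g X => rfl

theorem onGr_congr {T T' : Gr N →ₗ[ℂ] Gr N} (h : ∀ g, T g = T' g) (x : SuperField N U 𝔤) :
    onGr T x = onGr T' x := by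
  rw [LinearMap.ext h]

theorem parity_tmul (f : Hol U) (g : Gr N) (X : 𝔤) :
    parity ((f ⊗ₜ[ℂ] g) ⊗ₜ[ℂ] X) = (f ⊗ₜ[ℂ] CliffordAlgebra.involute g) ⊗ₜ[ℂ] X := rfl

theorem parity_parity (x : SuperField N U 𝔤) : parity (parity x) = x := by
  induction x using superField_induction with
  | hadd x y hx hy => simp only [map_add, hx, hy]
  | htmul f g X => rw [parity_tmul, parity_tmul, CliffordAlgebra.involute_involute]

theorem onGr_br (T : Gr N →ₐ[ℂ] Gr N) (x y : SuperField N U 𝔤) :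
    onGr T.toLinearMap (br x y) = br (onGr T.toLinearMap x) (onGr T.toLinearMap y) := by
  induction x using superField_induction with
  | hadd x x' hx hx' => simp only [map_add, LinearMap.add_apply, hx, hx']
  | htmul f g X =>
    induction y using superField_induction with
    | hadd y y' hy hy' => simp only [map_add, hy, hy']
    | htmul f' g' X' =>
      simp only [br_tmul, onGr_tmul, AlgHom.toLinearMap_apply, map_mul]

theorem add_parity_tmul (f : Hol U) (g : Gr N) (X : 𝔤) :
    (f ⊗ₜ[ℂ] g) ⊗ₜ[ℂ] X + parity ((f ⊗ₜ[ℂ] g) ⊗ₜ[ℂ] X) =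
      (f ⊗ₜ[ℂ] (g + CliffordAlgebra.involute g)) ⊗ₜ[ℂ] X := by
  rw [parity_tmul, ← TensorProduct.add_tmul, ← TensorProduct.tmul_add]

theorem sub_parity_tmul (f : Hol U) (g : Gr N) (X : 𝔤) :
    (f ⊗ₜ[ℂ] g) ⊗ₜ[ℂ] X - parity ((f ⊗ₜ[ℂ] g) ⊗ₜ[ℂ] X) =
      (f ⊗ₜ[ℂ] (g - CliffordAlgebra.involute g)) ⊗ₜ[ℂ] X := by
  rw [parity_tmul, ← TensorProduct.sub_tmul, ← TensorProduct.tmul_sub]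

/-- An even field is half the sum of itself and its parity transform, so it suffices to treat pure
tensors whose Grassmann factor is central. -/
theorem even_induction {P : SuperField N U 𝔤 → Prop} (hadd : ∀ x y, P x → P y → P (x + y))
    (hsmul : ∀ x, P x → P ((1 / 2 : ℂ) • x))
    (htmul : ∀ (f : Hol U) (g : Gr N) (X : 𝔤), (∀ h, g * h = h * g) → P ((f ⊗ₜ[ℂ] g) ⊗ₜ[ℂ] X))
    (x : SuperField N U 𝔤) (hx : parity x = x) : P x := by
  have h : P (x + parity x) := by
    clear hx
    induction x using superField_induction with
    | hadd x y hx hy => rw [map_add, add_add_add_comm]; exact hadd _ _ hx hy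
    | htmul f g X => rw [add_parity_tmul]; exact htmul _ _ _ (even_mul_comm g)
  rw [hx, ← two_smul ℂ] at h
  have := hsmul _ h
  rwa [smul_smul, one_div, inv_mul_cancel₀ two_ne_zero, one_smul] at this

theorem odd_induction {P : SuperField N U 𝔤 → Prop} (hadd : ∀ x y, P x → P y → P (x + y))
    (hsmul : ∀ x, P x → P ((1 / 2 : ℂ) • x))
    (htmul : ∀ (f : Hol U) (g : Gr N) (X : 𝔤), P ((f ⊗ₜ[ℂ] (g - CliffordAlgebra.involute g)) ⊗ₜ[ℂ] X))
    (x : SuperField N U 𝔤) (hx : parity x = -x) : P x := by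
  have h : P (x - parity x) := by
    clear hx
    induction x using superField_induction with
    | hadd x y hx hy => rw [map_add, add_sub_add_comm]; exact hadd _ _ hx hy
    | htmul f g X => rw [sub_parity_tmul]; exact htmul _ _ _
  rw [hx, sub_neg_eq_add, ← two_smul ℂ] at h
  have := hsmul _ h
  rwa [smul_smul, one_div, inv_mul_cancel₀ two_ne_zero, one_smul] at this

theorem br_skew (x y : SuperField N U 𝔤) (hx : parity x = x) : br x y = -br y x := by
  refine even_induction (P := fun x => br x y = -br y x) ?_ ?_ ?_ x hx
  · intro x x' hx hx'
    simp only [map_add, LinearMap.add_apply, hx, hx']; abel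
  · intro x hx
    simp only [map_smul, LinearMap.smul_apply, hx]; module
  · intro f g X hg
    induction y using superField_induction with
    | hadd y y' hy hy' => simp only [map_add, LinearMap.add_apply, hy, hy']; abel
    | htmul f' g' X' =>
      rw [br_tmul, br_tmul, mul_comm f, hg, ← lie_skew X X', TensorProduct.tmul_neg]

theorem br_symm (x y : SuperField N U 𝔤) (hx : parity x = -x) (hy : parity y = -y) :
    br x y = br y x := by
  refine odd_induction (P := fun x => br x y = br y x) ?_ ?_ ?_ x hx
  · intro x x' hx hx'
    simp only [map_add, LinearMap.add_apply, hx, hx']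
  · intro x hx
    simp only [map_smul, LinearMap.smul_apply, hx]
  · intro f g X
    let x : SuperField N U 𝔤 := ((f ⊗ₜ[ℂ] (g - CliffordAlgebra.involute g)) ⊗ₜ[ℂ] X)
    refine odd_induction (P := fun y => br x y = br y x) ?_ ?_ ?_ y hy
    · intro y y' hy hy'
      simp only [map_add, LinearMap.add_apply, hy, hy']
    · intro y hy
      simp only [map_smul, LinearMap.smul_apply, hy]
    · intro f' g' X'
      rw [br_tmul, br_tmul, mul_comm f, odd_mul_odd, ← lie_skew X X', TensorProduct.tmul_neg,
        TensorProduct.tmul_neg, TensorProduct.neg_tmul, neg_neg]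

theorem br_jacobi_even (x y z : SuperField N U 𝔤) (hx : parity x = x) :
    br x (br y z) = br (br x y) z + br y (br x z) := by
  refine even_induction (P := fun x => br x (br y z) = br (br x y) z + br y (br x z)) ?_ ?_ ?_ x hx
  · intro x x' hx hx'
    simp only [map_add, LinearMap.add_apply, hx, hx']; abel
  · intro x hx
    simp only [map_smul, LinearMap.smul_apply, hx]; module
  · intro f g X hg
    induction y using superField_induction with
    | hadd y y' hy hy' => simp only [map_add, LinearMap.add_apply, hy, hy']; abel
    | htmul f' g' Y =>
      induction z using superField_induction with
      | hadd z z' hz hz' => simp only [map_add, hz, hz']; abel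
      | htmul f'' g'' Z =>
        simp only [br_tmul]
        rw [← mul_assoc g', ← hg g', mul_assoc g, mul_assoc f f', mul_left_comm f' f,
          leibniz_lie X Y Z, TensorProduct.tmul_add]

theorem br_jacobi_odd (x y z : SuperField N U 𝔤) (hx : parity x = -x) (hy : parity y = -y) :
    br x (br y z) = br (br x y) z - br y (br x z) := by
  refine odd_induction (P := fun x => br x (br y z) = br (br x y) z - br y (br x z)) ?_ ?_ ?_ x hx
  · intro x x' hx hx'
    simp only [map_add, LinearMap.add_apply, hx, hx']; abel
  · intro x hx
    simp only [map_smul, LinearMap.smul_apply, hx]; module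
  · intro f g X
    let x : SuperField N U 𝔤 := ((f ⊗ₜ[ℂ] (g - CliffordAlgebra.involute g)) ⊗ₜ[ℂ] X)
    refine odd_induction (P := fun y => br x (br y z) = br (br x y) z - br y (br x z)) ?_ ?_ ?_ y hy
    · intro y y' hy hy'
      simp only [map_add, LinearMap.add_apply, hy, hy']; abel
    · intro y hy
      simp only [map_smul, LinearMap.smul_apply, hy]; module
    · intro f' g' Y
      induction z using superField_induction with
      | hadd z z' hz hz' => simp only [map_add, hz, hz']; abel
      | htmul f'' g'' Z =>
        simp only [x, br_tmul]
        rw [← mul_assoc (g' - _), odd_mul_odd g' g, neg_mul, mul_assoc (g - _), mul_assoc f f',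
          mul_left_comm f' f, leibniz_lie X Y Z, TensorProduct.tmul_add, TensorProduct.tmul_neg,
          TensorProduct.neg_tmul, sub_neg_eq_add]

theorem dx_br (α α' : Fin 2) (x y : SuperField N U 𝔤) :
    dx α α' (br x y) = br (dx α α' x) y + br x (dx α α' y) := by
  induction x using superField_induction with
  | hadd x x' hx hx' => simp only [map_add, LinearMap.add_apply, hx, hx']; abel
  | htmul f g X =>
    induction y using superField_induction with
    | hadd y y' hy hy' => simp only [map_add, hy, hy']; abel
    | htmul f' g' X' =>
      simp only [br_tmul, dx_tmul]
      rw [holPd_mul, TensorProduct.add_tmul, TensorProduct.add_tmul]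

theorem dth_br (a : Fin 4) (α : Fin 2) (x y : SuperField N U 𝔤) :
    dth a α (br x y) = br (dth a α x) y + br (parity x) (dth a α y) := by
  induction x using superField_induction with
  | hadd x x' hx hx' => simp only [map_add, LinearMap.add_apply, hx, hx']; abel
  | htmul f g X =>
    induction y using superField_induction with
    | hadd y y' hy hy' => simp only [map_add, hy, hy']; abel
    | htmul f' g' X' =>
      simp only [br_tmul, dth, onGr_tmul, parity_tmul]
      rw [contractLeft_mul, TensorProduct.tmul_add, TensorProduct.add_tmul]

theorem th_br (a : Fin 4) (α : Fin 2) (x y : SuperField N U 𝔤) :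
    th a α (br x y) = br (th a α x) y := by
  induction x using superField_induction with
  | hadd x x' hx hx' => simp only [map_add, LinearMap.add_apply, hx, hx']
  | htmul f g X =>
    induction y using superField_induction with
    | hadd y y' hy hy' => simp only [map_add, hy, hy']
    | htmul f' g' X' =>
      simp only [br_tmul, th, onGr_tmul, LinearMap.mulLeft_apply, mul_assoc]

theorem br_th (a : Fin 4) (α : Fin 2) (x y : SuperField N U 𝔤) :
    br x (th a α y) = th a α (br (parity x) y) := by
  induction x using superField_induction with
  | hadd x x' hx hx' => simp only [map_add, LinearMap.add_apply, hx, hx']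
  | htmul f g X =>
    induction y using superField_induction with
    | hadd y y' hy hy' => simp only [map_add, hy, hy']
    | htmul f' g' X' =>
      simp only [br_tmul, th, onGr_tmul, LinearMap.mulLeft_apply, parity_tmul]
      rw [← mul_assoc, mul_ext_ι, mul_assoc]

theorem body_br (x y : SuperField N U 𝔤) : body (br x y) = br (body x) (body y) := onGr_br _ x y

theorem sub_body_mem (x : SuperField N U 𝔤) :
    x - body x ∈ ⨆ i : Fin 4 × Fin 2, LinearMap.range (th (N := N) (U := U) (𝔤 := 𝔤) i.1 i.2) := by
  induction x using superField_induction with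
  | hadd x y hx hy => rw [map_add, add_sub_add_comm]; exact add_mem hx hy
  | htmul f g X =>
    let m : Gr N →ₗ[ℂ] SuperField N U 𝔤 :=
      (TensorProduct.mk ℂ (SuperFun N U) 𝔤).flip X ∘ₗ TensorProduct.mk ℂ (Hol U) (Gr N) f
    have h := sub_map_mem (V := Fin N ⊕ (Fin 4 × Fin 2) → ℂ)
      (p := LinearMap.pi (Sum.elim (fun i => LinearMap.proj (Sum.inl i)) fun _ => 0))
      (e := fun i : Fin 4 × Fin 2 => Pi.single (Sum.inr i) 1) (c := fun i v => v (Sum.inr i))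
      (fun v => by
        ext j
        rcases j with j | j
        · simp
        · simp [Pi.single_apply, Sum.inr.injEq]) g
    have h1 : (f ⊗ₜ[ℂ] g) ⊗ₜ[ℂ] X - body ((f ⊗ₜ[ℂ] g) ⊗ₜ[ℂ] X) = m (g - ExteriorAlgebra.map
        (LinearMap.pi (Sum.elim (fun i => LinearMap.proj (Sum.inl i)) fun _ => 0)) g) := by
      rw [map_sub]; rfl
    rw [h1]
    have h2 := Submodule.mem_map_of_mem (f := m) h
    rw [Submodule.map_iSup] at h2
    have h3 : ∀ i : Fin 4 × Fin 2, (LinearMap.range (LinearMap.mulLeft ℂ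
        (ExteriorAlgebra.ι ℂ (Pi.single (M := fun _ : Fin N ⊕ (Fin 4 × Fin 2) => ℂ)
          (Sum.inr i) 1)))).map m ≤ LinearMap.range (th (N := N) (U := U) (𝔤 := 𝔤) i.1 i.2) := by
      rintro i _ ⟨_, ⟨y, rfl⟩, rfl⟩
      exact ⟨(f ⊗ₜ[ℂ] y) ⊗ₜ[ℂ] X, rfl⟩
    exact iSup_mono h3 h2

variable (N U 𝔤) in
/-- The calculus of super-fields on chiral superspace. -/
def superCalc : SuperCalc (SuperField N U 𝔤) where
  br := br
  par := parity
  par_par := parity_parity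
  par_br := onGr_br _
  skew := br_skew
  symm := br_symm
  jacobi_even := br_jacobi_even
  jacobi_odd := br_jacobi_odd
  dx := dx
  dth := dth
  th := th
  body := body
  dx_br := dx_br
  dx_dx α α' β β' x := by
    induction x using superField_induction with
    | hadd x y hx hy => simp only [map_add, hx, hy]
    | htmul f g X => simp only [dx_tmul]; rw [holPd_comm]
  par_dx α α' x := (dx_onGr α α' _ x).symm
  dx_th α α' a β x := dx_onGr α α' _ x
  dx_dth α α' a β x := dx_onGr α α' _ x
  dth_br := dth_br
  dth_dth a α b β x := by
    rw [dth, dth, onGr_onGr, onGr_onGr, ← onGr_neg]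
    refine onGr_congr (fun g => ?_) x
    exact CliffordAlgebra.contractLeft_comm (Q := (0 : QuadraticForm ℂ (Fin N ⊕ (Fin 4 × Fin 2) → ℂ)))
      _ _ g
  par_dth a α x := by
    rw [dth, parity, onGr_onGr, onGr_onGr, ← onGr_neg]
    refine onGr_congr (fun g => ?_) x
    exact involute_contractLeft _ _
  th_br := th_br
  br_th := br_th
  th_th a α b β x := by
    rw [th, th, onGr_onGr, onGr_onGr, ← onGr_neg]
    refine onGr_congr (fun g => ?_) x
    exact ext_ι_mul_swap _ _ _
  par_th a α x := by
    rw [th, parity, onGr_onGr, onGr_onGr, ← onGr_neg]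
    refine onGr_congr (fun g => ?_) x
    simp only [LinearMap.comp_apply, LinearMap.mulLeft_apply, AlgHom.toLinearMap_apply, map_mul,
      LinearMap.neg_apply]
    rw [involute_ext_ι, neg_mul]
  dth_th a α b β x := by
    have h : onGr (CliffordAlgebra.contractLeft (LinearMap.proj (Sum.inr (a, α))) ∘ₗ
          LinearMap.mulLeft ℂ (ExteriorAlgebra.ι ℂ (Pi.single (Sum.inr (b, β)) 1))) x =
        onGr ((if a = b ∧ α = β then LinearMap.id else 0) -
          LinearMap.mulLeft ℂ (ExteriorAlgebra.ι ℂ (Pi.single (Sum.inr (b, β)) 1)) ∘ₗ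
          CliffordAlgebra.contractLeft (LinearMap.proj (Sum.inr (a, α)))) x :=
      onGr_congr (fun g => by
        have h := contractLeft_ext_ι_mul (V := Fin N ⊕ (Fin 4 × Fin 2) → ℂ)
          (LinearMap.proj (Sum.inr (a, α))) (Pi.single (Sum.inr (b, β)) 1) g
        refine h.trans ?_
        split_ifs with hab
        · obtain ⟨rfl, rfl⟩ := hab
          simp
        · have : (a, α) ≠ (b, β) := fun h => hab (Prod.mk.inj h)
          simp [this]) x
    rw [dth, th, onGr_onGr, onGr_onGr, h, onGr_sub]
    congr 1
    split_ifs
    · exact onGr_id x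
    · exact onGr_zero x
  body_br := body_br
  body_dx α α' x := (dx_onGr α α' _ x).symm
  body_th a α x := by
    rw [body, th, onGr_onGr, ← onGr_zero x]
    refine onGr_congr (fun g => ?_) x
    simp only [LinearMap.comp_apply, LinearMap.mulLeft_apply, AlgHom.toLinearMap_apply, map_mul,
      LinearMap.zero_apply, ExteriorAlgebra.map_apply_ι]
    have : (LinearMap.pi (Sum.elim (fun i => LinearMap.proj (Sum.inl i)) fun _ => 0) :
        (Fin N ⊕ (Fin 4 × Fin 2) → ℂ) →ₗ[ℂ] Fin N ⊕ (Fin 4 × Fin 2) → ℂ)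
        (Pi.single (Sum.inr (a, α)) 1) = 0 := by
      ext j
      rcases j with j | j <;> simp
    rw [this, map_zero, zero_mul]
  dth_body a α x := by
    rw [dth, body, onGr_onGr, ← onGr_zero x]
    refine onGr_congr (fun g => ?_) x
    exact contractLeft_map (fun v => by simp) g
  sub_body_mem := sub_body_mem

end ChiralSuperspace

namespace ChiralSuperspace

/-! ### Comparison of the abstract with the concrete calculus -/

variable {N : ℕ} {U : Opens Spacetime} {𝔤 : Type*} [LieRing 𝔤] [LieAlgebra ℂ 𝔤]

/-- The components of a super-connection. -/
def SuperConnection.toConn (A : SuperConnection N U 𝔤) : Conn (SuperField N U 𝔤) := ⟨A.bos, A.fer⟩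

/-- The components of a multiplet. -/
def Multiplet.toFields (Φ : Multiplet N U 𝔤) : Fields (SuperField N U 𝔤) :=
  ⟨Φ.psiT, Φ.phi, Φ.psi, Φ.B⟩

variable {A : SuperConnection N U 𝔤} {Φ : Multiplet N U 𝔤} {lam : ℂ} {ω : SuperField N U 𝔤}

theorem superCalc_thLow (a : Fin 4) (α : Fin 2) (f : SuperField N U 𝔤) :
    (superCalc N U 𝔤).thLow a α f = thLow a α f := SuperCalc.thLow_apply _ _ _

theorem superCalc_euler (f : SuperField N U 𝔤) : (superCalc N U 𝔤).euler f = euler f :=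
  SuperCalc.euler_apply _

theorem gradedConn_iff : (superCalc N U 𝔤).GradedConn A.toConn ↔ A.IsGraded :=
  ⟨fun h => ⟨h.bos_even, h.fer_odd⟩, fun h => ⟨h.bos_even, h.fer_odd⟩⟩

theorem graded_iff : (superCalc N U 𝔤).Graded Φ.toFields ↔ Φ.IsGraded :=
  ⟨fun h => ⟨h.psiT_odd, h.phi_even, h.psi_odd, h.B_even, h.phi_skew, h.B_symm⟩,
    fun h => ⟨h.psiT_odd, h.phi_even, h.psi_odd, h.B_even, h.phi_skew, h.B_symm⟩⟩

theorem constr_iff : (superCalc N U 𝔤).Constr lam A.toConn ↔ ConstraintEquations lam A :=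
  ⟨fun h => ⟨h.fermi_bose, h.fermi_fermi, h.asd⟩, fun h => ⟨h.fermi_bose, h.fermi_fermi, h.asd⟩⟩

theorem rel_iff :
    (superCalc N U 𝔤).Rel lam A.toConn Φ.toFields ↔ SuperfieldRelations lam A Φ where
  mp h :=
    { radial_curvFB := fun β β' => by
        have := h.curvFB β β'
        simp only [superCalc_thLow] at this
        exact this
      radial_curvFF := fun b β => by
        have := h.curvFF b β
        simp only [superCalc_thLow] at this
        exact this
      der_Ftilde := h.Ft
      der_psiT := h.psiT
      der_phi := h.phi
      der_psi := h.psi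
      der_B := h.B
      asd := h.asd }
  mpr h :=
    { curvFB := fun β β' => by
        simp only [superCalc_thLow]
        exact h.radial_curvFB β β'
      curvFF := fun b β => by
        simp only [superCalc_thLow]
        exact h.radial_curvFF b β
      Ft := h.der_Ftilde
      psiT := h.der_psiT
      phi := h.der_phi
      psi := h.der_psi
      B := h.der_B
      asd := h.asd }

theorem boxD_covB (B : Fin 2 → Fin 2 → SuperField N U 𝔤) (f : SuperField N U 𝔤) :
    SuperLie.boxD ((superCalc N U 𝔤).covB B) f = box B f := by
  simp only [SuperLie.boxD, LinearMap.sum_apply, LinearMap.smul_apply, LinearMap.comp_apply]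
  rfl

theorem fe_iff {B : Fin 2 → Fin 2 → SuperField N U 𝔤} :
    (superCalc N U 𝔤).FE lam B Φ.toFields ↔ FieldEquations lam B Φ where
  mp h :=
    { eq_B := fun α α' => by
        have := eq_neg_of_add_eq_zero_left
          ((add_assoc _ _ _).symm.trans (h.B α α'))
        rw [neg_add, ← sub_eq_add_neg] at this
        exact this
      eq_psiT := fun a α => sub_eq_zero.1 (h.psiT a α)
      eq_phi := fun a b => (boxD_covB B _).symm.trans (sub_eq_zero.1 (h.phi a b))
      eq_psi := fun a α' => sub_eq_zero.1 (h.psi a α')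
      asd := fun α β => sub_eq_zero.1 (h.asd α β) }
  mpr h :=
    { B := fun α α' => by
        have := h.eq_B α α'
        rw [sub_eq_add_neg, ← neg_add, eq_neg_iff_add_eq_zero, ← add_assoc] at this
        exact this
      psiT := fun a α => sub_eq_zero.2 (h.eq_psiT a α)
      phi := fun a b => sub_eq_zero.2 ((boxD_covB B _).trans (h.eq_phi a b))
      psi := fun a α' => sub_eq_zero.2 (h.eq_psi a α')
      asd := fun α β => sub_eq_zero.2 (h.asd α β) }

/-- The right-hand sides of the recursion relations for the multiplet. -/
def recRhs (A : SuperConnection N U 𝔤) (Φ : Multiplet N U 𝔤) : Multiplet N U 𝔤 where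
  psiT a α' := -(2 : ℂ) • ∑ b, ∑ α, th b α (covB A.bos α α' (Φ.phi a b))
  phi a b := ∑ c, ∑ d, eps4 a b c d • ∑ α, th c α (Φ.psi d α)
  psi a α := ∑ β, th a β (Φ.B α β) - ∑ b, ∑ c, thLow b α (br (Φ.phi b c) (upper Φ.phi a c))
  B α β := -(2 : ℂ) • (1 / 2 : ℂ) • ∑ a, ∑ b,
    (thLow a α (br (Φ.psi b β) (Φ.phi a b)) + thLow a β (br (Φ.psi b α) (Φ.phi a b)))

/-- The right-hand sides of the recursion relations for the connection. -/
def recRhsConn (Φ : Multiplet N U 𝔤) : SuperConnection N U 𝔤 where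
  bos α α' := ∑ a, thLow a α (Φ.psiT a α')
  fer a α := (2 : ℂ) • ∑ b, thLow b α (Φ.phi b a)

theorem rhs_toConn (A : SuperConnection N U 𝔤) (Φ : Multiplet N U 𝔤) :
    (superCalc N U 𝔤).rhs A.toConn Φ.toFields = (recRhs A Φ).toFields := by
  simp only [SuperCalc.rhs, superCalc_thLow]
  rfl

theorem rhsConn_toFields (Φ : Multiplet N U 𝔤) :
    (superCalc N U 𝔤).rhsConn Φ.toFields = (recRhsConn Φ).toConn := by
  simp only [SuperCalc.rhsConn, superCalc_thLow]
  rfl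

theorem rec_of_recursionRelations (h : RecursionRelations lam A Φ) :
    (superCalc N U 𝔤).Rec A.toConn Φ.toFields := by
  constructor <;> simp only [superCalc_euler, rhs_toConn, rhsConn_toFields]
  · exact h.rec_psiT
  · exact h.rec_phi
  · exact h.rec_psi
  · exact h.rec_B
  · exact h.rec_bos
  · exact h.rec_fer

theorem rec_euler_Ftilde (hr : IsRadial A) (h : (superCalc N U 𝔤).Rel lam A.toConn Φ.toFields)
    (α' β' : Fin 2) : euler (Ftilde A.bos α' β') = ∑ a, ∑ α, th a α
      ((1 / 2 : ℂ) • (covB A.bos α α' (Φ.psiT a β') + covB A.bos α β' (Φ.psiT a α'))) := by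
  have hr' : ∑ a, ∑ α, (superCalc N U 𝔤).th a α (A.toConn.fer a α) = 0 := hr
  have h1 := SuperCalc.Rel.euler_Ft hr' h α' β'
  rw [superCalc_euler] at h1
  exact h1

/-- The recursion relations for `F̃` and `F` are not integrated; they are consequences of the
super-field relations. -/
theorem recursionRelations_of_rel (hr : IsRadial A)
    (hr' : (superCalc N U 𝔤).Rec A.toConn Φ.toFields)
    (h : (superCalc N U 𝔤).Rel lam A.toConn Φ.toFields) : RecursionRelations lam A Φ := by
  have hF := rec_euler_Ftilde hr h
  have hasd : ∀ α β, euler (Fasd A.bos α β) = lam • euler (Φ.B α β) := fun α β => by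
    rw [← superCalc_euler, ← superCalc_euler, ← map_smul]
    exact congrArg _ (h.asd α β)
  obtain ⟨h1, h2, h3, h4, h5, h6⟩ := hr'
  simp only [superCalc_euler, rhs_toConn, rhsConn_toFields] at h1 h2 h3 h4 h5 h6
  exact ⟨hF, h1, h2, h3, h4, hasd, h5, h6⟩

theorem superCalc_gaugeAd (ω f : SuperField N U 𝔤) :
    (superCalc N U 𝔤).gaugeAd ω f = gaugeAd ω f := expSum_apply _ _ _

theorem superCalc_gaugeInhom (ω f : SuperField N U 𝔤) :
    (superCalc N U 𝔤).gaugeInhom ω f = gaugeInhom ω f := by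
  simp only [SuperCalc.gaugeInhom, LinearMap.neg_apply, LinearMap.sum_apply, LinearMap.smul_apply]
  rfl

theorem gauge_toConn (ω : SuperField N U 𝔤) (A : SuperConnection N U 𝔤) :
    (superCalc N U 𝔤).gauge ω A.toConn = (A.gauge ω).toConn := by
  simp only [SuperCalc.gauge, superCalc_gaugeAd, superCalc_gaugeInhom]
  rfl

theorem map_gaugeAd_toFields (ω : SuperField N U 𝔤) (Φ : Multiplet N U 𝔤) :
    Φ.toFields.map ((superCalc N U 𝔤).gaugeAd ω) = (Φ.map (gaugeAd ω)).toFields := by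
  simp only [Fields.map, superCalc_gaugeAd]
  rfl

theorem isGaugeParameter_iff : IsGaugeParameter ω ↔ parity ω = ω ∧ ω ∈ (superCalc N U 𝔤).fil 1 :=
  and_congr_right fun _ => SuperCalc.body_eq_zero_iff (S := superCalc N U 𝔤)

/-- The field equations at `θ = 0` say that the defects of the super-fields have positive degree,
which is the initial condition for their propagation. -/
theorem rel_of_body (hA : A.IsGraded) (hΦ : Φ.IsGraded) (hr : IsRadial A)
    (h : (superCalc N U 𝔤).Rec A.toConn Φ.toFields)
    (h0 : FieldEquations lam (fun α α' => body (A.bos α α')) (Φ.map body)) :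
    (superCalc N U 𝔤).Rel lam A.toConn Φ.toFields := by
  have h1 : (superCalc N U 𝔤).FE lam
      (fun α α' => (superCalc N U 𝔤).body (A.toConn.bos α α'))
      (Φ.toFields.map (superCalc N U 𝔤).body) := (fe_iff (Φ := Φ.map body)).2 h0
  have h2 := SuperCalc.feMod_one_of_body h1
  have hr' : ∑ a, ∑ α, (superCalc N U 𝔤).th a α (A.toConn.fer a α) = 0 := hr
  have hΦ' := graded_iff.2 hΦ
  exact (h.radialRel hΦ' hr').rel (gradedConn_iff.2 hA) hΦ' h2

theorem radialGaugeComponents_iff (hA : A.IsGraded) (hΦ : Φ.IsGraded) :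
    SuperfieldRelations lam A Φ ↔ RadialGaugeComponents lam A Φ := by
  have hA' := gradedConn_iff.2 hA
  have hΦ' := graded_iff.2 hΦ
  have hgauge : ∀ ω, IsGaugeParameter ω → (A.gauge ω).IsGraded ∧ (Φ.map (gaugeAd ω)).IsGraded ∧
      (SuperfieldRelations lam (A.gauge ω) (Φ.map (gaugeAd ω)) ↔ SuperfieldRelations lam A Φ) := by
    intro ω hω
    rw [isGaugeParameter_iff] at hω
    rw [← gradedConn_iff, ← graded_iff, ← rel_iff, ← rel_iff, ← gauge_toConn,
      ← map_gaugeAd_toFields]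
    exact ⟨SuperCalc.gauge_graded hω.1 hA', SuperCalc.map_gaugeAd_graded hω.1 hΦ',
      SuperCalc.rel_gauge_iff hω.2 hω.1 hA'⟩
  constructor
  · intro h
    obtain ⟨ω, hω, hω', hr⟩ := SuperCalc.exists_radial_gauge hA'
    rw [gauge_toConn] at hr
    have hg := isGaugeParameter_iff.2 ⟨hω, hω'⟩
    obtain ⟨hA1, hΦ1, hiff⟩ := hgauge ω hg
    have h1 := rel_iff.2 (hiff.2 h)
    have h2 := (h1.fe (gradedConn_iff.2 hA1) (graded_iff.2 hΦ1)).body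
    exact ⟨ω, hg, hr, recursionRelations_of_rel hr
      (h1.radialRel.toRec (graded_iff.2 hΦ1) hr) h1,
      (fe_iff (Φ := (Φ.map (gaugeAd ω)).map body)).1 h2⟩
  · rintro ⟨ω, hg, hr, hrec, hfe⟩
    obtain ⟨hA1, hΦ1, hiff⟩ := hgauge ω hg
    exact hiff.1 (rel_iff.1 (rel_of_body hA1 hΦ1 hr (rec_of_recursionRelations hrec) hfe))

theorem constraintEquations_iff (hA : A.IsGraded) (hΦ : Φ.IsGraded) :
    ConstraintEquations lam A ∧ Φ = A.multiplet ↔ SuperfieldRelations lam A Φ := by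
  constructor
  · rintro ⟨h, rfl⟩
    exact rel_iff.1 (SuperCalc.Constr.rel (gradedConn_iff.2 hA) (graded_iff.2 hΦ) (constr_iff.2 h))
  · intro h
    obtain ⟨h1, h2, h3, h4, h5⟩ := (rel_iff.2 h).constr (gradedConn_iff.2 hA) (graded_iff.2 hΦ)
    exact ⟨constr_iff.1 h1, Multiplet.ext (funext₂ h2) (funext₂ h3) (funext₂ h4) (funext₂ h5)⟩

theorem isRadial_iff :
    ∑ a, ∑ α, (superCalc N U 𝔤).th a α (A.toConn.fer a α) = 0 ↔ IsRadial A := Iff.rfl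

theorem map_body_toFields (Φ : Multiplet N U 𝔤) :
    Φ.toFields.map (superCalc N U 𝔤).body = (Φ.map body).toFields := rfl

theorem toFields_injective :
    Function.Injective (Multiplet.toFields : Multiplet N U 𝔤 → Fields (SuperField N U 𝔤)) :=
  fun _ _ h => Multiplet.ext (congrArg Fields.psiT h) (congrArg Fields.phi h)
    (congrArg Fields.psi h) (congrArg Fields.B h)

theorem toConn_injective :
    Function.Injective (SuperConnection.toConn : SuperConnection N U 𝔤 → Conn (SuperField N U 𝔤)) :=
  fun _ _ h => SuperConnection.ext (congrArg Conn.bos h) (congrArg Conn.fer h)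

theorem existsUnique_rec_superField {A₀ : Fin 2 → Fin 2 → SuperField N U 𝔤} {Φ₀ : Multiplet N U 𝔤}
    (h : IsComponentFields A₀ Φ₀) :
    ∃! p : SuperConnection N U 𝔤 × Multiplet N U 𝔤, p.1.IsGraded ∧ p.2.IsGraded ∧
      (superCalc N U 𝔤).Rec p.1.toConn p.2.toFields ∧
      (∀ α α', body (p.1.bos α α') = A₀ α α') ∧ p.2.map body = Φ₀ := by
  have h1 : Φ₀.toFields.map (superCalc N U 𝔤).body = Φ₀.toFields :=
    congrArg Multiplet.toFields h.body_fields
  have h2 : ∀ α α', (superCalc N U 𝔤).body (A₀ α α') = A₀ α α' := h.body_conn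
  have h3 : ∀ α α', (superCalc N U 𝔤).par (A₀ α α') = A₀ α α' := h.even
  obtain ⟨p, ⟨g1, g2, g3, g4, g5⟩, hp⟩ :=
    SuperCalc.existsUnique_rec h2 h1 h3 (graded_iff.2 h.graded)
  obtain ⟨A, hA⟩ : ∃ A : SuperConnection N U 𝔤, A.toConn = p.1 := ⟨⟨p.1.bos, p.1.fer⟩, rfl⟩
  obtain ⟨Φ, hΦ⟩ : ∃ Φ : Multiplet N U 𝔤, Φ.toFields = p.2 :=
    ⟨⟨p.2.psiT, p.2.phi, p.2.psi, p.2.B⟩, rfl⟩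
  rw [← hA] at g1 g3 g4
  rw [← hΦ] at g2 g3 g5
  rw [map_body_toFields] at g5
  refine ⟨(A, Φ), ⟨gradedConn_iff.1 g1, graded_iff.1 g2, g3, g4, toFields_injective g5⟩, ?_⟩
  rintro ⟨A', Φ'⟩ ⟨k1, k2, k3, k4, k5⟩
  have hk := hp (A'.toConn, Φ'.toFields) ⟨gradedConn_iff.2 k1, graded_iff.2 k2, k3, k4,
    (map_body_toFields Φ').trans (congrArg _ k5)⟩
  exact Prod.ext (toConn_injective ((congrArg Prod.fst hk).trans hA.symm))
    (toFields_injective ((congrArg Prod.snd hk).trans hΦ.symm))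

/-- The recursion relations for the connection and the multiplet already determine the solution and
force radial gauge. The field equations serve to establish the remaining two, for the curvature. -/
theorem existsUnique_radial {A₀ : Fin 2 → Fin 2 → SuperField N U 𝔤} {Φ₀ : Multiplet N U 𝔤}
    (h : IsComponentFields A₀ Φ₀) (h0 : FieldEquations lam A₀ Φ₀) :
    ∃! p : SuperConnection N U 𝔤 × Multiplet N U 𝔤,
      p.1.IsGraded ∧ p.2.IsGraded ∧ IsRadial p.1 ∧ RecursionRelations lam p.1 p.2 ∧
      (∀ α α', body (p.1.bos α α') = A₀ α α') ∧ p.2.map body = Φ₀ := by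
  obtain ⟨⟨A, Φ⟩, ⟨hA, hΦ, hrec, hA₀, hΦ₀⟩, huniq⟩ := existsUnique_rec_superField h
  have hr : IsRadial A := isRadial_iff.1 (SuperCalc.Rec.radial (graded_iff.2 hΦ) hrec)
  have hb : (fun α α' => body (A.bos α α')) = A₀ := funext₂ hA₀
  have hfe : FieldEquations lam (fun α α' => body (A.bos α α')) (Φ.map body) := by
    rw [hb, hΦ₀]; exact h0
  have hrel := rel_of_body hA hΦ hr hrec hfe
  refine ⟨(A, Φ), ⟨hA, hΦ, hr, recursionRelations_of_rel hr hrec hrel, hA₀, hΦ₀⟩, ?_⟩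
  rintro p ⟨g1, g2, -, g4, g5, g6⟩
  exact huniq p ⟨g1, g2, rec_of_recursionRelations g4, g5, g6⟩

end ChiralSuperspace

end

/-! ### The main theorem. -/

theorem mainTheorem7 {𝔤 : Type*} [LieRing 𝔤] [LieAlgebra ℂ 𝔤] [Module.Finite ℂ 𝔤]
    (N : ℕ) (U : TopologicalSpace.Opens Spacetime) (lam : ℂ) :
    (∀ (A : SuperConnection N U 𝔤) (Φ : Multiplet N U 𝔤), A.IsGraded → Φ.IsGraded →
      List.TFAE [
        ConstraintEquations lam A ∧ Φ = A.multiplet,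
        SuperfieldRelations lam A Φ,
        RadialGaugeComponents lam A Φ]) ∧
    (∀ (A : SuperConnection N U 𝔤) (Φ : Multiplet N U 𝔤), A.IsGraded → Φ.IsGraded →
      SuperfieldRelations lam A Φ → FieldEquations lam A.bos Φ) ∧
    (∀ (A₀ : Fin 2 → Fin 2 → SuperField N U 𝔤) (Φ₀ : Multiplet N U 𝔤),
      IsComponentFields A₀ Φ₀ → FieldEquations lam A₀ Φ₀ →
      ∃! p : SuperConnection N U 𝔤 × Multiplet N U 𝔤,
        p.1.IsGraded ∧ p.2.IsGraded ∧ IsRadial p.1 ∧ RecursionRelations lam p.1 p.2 ∧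
        (∀ α α', body (p.1.bos α α') = A₀ α α') ∧ p.2.map body = Φ₀) := by
  refine ⟨fun A Φ hA hΦ => ?_, fun A Φ hA hΦ h => fe_iff.1 ((rel_iff.2 h).fe
    (gradedConn_iff.2 hA) (graded_iff.2 hΦ)), fun A₀ Φ₀ h h0 => existsUnique_radial h h0⟩
  tfae_have 1 ↔ 2 := constraintEquations_iff hA hΦ
  tfae_have 2 ↔ 3 := radialGaugeComponents_iff hA hΦ
  tfae_finish
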